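/- Let $W=(w_1,\dots,w_n)$, $n\ge 3$, be a simple oriented closed polygon on the unit sphere $S^2\subset\mathbb R^3$ (indices mod $n$; consecutive vertices are neither equal nor antipodal, and the edges are the minor great circle arcs $w_iw_{i+1}$). Let $\xi\in S^2$ be admissible for $W$, i.e. $\langle\xi,w_i\rangle=0$ implies $\langle\xi,w_{i-1}\rangle\langle\xi,w_{i+1}\rangle<0$. Let $S(\xi)$ be the great circle with pole $\xi$, and let $i(W,\xi)=1-\#\{i:\langle\xi,w_i\rangle\le0\}+\#\{i:\langle\xi,w_i\rangle\le0,\ \langle\xi,w_{i+1}\rangle\le 0\}$ be the critical point index. Let $w_i'=\frac{w_i\times w_{i+1}}{\|w_i\times w_{i+1}\|}$ be the vertices of the polar polygon. For a great circle arc $\gamma$ from $\xi$ to $-\xi$ that meets no $w'_i$, let $d(W',\gamma)=\sum_i \operatorname{sign}\langle w_i'\times w_{i+1}',\xi\rangle$, the sum being over those $i$ for which the arc $w'_iw'_{i+1}$ meets $\gamma$. A $\xi$-isotopy is a continuous family of simple polygons $W(t)=(w_1(t),\dots,w_n(t))$, $t\in[0,1]$, such that $\langle\xi,w_i(t)\rangle=0$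 if and only if $\langle\xi,w_i(0)\rangle=0$. The $\xi$-isotopy class of $W$ consists of the polygons that can be reached from $W$ by $\xi$-isotopies, renumbering of the vertices (keeping the orientation), insertion of vertices on edges, and deletion of vertices that lie on the minor arc between their neighbours. Suppose $i(W,\xi)=1-r<0$. Let $Y$ be a polygon in the $\xi$-isotopy class of $W$ such that all points of $Y$ on $S(\xi)$ are vertices; these are $2r$ vertices $y_1,\dots,y_{2r}$, numbered in the order of the oriented polygon, such that the parts of $Y$ from $y_{2i+1}$ to $y_{2i+2}$, the chords $[y_{2i+1},y_{2i+2}]$, $0\le i<r$, lie in the hemisphere with pole $\xi$. The numbering is started so that the chord $[y_1,y_2]$ is free, i.e. $y_1$ and $y_2$ are adjacent on $S(\xi)$. The permutation $\Pi\in S_{2r}$ is defined by: $\Pi(k)=l$ if $y_l$ is the $k$-th of these vertices on $S(\xi)$, beginning with $y_1$ and going counterclockwise around $\xi$. Any $\Pi$ that arises in this way, from any such $Y$ and any such free chord, is said to represent the $\xi$-isotopy class of $W$. A chord $[y_{2i+1},y_{2i+2}]$ is positive if $y_{2i+1}$ comes before $y_{2i+2}$ in the order on $S(\xi)$ that begins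 with $y_1$, i.e. $\Pi^{-1}(2i+1)<\Pi^{-1}(2i+2)$, and negative otherwise. Let $N^+(\Pi)$ and $N^-(\Pi)$ be the numbers of positive and negative chords other than $[y_1,y_2]$. Then the $\xi$-isotopy class of $W$ is represented by some permutation, and for every permutation $\Pi$ that represents it, the normal degree $d(W,\xi)$ (the common value of $d(W',\gamma)$ for all great circle arcs $\gamma$ from $\xi$ to $-\xi$ that meet no vertex of $W'$; such arcs exist) equals \[d(W,\xi)=-N^+(\Pi)+N^-(\Pi).\] In particular, $-N^+(\Pi)+N^-(\Pi)$ does not depend on the choice of the free chord $[y_1,y_2]$. -/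

import Mathlib

open Matrix

noncomputable section

/-- Ambient Euclidean space; the scalar product is `⬝ᵥ`, the vector product is `⨯₃`. Points of
the unit sphere are the vectors `v` with `v ⬝ᵥ v = 1`. -/
abbrev V3 : Type := Fin 3 → ℝ

/-- The (minor) great circle arc joining two non-antipodal unit vectors. -/
def sphArc (a b : V3) : Set V3 :=
  {p | p ⬝ᵥ p = 1 ∧ ∃ s t : ℝ, 0 ≤ s ∧ 0 ≤ t ∧ p = s • a + t • b}

/-- The vector `v` divided by its Euclidean length. -/
def unitize (v : V3) : V3 := (Real.sqrt (v ⬝ᵥ v))⁻¹ • v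

/-- An oriented closed spherical polygon with `n` vertices. The vertices are indexed cyclically,
i.e. by the integers with period `n`; consecutive vertices are neither equal nor antipodal, so
each edge is a nondegenerate great circle arc of length less than `π`. -/
structure SphPolygon where
  n : ℕ
  three_le : 3 ≤ n
  w : ℤ → V3
  periodic : ∀ i, w (i + n) = w i
  unit : ∀ i, w i ⬝ᵥ w i = 1
  ne_next : ∀ i, w (i + 1) ≠ w i
  ne_neg_next : ∀ i, w (i + 1) ≠ -w i

namespace SphPolygon

/-- The edge from the `i`-th vertex to the next one. -/
def edge (W : SphPolygon) (i : ℤ) : Set V3 := sphArc (W.w i) (W.w (i + 1))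

/-- The polygon is simple: different edges only meet if they are adjacent, and then only in their
common vertex. -/
def IsSimple (W : SphPolygon) : Prop :=
  ∀ i j : ℤ, ∀ p, p ∈ W.edge i → p ∈ W.edge j →
    i ≡ j [ZMOD W.n] ∨ (j ≡ i + 1 [ZMOD W.n] ∧ p = W.w j) ∨ (i ≡ j + 1 [ZMOD W.n] ∧ p = W.w i)

/-- Admissibility of the direction `ξ`. -/
def IsAdmissible (W : SphPolygon) (ξ : V3) : Prop :=
  ∀ i : ℤ, ξ ⬝ᵥ W.w i = 0 → (ξ ⬝ᵥ W.w (i - 1)) * (ξ ⬝ᵥ W.w (i + 1)) < 0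

open Classical in
/-- The critical point (above) index of the cone vertex `0` of the polyhedral vertex star with
edges `(0, wᵢ)` and triangles `(0, wᵢ, wᵢ₊₁)`: one minus the number of edges plus the number of
triangles on which the height function `⟨ξ, ·⟩` attains its maximum at `0`. -/
def index (W : SphPolygon) (ξ : V3) : ℤ :=
  1 - (((Finset.range W.n).filter fun i : ℕ => ξ ⬝ᵥ W.w i ≤ 0).card : ℤ)
    + (((Finset.range W.n).filter fun i : ℕ =>
        ξ ⬝ᵥ W.w i ≤ 0 ∧ ξ ⬝ᵥ W.w ((i : ℤ) + 1) ≤ 0).card : ℤ)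

/-- The vertices of the polar polygon. -/
def polar (W : SphPolygon) (i : ℤ) : V3 := unitize (W.w i ⨯₃ W.w (i + 1))

end SphPolygon

/-- The great circle arc from `ξ` to `-ξ` through the unit vector `u` orthogonal to `ξ`. -/
def meridian (ξ u : V3) : Set V3 :=
  {p | p ⬝ᵥ p = 1 ∧ ∃ a b : ℝ, 0 ≤ b ∧ p = a • ξ + b • u}

namespace SphPolygon

/-- The unit vector `u` orthogonal to `ξ` determines a great circle arc from `ξ` to `-ξ` that
meets no vertex of the polar polygon. -/
def IsTransversal (W : SphPolygon) (ξ u : V3) : Prop :=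
  u ⬝ᵥ u = 1 ∧ ξ ⬝ᵥ u = 0 ∧ ∀ i : ℤ, W.polar i ∉ meridian ξ u

open Classical in
/-- The algebraic number of crossings of the edges of the polar polygon with the great circle
arc from `ξ` to `-ξ` through `u`. -/
def degreeAlong (W : SphPolygon) (ξ u : V3) : ℤ :=
  ∑ i ∈ Finset.range W.n,
    if (sphArc (W.polar i) (W.polar ((i : ℤ) + 1)) ∩ meridian ξ u).Nonempty then
      (SignType.sign ((W.polar i ⨯₃ W.polar ((i : ℤ) + 1)) ⬝ᵥ ξ) : ℤ)
    else 0

/-- The normal degree of `W` with respect to `ξ` is well defined and equals `d`: there are great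
circle arcs from `ξ` to `-ξ` that avoid the vertices of the polar polygon, and the algebraic
number of crossings with any such arc is `d`. -/
def HasNormalDegree (W : SphPolygon) (ξ : V3) (d : ℤ) : Prop :=
  (∃ u, W.IsTransversal ξ u) ∧ ∀ u, W.IsTransversal ξ u → W.degreeAlong ξ u = d

/-- There is a `ξ`-isotopy from `U` to `V`. -/
def IsIsotopic (ξ : V3) (U V : SphPolygon) : Prop :=
  ∃ F : unitInterval → SphPolygon, F 0 = U ∧ F 1 = V ∧
    (∀ t, (F t).n = U.n) ∧ (∀ i : ℤ, Continuous fun t => (F t).w i) ∧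
    (∀ t, (F t).IsSimple) ∧ ∀ t, ∀ i : ℤ, ξ ⬝ᵥ (F t).w i = 0 ↔ ξ ⬝ᵥ U.w i = 0

/-- `V` is `U` with another starting point of the cyclic enumeration of the vertices. -/
def IsShift (U V : SphPolygon) : Prop :=
  V.n = U.n ∧ ∃ k : ℤ, ∀ i : ℤ, V.w i = U.w (i + k)

/-- `V` is obtained from `U` by inserting one further vertex, on the edge that joins the vertices
with numbers `U.n - 1` and `0`. -/
def IsInsertion (U V : SphPolygon) : Prop :=
  V.n = U.n + 1 ∧ (∀ i : ℤ, 0 ≤ i → i < U.n → V.w i = U.w i) ∧ V.w U.n ∈ U.edge ((U.n : ℤ) - 1)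

/-- Same `ξ`-isotopy class: the equivalence relation generated by `ξ`-isotopies, renumbering,
and subdivision of edges (and, inversely, deletion of non-essential vertices). -/
def SameClass (ξ : V3) : SphPolygon → SphPolygon → Prop :=
  Relation.EqvGen fun U V => IsIsotopic ξ U V ∨ IsShift U V ∨ IsInsertion U V

/-- All points of the polygon on the great circle `S(ξ)` are vertices. -/
def IsSubdivided (W : SphPolygon) (ξ : V3) : Prop :=
  ∀ i : ℤ, ∀ p ∈ W.edge i, ξ ⬝ᵥ p = 0 → p = W.w i ∨ p = W.w (i + 1)

/-- The permutation `σ` of `0, …, 2r - 1` is read off from the polygon `Y`, all of whose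
intersections with `S(ξ)` are vertices. Here `y k = Y.w (c k)`, `k = 0, …, 2r - 1`
(continued with period `2r`), are the vertices on `S(ξ)` in the order of the oriented polygon,
the chords `[y (2i), y (2i+1)]` lie in the hemisphere with pole `ξ`, the chord `[y 0, y 1]` is
free, i.e. `y 0` and `y 1` are adjacent in the cyclic order on `S(ξ)`, and `σ k = l` means
that `y l` is at position `k` (counted from `0`) on `S(ξ)`, beginning with `y 0` and going
counterclockwise around `ξ`; `θ k` is the angle at position `k`. -/
def ReadsOff (Y : SphPolygon) (ξ : V3) (r : ℕ) (σ : Equiv.Perm (Fin (2 * r))) : Prop :=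
  Y.IsSubdivided ξ ∧
  ∃ (c : ℤ → ℤ) (θ : Fin (2 * r) → ℝ),
    StrictMono c ∧ (∀ k, c (k + 2 * r) = c k + Y.n) ∧
    (∀ j : ℤ, ξ ⬝ᵥ Y.w j = 0 ↔ ∃ k, c k = j) ∧
    (∀ i : ℤ, 0 < ξ ⬝ᵥ Y.w (c (2 * i) + 1)) ∧
    StrictMono θ ∧ (∀ k, 0 ≤ θ k ∧ θ k < 2 * Real.pi) ∧
    (∀ k : Fin (2 * r), Y.w (c ((σ k : ℕ) : ℤ)) =
      Real.cos (θ k) • Y.w (c 0) + Real.sin (θ k) • (ξ ⨯₃ Y.w (c 0))) ∧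
    ∃ k : Fin (2 * r), (σ k : ℕ) = 1 ∧ ((k : ℕ) = 1 ∨ (k : ℕ) + 1 = 2 * r)

/-- The permutation `σ` represents the `ξ`-isotopy class of `W`: it can be read off, with some
choice of the free chord, from a polygon in the class (for instance from a polygon made of
once-broken geodesics whose vertices on `S(ξ)` form a regular polygon, or from `W` itself after
subdivision). -/
def IsRepresentedBy (W : SphPolygon) (ξ : V3) (r : ℕ) (σ : Equiv.Perm (Fin (2 * r))) : Prop :=
  ∃ Y : SphPolygon, SameClass ξ W Y ∧ Y.ReadsOff ξ r σ

end SphPolygon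

/-- The label of the first vertex of the `i`-th chord. -/
def chordFst {r : ℕ} (i : Fin r) : Fin (2 * r) := ⟨2 * i, by omega⟩

/-- The label of the second vertex of the `i`-th chord. -/
def chordSnd {r : ℕ} (i : Fin r) : Fin (2 * r) := ⟨2 * i + 1, by omega⟩

/-- The number of positive chords other than the distinguished chord `0`: the first vertex comes
before the second one on `S(ξ)`, in the order that begins with the vertex `0`. -/
def numPos {r : ℕ} (σ : Equiv.Perm (Fin (2 * r))) : ℕ :=
  (Finset.univ.filter fun i : Fin r =>
    (i : ℕ) ≠ 0 ∧ σ.symm (chordFst i) < σ.symm (chordSnd i)).card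

/-- The number of negative chords other than the distinguished chord `0`. -/
def numNeg {r : ℕ} (σ : Equiv.Perm (Fin (2 * r))) : ℕ :=
  (Finset.univ.filter fun i : Fin r =>
    (i : ℕ) ≠ 0 ∧ σ.symm (chordSnd i) < σ.symm (chordFst i)).card

end

/-! The normal degree is a rotation number. Project along `ξ` to the complex plane (`hor`). The
polar vertex w_i' becomes a positive multiple of -i times `secant` of w_i and w_{i+1}, which is, up
to a real factor, the edge direction of the central projection of W to the plane ⟨ξ,·⟩ = 1. By
simplicity and admissibility consecutive directions are never opposite
(`IsSimple.notOpposite_secant`). So the sum `totalTurn` of the angles between them is a multiple of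
2π, and counting passages through a half-line identifies it with 2π d(W',γ) for every γ
(`IsSimple.totalTurn_eq_degreeAlong`). It varies continuously under isotopies, hence is constant,
and renumbering and subdivision do not change it (`SameClass.invariant`). It may therefore be
computed on Y.

On Y, Hopf's proof of the theorem of turning tangents is applied to each chord separately. The
secant is bilinear, and by simplicity it does not vanish for different points of Y in the same open
hemisphere. Deforming the diagonal of the triangle of parameter pairs into the other two sides shows
that the turning of a chord depends on its ends only: it is the angle from y_k to -y_{k+1}
(`IsChordArc.sum_turn`). If φ_k in [0,2π) is the position of y_k, measured from y_0 (numbering from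
0), this angle is φ_{k+1} - φ_k - π sign(φ_{k+1} - φ_k). The differences telescope around the
polygon, so the total turning is -π(U + L), where U and L are the sums of the signs over the upper
and the lower chords.

The same argument on a rectangle, for two chords in one hemisphere, says that their ends are not
interlaced on the great circle, in the form of an identity between signs (`AreDisjointArcs.turn_eq`,
`IsEnumeration.sign_relation`). Adding up these identities with alternating weights gives U - L = 2
(`sum_alternating`). Hence the total turning is 2π(1 - U). The distinguished chord starts at angle 0
and contributes 1 to U, so 1 - U = -N⁺ + N⁻.

For the existence of a permutation, W is cut at the great circle. The index counts the edges that go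
up, so there are 2r crossings, and an upper chord with the least difference of position angles is
free, because chords of one hemisphere are not interlaced. Independence of the free chord follows
since the degree knows nothing of it. -/

/-! ### Oriented angles between complex numbers -/

/-- The oriented angle from `x` to `y`, in `(-π, π]`. -/
noncomputable def turnAngle (x y : ℂ) : ℝ := Complex.arg (starRingEnd ℂ x * y)

/-- `x` and `y` are nonzero and do not point in opposite directions. -/
def NotOpposite (x y : ℂ) : Prop := starRingEnd ℂ x * y ∈ Complex.slitPlane

namespace NotOpposite

lemma left_ne_zero {x y : ℂ} (h : NotOpposite x y) : x ≠ 0 := by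
  rintro rfl
  simp [NotOpposite] at h

lemma right_ne_zero {x y : ℂ} (h : NotOpposite x y) : y ≠ 0 := by
  rintro rfl
  simp [NotOpposite] at h

lemma symm {x y : ℂ} (h : NotOpposite x y) : NotOpposite y x := by
  unfold NotOpposite at *
  rw [Complex.mem_slitPlane_iff] at *
  simp at *
  rcases h with h | h
  · left; linarith
  · right; contrapose! h; linarith

lemma self {x : ℂ} (h : x ≠ 0) : NotOpposite x x := by
  unfold NotOpposite
  rw [Complex.mem_slitPlane_iff, ← Complex.normSq_eq_conj_mul_self]
  left
  simpa using Complex.normSq_pos.2 h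

lemma cone_ne_zero {x y : ℂ} (h : NotOpposite x y) {s t : ℝ} (hs : 0 ≤ s) (ht : 0 ≤ t)
    (hst : 0 < s + t) : (s : ℂ) * x + t * y ≠ 0 := by
  intro h0
  have hx := Complex.normSq_pos.2 h.left_ne_zero
  rcases ht.eq_or_lt with ht0 | ht0
  · subst ht0
    have : (s : ℂ) ≠ 0 := by norm_cast; linarith
    simp [this, h.left_ne_zero] at h0
  · have h1 : (s : ℂ) * Complex.normSq x + t * (starRingEnd ℂ x * y) = 0 := by
      rw [Complex.normSq_eq_conj_mul_self]
      linear_combination (starRingEnd ℂ x) * h0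
    unfold NotOpposite at h
    rw [Complex.mem_slitPlane_iff] at h
    have h2 := congrArg Complex.re h1
    have h3 := congrArg Complex.im h1
    rw [Complex.add_re, ← Complex.ofReal_mul, Complex.ofReal_re, Complex.re_ofReal_mul,
      Complex.zero_re] at h2
    rw [Complex.add_im, ← Complex.ofReal_mul, Complex.ofReal_im, Complex.im_ofReal_mul,
      Complex.zero_im] at h3
    rcases h with h | h
    · nlinarith [mul_pos ht0 h, mul_nonneg hs hx.le]
    · apply h
      have : t * (starRingEnd ℂ x * y).im = 0 := by linarith
      rcases mul_eq_zero.1 this with h | h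
      · linarith
      · exact h

/-- This is how non-opposite directions are obtained from geometry: a bilinear family without zeros
provides the segment. If conj x · y were a nonpositive real number, y would be a nonpositive
multiple of x and the segment would pass through 0. -/
lemma of_segment {x y : ℂ}
    (h : ∀ t : ℝ, 0 ≤ t → t ≤ 1 → ((1 - t : ℝ) : ℂ) * x + (t : ℂ) * y ≠ 0) :
    NotOpposite x y := by
  have hx : x ≠ 0 := by simpa using h 0 le_rfl zero_le_one
  have hN := Complex.normSq_pos.2 hx
  by_contra hno
  unfold NotOpposite at hno
  rw [Complex.mem_slitPlane_iff] at hno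
  push Not at hno
  set c := starRingEnd ℂ x * y with hc
  have hc' : c = (c.re : ℂ) := by apply Complex.ext <;> simp [hno.2]
  have hD : 0 < Complex.normSq x - c.re := by linarith [hno.1]
  -- Here y = (c / |x|²) x, and this is the parameter at which the segment passes through 0.
  refine h (Complex.normSq x / (Complex.normSq x - c.re)) (by positivity)
    (by rw [div_le_one hD]; linarith [hno.1]) ?_
  have hx' : starRingEnd ℂ x ≠ 0 := by simpa using hx
  have hD' : (Complex.normSq x : ℂ) - (c.re : ℂ) ≠ 0 := by
    norm_cast; exact hD.ne'
  apply mul_left_cancel₀ hx'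
  have e1 : starRingEnd ℂ x * x = (Complex.normSq x : ℂ) :=
    (Complex.normSq_eq_conj_mul_self).symm
  have e2 : starRingEnd ℂ x * y = (c.re : ℂ) := by rw [← hc']
  push_cast
  rw [mul_zero, mul_add, mul_left_comm, e1, mul_left_comm, e2]
  field_simp
  ring

lemma smul_smul {x y : ℂ} (h : NotOpposite x y) {s t : ℝ} (hs : 0 < s) (ht : 0 < t) :
    NotOpposite (s * x) (t * y) := by
  apply of_segment
  intro u h0 h1
  have : 0 < (1 - u) * s + u * t := by
    rcases h0.eq_or_lt with h | h
    · subst h; simpa using hs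
    · have := mul_pos h ht
      have := mul_nonneg (sub_nonneg.2 h1) hs.le
      linarith
  have := h.cone_ne_zero (mul_nonneg (sub_nonneg.2 h1) hs.le) (mul_nonneg h0 ht.le) this
  push_cast at this ⊢
  convert this using 1
  ring

end NotOpposite

lemma turnAngle_self (x : ℂ) : turnAngle x x = 0 := by
  unfold turnAngle
  rw [← Complex.normSq_eq_conj_mul_self]
  exact Complex.arg_ofReal_of_nonneg (Complex.normSq_nonneg x)

lemma turnAngle_neg_neg (x y : ℂ) : turnAngle (-x) (-y) = turnAngle x y := by
  simp [turnAngle]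

lemma turnAngle_smul_smul (x y : ℂ) {s t : ℝ} (hs : 0 < s) (ht : 0 < t) :
    turnAngle (s * x) (t * y) = turnAngle x y := by
  unfold turnAngle
  rw [← Complex.arg_real_mul (starRingEnd ℂ x * y) (mul_pos hs ht)]
  congr 1
  push_cast
  rw [map_mul, Complex.conj_ofReal]
  ring

lemma turnAngle_smul_self (x : ℂ) {s t : ℝ} (hs : 0 < s) (ht : 0 < t) :
    turnAngle (s * x) (t * x) = 0 := by
  rw [turnAngle_smul_smul _ _ hs ht, turnAngle_self]

lemma turnAngle_symm {x y : ℂ} (h : NotOpposite x y) : turnAngle y x = -turnAngle x y := by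
  unfold turnAngle
  have h1 : starRingEnd ℂ y * x = starRingEnd ℂ (starRingEnd ℂ x * y) := by
    simp [mul_comm]
  rw [h1, Complex.arg_conj, if_neg (Complex.mem_slitPlane_iff_arg.1 h).1]

lemma turnAngle_coe {x y : ℂ} (hx : x ≠ 0) (hy : y ≠ 0) :
    (turnAngle x y : Real.Angle) = (Complex.arg y : Real.Angle) - (Complex.arg x : Real.Angle) := by
  unfold turnAngle
  rw [Complex.arg_mul_coe_angle (by simpa using hx) hy, Complex.arg_conj_coe_angle]
  abel

/-- Modulo 2π each turning angle is a difference of arguments, so the sum telescopes; for closed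
polygons it is a multiple of 2π. -/
lemma sum_turnAngle_coe (v : ℕ → ℂ) (n : ℕ) (hv : ∀ i ≤ n, v i ≠ 0) :
    ((∑ i ∈ Finset.range n, turnAngle (v i) (v (i + 1)) : ℝ) : Real.Angle) =
      (Complex.arg (v n) : Real.Angle) - (Complex.arg (v 0) : Real.Angle) := by
  induction n with
  | zero => simp
  | succ n ih =>
    rw [Finset.sum_range_succ, Real.Angle.coe_add, ih fun i hi => hv i (by omega),
      turnAngle_coe (hv _ (by omega)) (hv _ le_rfl)]
    abel

/-- A continuous function with values in 2πℤ on a connected space is constant: between two different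
values it would also take the smaller one plus π. -/
lemma exists_int_of_continuous {X : Type*} [TopologicalSpace X] [PreconnectedSpace X] {S : X → ℝ}
    (hS : Continuous S) (h : ∀ x, (S x : Real.Angle) = 0) (x y : X) : S x = S y := by
  by_contra hne
  wlog hlt : S x < S y generalizing x y
  · exact this y x (Ne.symm hne) (lt_of_le_of_ne (not_lt.1 hlt) (Ne.symm hne))
  obtain ⟨n, hn⟩ := Real.Angle.coe_eq_zero_iff.1 (h x)
  obtain ⟨m, hm⟩ := Real.Angle.coe_eq_zero_iff.1 (h y)
  simp only [zsmul_eq_mul] at hn hm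
  have hpi := Real.pi_pos
  have hnm : n < m := by
    rw [← hn, ← hm] at hlt
    have := lt_of_mul_lt_mul_right hlt (by positivity)
    exact_mod_cast this
  have hnm' : (n : ℝ) + 1 ≤ m := by exact_mod_cast hnm
  have hmem : S x + Real.pi ∈ Set.Icc (S x) (S y) := by
    constructor
    · linarith
    · rw [← hn, ← hm]; nlinarith
  obtain ⟨w, hw⟩ := (intermediate_value_univ x y hS) hmem
  obtain ⟨k, hk⟩ := Real.Angle.coe_eq_zero_iff.1 (h w)
  simp only [zsmul_eq_mul] at hk
  rw [hw, ← hn] at hk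
  have h3 : (k : ℝ) * 2 = n * 2 + 1 := by
    apply mul_right_cancel₀ hpi.ne'
    linarith
  have h4 : k * 2 = n * 2 + 1 := by exact_mod_cast h3
  omega

lemma Continuous.turnAngle {X : Type*} [TopologicalSpace X] {f g : X → ℂ} (hf : Continuous f)
    (hg : Continuous g) (h : ∀ x, NotOpposite (f x) (g x)) :
    Continuous fun x => turnAngle (f x) (g x) := by
  rw [continuous_iff_continuousAt]
  intro x
  have h1 : ContinuousAt (fun x => starRingEnd ℂ (f x) * g x) x :=
    ((Complex.continuous_conj.comp hf).mul hg).continuousAt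
  exact ContinuousAt.comp (f := fun x => starRingEnd ℂ (f x) * g x)
    (Complex.continuousAt_arg (h x)) h1

/-- The rotation number of a closed polygon is invariant under deformations. -/
lemma sum_turnAngle_deform {X : Type*} [TopologicalSpace X] [PreconnectedSpace X]
    (v : X → ℕ → ℂ) (n : ℕ) (hc : ∀ i, Continuous fun x => v x i)
    (hv : ∀ x, ∀ i < n, NotOpposite (v x i) (v x (i + 1))) (hcl : ∀ x, v x n = v x 0) (x y : X) :
    ∑ i ∈ Finset.range n, turnAngle (v x i) (v x (i + 1)) =
      ∑ i ∈ Finset.range n, turnAngle (v y i) (v y (i + 1)) := by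
  rcases Nat.eq_zero_or_pos n with rfl | hn
  · simp
  refine exists_int_of_continuous (S := fun x => ∑ i ∈ Finset.range n,
    turnAngle (v x i) (v x (i + 1))) ?_ ?_ x y
  · exact continuous_finsetSum _ fun i hi =>
      (hc i).turnAngle (hc (i + 1)) fun x => hv x i (Finset.mem_range.1 hi)
  · intro x
    rw [sum_turnAngle_coe, hcl, sub_self]
    intro i hi
    rcases hi.eq_or_lt with rfl | hi
    · rw [hcl]; exact (hv x 0 hn).left_ne_zero
    · exact (hv x i hi).left_ne_zero

/-! ### Rotation numbers of quadrilaterals -/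

/-- The sum of the turning angles of a quadrilateral. -/
noncomputable def quadTurn (a b c d : ℂ) : ℝ :=
  turnAngle a b + turnAngle b c + turnAngle c d + turnAngle d a

lemma quadTurn_deform (a b c d : unitInterval → ℂ) (ha : Continuous a) (hb : Continuous b)
    (hc : Continuous c) (hd : Continuous d) (hab : ∀ t, NotOpposite (a t) (b t))
    (hbc : ∀ t, NotOpposite (b t) (c t)) (hcd : ∀ t, NotOpposite (c t) (d t))
    (hda : ∀ t, NotOpposite (d t) (a t)) :
    quadTurn (a 0) (b 0) (c 0) (d 0) = quadTurn (a 1) (b 1) (c 1) (d 1) := by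
  have := sum_turnAngle_deform (X := unitInterval)
    (fun t i => if i = 0 then a t else if i = 1 then b t else if i = 2 then c t else
      if i = 3 then d t else a t) 4 ?_ ?_ ?_ 0 1
  · simpa [Finset.sum_range_succ, quadTurn] using this
  · intro i
    rcases i with _ | _ | _ | _ | i <;> simpa
  · intro t i hi
    interval_cases i <;> simp [hab, hbc, hcd, hda]
  · intro t; simp

/-- Angles add up if the middle vector lies in the cone of the outer ones. -/
lemma turnAngle_add_of_cone {x y : ℂ} (h : NotOpposite x y) {s t : ℝ} (hs : 0 ≤ s) (ht : 0 ≤ t)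
    (hst : 0 < s + t) :
    turnAngle x (s * x + t * y) + turnAngle (s * x + t * y) y = turnAngle x y := by
  have key : ∀ m : unitInterval, 0 < (1 - (m : ℝ)) + m * (s + t) := fun m => by
    have h1 := m.2.1
    have h2 := m.2.2
    rcases h1.eq_or_lt with h | h
    · rw [← h]; norm_num
    · nlinarith [mul_pos h hst]
  have ks : ∀ m : unitInterval, 0 ≤ (m : ℝ) * s := fun m => mul_nonneg m.2.1 hs
  have kt : ∀ m : unitInterval, 0 ≤ (m : ℝ) * t := fun m => mul_nonneg m.2.1 ht
  -- The second corner moves from x to s x + t y inside the cone. The quadrilateral x, x, y, y at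
  -- the start has total turning 0.
  have := quadTurn_deform (fun _ => x)
    (fun m => ((1 - (m : ℝ) + m * s : ℝ) : ℂ) * x + ((m * t : ℝ) : ℂ) * y)
    (fun _ => y) (fun _ => y) continuous_const (by fun_prop) continuous_const continuous_const
    (fun m => ?_) (fun m => ?_) (fun m => .self h.right_ne_zero) (fun m => h.symm)
  · simp only [quadTurn, turnAngle_self, turnAngle_symm h] at this
    simp at this
    simp only [turnAngle_self] at this
    linarith
  · apply NotOpposite.of_segment
    intro u hu0 hu1
    have h1 : 0 ≤ (1 - u) + u * (1 - m + m * s) :=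
      add_nonneg (by linarith) (mul_nonneg hu0 (by linarith [ks m, m.2.2]))
    have h2 : 0 ≤ u * (m * t) := mul_nonneg hu0 (kt m)
    have := h.cone_ne_zero h1 h2 (by
      rcases hu0.eq_or_lt with h | h
      · rw [← h]; norm_num
      · nlinarith [mul_pos h (key m)])
    convert this using 1
    push_cast; ring
  · apply NotOpposite.of_segment
    intro u hu0 hu1
    have h1 : 0 ≤ (1 - u) * (1 - m + m * s) :=
      mul_nonneg (by linarith) (by linarith [ks m, m.2.2])
    have h2 : 0 ≤ (1 - u) * (m * t) + u := add_nonneg (mul_nonneg (by linarith) (kt m)) hu0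
    have := h.cone_ne_zero h1 h2 (by
      rcases hu0.eq_or_lt with h | h
      · rw [← h]; nlinarith [key m]
      · nlinarith [mul_nonneg (sub_nonneg.2 hu1) (key m).le])
    convert this using 1
    push_cast; ring

lemma NotOpposite.left_cone {x y : ℂ} (h : NotOpposite x y) {s t : ℝ} (hs : 0 ≤ s) (ht : 0 ≤ t)
    (hst : 0 < s + t) : NotOpposite x (s * x + t * y) := .of_segment fun u hu0 hu1 => by
  have := h.cone_ne_zero (s := 1 - u + u * s) (t := u * t)
    (add_nonneg (by linarith) (mul_nonneg hu0 hs)) (mul_nonneg hu0 ht) (by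
      rcases hu0.eq_or_lt with h | h
      · rw [← h]; norm_num
      · nlinarith [mul_pos h hst])
  convert this using 1
  push_cast; ring

lemma NotOpposite.cone_right {x y : ℂ} (h : NotOpposite x y) {s t : ℝ} (hs : 0 ≤ s) (ht : 0 ≤ t)
    (hst : 0 < s + t) : NotOpposite (s * x + t * y) y := by
  have := h.symm.left_cone ht hs (by linarith)
  rw [add_comm] at this
  exact this.symm

/-- The rotation number of the image of the boundary of the unit square under a bilinear map
without zeros is zero. -/
lemma quadTurn_eq_zero {a b c d : ℂ}
    (h : ∀ s t : ℝ, 0 ≤ s → s ≤ 1 → 0 ≤ t → t ≤ 1 →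
      (((1 - s) * (1 - t) : ℝ) : ℂ) * a + ((s * (1 - t) : ℝ) : ℂ) * b + ((s * t : ℝ) : ℂ) * c +
        (((1 - s) * t : ℝ) : ℂ) * d ≠ 0) : quadTurn a b c d = 0 := by
  have had : NotOpposite a d := .of_segment fun t h0 h1 => by
    simpa using h 0 t le_rfl zero_le_one h0 h1
  -- The square is shrunk to its side s = 0: the corners are the values at (0,0), (m,0), (m,1),
  -- (0,1), and at m = 0 the quadrilateral a, a, d, d has total turning 0.
  have := quadTurn_deform (fun _ => a)
    (fun m => ((1 - (m : ℝ) : ℝ) : ℂ) * a + ((m : ℝ) : ℂ) * b)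
    (fun m => ((1 - (m : ℝ) : ℝ) : ℂ) * d + ((m : ℝ) : ℂ) * c) (fun _ => d)
    continuous_const (by fun_prop) (by fun_prop) continuous_const
    (fun m => .of_segment fun u hu0 hu1 => ?_) (fun m => .of_segment fun u hu0 hu1 => ?_)
    (fun m => .of_segment fun u hu0 hu1 => ?_) (fun m => had.symm)
  · simp [quadTurn, turnAngle_self, turnAngle_symm had] at this
    simp only [quadTurn, turnAngle_symm had]
    linarith
  · have := h (u * m) 0 (mul_nonneg hu0 m.2.1) (mul_le_one₀ hu1 m.2.1 m.2.2) le_rfl zero_le_one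
    convert this using 1
    push_cast; ring
  · have := h m u m.2.1 m.2.2 hu0 hu1
    convert this using 1
    push_cast; ring
  · have := h ((1 - u) * m) 1 (mul_nonneg (by linarith) m.2.1)
      (mul_le_one₀ (by linarith) m.2.1 m.2.2) zero_le_one le_rfl
    convert this using 1
    push_cast; ring

/-- The same for a bilinear map with one zero, in a corner of the square; the corner is replaced
by a vector between its neighbours. -/
lemma quadTurn_corner {b c d : ℂ} (hbd : NotOpposite b d)
    (h : ∀ s t : ℝ, 0 ≤ s → s ≤ 1 → 0 ≤ t → t ≤ 1 → 0 < s + t →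
      ((s * (1 - t) : ℝ) : ℂ) * b + ((s * t : ℝ) : ℂ) * c + (((1 - s) * t : ℝ) : ℂ) * d ≠ 0)
    {x y : ℝ} (hx : 0 ≤ x) (hy : 0 ≤ y) (hxy : 0 < x + y) :
    quadTurn (x * b + y * d) b c d = 0 := by
  have hD := turnAngle_add_of_cone hbd hx hy hxy
  have hE := turnAngle_add_of_cone hbd (s := 1) (t := 1) (by norm_num) (by norm_num) (by norm_num)
  -- Up to the factor m, these are the values of the bilinear map on the two far sides of the square
  -- [0,m]², at (m, u m) and (u m, m). Dividing by m makes the family extend to m = 0, where the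
  -- zero in the corner has disappeared.
  have key : ∀ (m : unitInterval) (u : ℝ), 0 ≤ u → u ≤ 1 →
      ((1 - u * m : ℝ) : ℂ) * b + (((1 - m) * u : ℝ) : ℂ) * d + ((u * m : ℝ) : ℂ) * c ≠ 0 ∧
      ((1 - u * m : ℝ) : ℂ) * d + (((1 - m) * u : ℝ) : ℂ) * b + ((u * m : ℝ) : ℂ) * c ≠ 0 := by
    intro m u hu0 hu1
    rcases m.2.1.eq_or_lt with hm | hm
    · rw [← hm]
      constructor
      · simpa using hbd.cone_ne_zero (s := 1) (t := u) (by norm_num) hu0 (by linarith)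
      · simpa [add_comm] using hbd.cone_ne_zero (s := u) (t := 1) hu0 (by norm_num) (by linarith)
    · have hum : u * m ≤ 1 := mul_le_one₀ hu1 m.2.1 m.2.2
      have hm0 : ((m : ℝ) : ℂ) ≠ 0 := by norm_cast; exact hm.ne'
      constructor
      · have := h m (u * m) m.2.1 m.2.2 (mul_nonneg hu0 m.2.1) hum
          (by linarith [mul_nonneg hu0 m.2.1])
        intro h0
        apply this
        push_cast at h0 ⊢
        linear_combination (m : ℂ) * h0
      · have := h (u * m) m (mul_nonneg hu0 m.2.1) hum m.2.1 m.2.2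
          (by linarith [mul_nonneg hu0 m.2.1])
        intro h0
        apply this
        push_cast at h0 ⊢
        linear_combination (m : ℂ) * h0
  -- The middle corner of b, ·, d moves from b + d, where angles add up by convexity, to c.
  have := quadTurn_deform (fun _ => b)
    (fun m => ((1 - (m : ℝ) : ℝ) : ℂ) * (b + d) + ((m : ℝ) : ℂ) * c)
    (fun _ => d) (fun _ => d)
    continuous_const (by fun_prop) continuous_const continuous_const
    (fun m => .of_segment fun u hu0 hu1 => ?_) (fun m => .of_segment fun u hu0 hu1 => ?_)
    (fun m => .self hbd.right_ne_zero) (fun m => hbd.symm)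
  · simp [quadTurn, turnAngle_self, turnAngle_symm hbd] at this hE
    have hDb := hbd.left_cone hx hy hxy
    have hDd := hbd.cone_right hx hy hxy
    simp only [quadTurn, turnAngle_symm hDb, turnAngle_symm hDd]
    linarith
  · have := (key m u hu0 hu1).1
    convert this using 1
    push_cast; ring
  · have := (key m (1 - u) (by linarith) (by linarith)).2
    convert this using 1
    push_cast; ring

/-- Angles add up for `x`, `z`, `y` if `z` is the end of a deformation that starts at `y`. -/
lemma turnAngle_add_of_deform {x y z : ℂ} (hxy : NotOpposite x y)
    (h : ∀ s t : ℝ, 0 < s → s ≤ 1 → 0 ≤ t → t ≤ 1 →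
      (((1 - t) * s : ℝ) : ℂ) * x + ((t * (1 - s) : ℝ) : ℂ) * y + ((t * s : ℝ) : ℂ) * z ≠ 0) :
    turnAngle x z + turnAngle z y = turnAngle x y := by
  have := quadTurn_deform (fun _ => x)
    (fun m => ((1 - (m : ℝ) : ℝ) : ℂ) * y + ((m : ℝ) : ℂ) * z)
    (fun _ => y) (fun _ => y)
    continuous_const (by fun_prop) continuous_const continuous_const
    (fun m => .of_segment fun u hu0 hu1 => ?_) (fun m => .of_segment fun u hu0 hu1 => ?_)
    (fun m => .self hxy.right_ne_zero) (fun m => hxy.symm)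
  · simp [quadTurn, turnAngle_self, turnAngle_symm hxy] at this
    linarith
  · rcases m.2.1.eq_or_lt with hm | hm
    · rw [← hm]
      simpa using hxy.cone_ne_zero (s := 1 - u) (t := u) (by linarith) hu0 (by linarith)
    · have hd : 0 < (1 - u) + u * m := by
        rcases hu0.eq_or_lt with h | h
        · rw [← h]; norm_num
        · nlinarith [mul_pos h hm]
      have hd' : ((1 : ℂ) - u + u * (m : ℝ)) ≠ 0 := by exact_mod_cast hd.ne'
      have hm0 : ((m : ℝ) : ℂ) ≠ 0 := by norm_cast; exact hm.ne'
      -- At this parameter the family of the hypothesis is the given point of the segment times m /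
      -- ((1 - u) + u m).
      have := h m (u * m / ((1 - u) + u * m)) hm m.2.2
        (div_nonneg (mul_nonneg hu0 m.2.1) hd.le)
        ((div_le_one hd).2 (by linarith))
      intro h0
      apply this
      push_cast at h0 ⊢
      field_simp
      linear_combination (m : ℂ) * h0
  · rcases (mul_nonneg m.2.1 (sub_nonneg.2 hu1)).eq_or_lt with hm | hm
    · have hm' : ((m : ℝ) : ℂ) * (1 - u) = 0 := by exact_mod_cast hm.symm
      convert hxy.right_ne_zero using 1
      push_cast
      linear_combination (z - y) * hm'
    · have := h (m * (1 - u)) 1 hm (mul_le_one₀ m.2.2 (by linarith) (by linarith))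
        zero_le_one le_rfl
      convert this using 1
      push_cast
      ring

/-! ### Cylindrical coordinates -/

/-- `e`, `ξ ⨯₃ e`, `ξ` is a positively oriented orthonormal basis. -/
structure IsFrame (ξ e : V3) : Prop where
  axis : ξ ⬝ᵥ ξ = 1
  unit : e ⬝ᵥ e = 1
  orth : ξ ⬝ᵥ e = 0

/-- The orthogonal projection along `ξ`, in complex coordinates. -/
noncomputable def hor (ξ e v : V3) : ℂ := ⟨v ⬝ᵥ e, v ⬝ᵥ (ξ ⨯₃ e)⟩

/-- The direction of the difference of the central projections of `a` and `b` to the plane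
`⟨ξ, ·⟩ = 1`. -/
noncomputable def secant (ξ e a b : V3) : ℂ :=
  ((ξ ⬝ᵥ b : ℝ) : ℂ) * hor ξ e a - ((ξ ⬝ᵥ a : ℝ) : ℂ) * hor ξ e b

section Hor
variable (ξ e : V3)

@[simp] lemma hor_add (a b : V3) : hor ξ e (a + b) = hor ξ e a + hor ξ e b := by
  apply Complex.ext <;> simp [hor, add_dotProduct]

@[simp] lemma hor_smul (s : ℝ) (a : V3) : hor ξ e (s • a) = s * hor ξ e a := by
  apply Complex.ext <;> simp [hor, smul_dotProduct]

@[simp] lemma hor_neg (a : V3) : hor ξ e (-a) = -hor ξ e a := by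
  apply Complex.ext <;> simp [hor, neg_dotProduct]

/-- This allows chords in the lower hemisphere to be treated by reflecting them to the upper one. -/
lemma secant_neg_neg (a b : V3) : secant ξ e (-a) (-b) = secant ξ e a b := by
  simp [secant]

lemma secant_smul_right (s : ℝ) (a b : V3) : secant ξ e a (s • b) = s * secant ξ e a b := by
  simp [secant]; ring

lemma secant_smul_left (s : ℝ) (a b : V3) : secant ξ e (s • a) b = s * secant ξ e a b := by
  simp [secant]; ring

lemma secant_add_right (a b c : V3) : secant ξ e a (b + c) = secant ξ e a b + secant ξ e a c := by
  simp [secant]; ring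

lemma secant_add_left (a b c : V3) : secant ξ e (a + b) c = secant ξ e a c + secant ξ e b c := by
  simp [secant]; ring

@[simp] lemma secant_self (a : V3) : secant ξ e a a = 0 := by
  simp [secant]

lemma secant_of_left {a : V3} (h : ξ ⬝ᵥ a = 0) (b : V3) :
    secant ξ e a b = ((ξ ⬝ᵥ b : ℝ) : ℂ) * hor ξ e a := by
  simp [secant, h]

lemma secant_of_right {b : V3} (h : ξ ⬝ᵥ b = 0) (a : V3) :
    secant ξ e a b = ((ξ ⬝ᵥ a : ℝ) : ℂ) * -hor ξ e b := by
  simp [secant, h]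

/-- The secants between two segments form a bilinear family. -/
lemma secant_lineMap (s t : ℝ) (a b c d : V3) :
    secant ξ e ((1 - s) • a + s • b) ((1 - t) • c + t • d) =
      (((1 - s) * (1 - t) : ℝ) : ℂ) * secant ξ e a c + ((s * (1 - t) : ℝ) : ℂ) * secant ξ e b c +
      ((s * t : ℝ) : ℂ) * secant ξ e b d + (((1 - s) * t : ℝ) : ℂ) * secant ξ e a d := by
  simp only [secant_add_left, secant_add_right, secant_smul_left, secant_smul_right]
  push_cast
  ring

lemma continuous_hor {X : Type*} [TopologicalSpace X] {f : X → V3} (hf : Continuous f) :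
    Continuous fun x => hor ξ e (f x) := by
  have h1 : Continuous fun x => f x ⬝ᵥ e := hf.dotProduct continuous_const
  have h2 : Continuous fun x => f x ⬝ᵥ (ξ ⨯₃ e) := hf.dotProduct continuous_const
  have : (fun x => hor ξ e (f x)) =
      fun x => ((f x ⬝ᵥ e : ℝ) : ℂ) + ((f x ⬝ᵥ (ξ ⨯₃ e) : ℝ) : ℂ) * Complex.I := by
    funext x
    apply Complex.ext <;> simp [hor]
  rw [this]
  exact (Complex.continuous_ofReal.comp h1).add
    ((Complex.continuous_ofReal.comp h2).mul continuous_const)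

lemma continuous_secant {X : Type*} [TopologicalSpace X] {f g : X → V3} (hf : Continuous f)
    (hg : Continuous g) : Continuous fun x => secant ξ e (f x) (g x) := by
  have h1 : Continuous fun x => ξ ⬝ᵥ f x := continuous_const.dotProduct hf
  have h2 : Continuous fun x => ξ ⬝ᵥ g x := continuous_const.dotProduct hg
  exact ((Complex.continuous_ofReal.comp h2).mul (continuous_hor ξ e hf)).sub
    ((Complex.continuous_ofReal.comp h1).mul (continuous_hor ξ e hg))

end Hor

lemma exists_isFrame {ξ : V3} (h : ξ ⬝ᵥ ξ = 1) : ∃ e, IsFrame ξ e := by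
  have key : ∀ v : V3, ξ ⬝ᵥ v = 0 → 0 < v ⬝ᵥ v → ∃ e, IsFrame ξ e := by
    intro v hv hpos
    refine ⟨unitize v, h, ?_, ?_⟩
    · have := Real.sqrt_pos.2 hpos
      simp only [unitize, smul_dotProduct, dotProduct_smul, smul_eq_mul]
      have h2 := Real.mul_self_sqrt hpos.le
      field_simp
      nlinarith
    · simp [unitize, dotProduct_smul, hv]
  have hx : ξ 0 * ξ 0 + ξ 1 * ξ 1 + ξ 2 * ξ 2 = 1 := by
    simpa [dotProduct, Fin.sum_univ_three] using h
  by_cases h01 : ξ 0 = 0 ∧ ξ 1 = 0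
  · apply key ![1, 0, 0]
    · simp [dotProduct, Fin.sum_univ_three, h01.1]
    · simp [dotProduct, Fin.sum_univ_three]
  · apply key ![-ξ 1, ξ 0, 0]
    · simp [dotProduct, Fin.sum_univ_three]; ring
    · have : 0 < ξ 0 * ξ 0 + ξ 1 * ξ 1 := by
        by_contra hc
        exact h01 ⟨by nlinarith [mul_self_nonneg (ξ 0), mul_self_nonneg (ξ 1)],
          by nlinarith [mul_self_nonneg (ξ 0), mul_self_nonneg (ξ 1)]⟩
      simp [dotProduct, Fin.sum_univ_three]
      linarith

namespace IsFrame
variable {ξ e : V3} (he : IsFrame ξ e)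
include he

lemma hor_cross_axis (v : V3) : hor ξ e (ξ ⨯₃ v) = Complex.I * hor ξ e v := by
  apply Complex.ext
  · simp [hor, cross_apply, dotProduct, Fin.sum_univ_three]; ring
  · simp [hor, cross_dot_cross, he.axis, he.orth]

lemma normSq_hor (v : V3) : Complex.normSq (hor ξ e v) + (ξ ⬝ᵥ v) ^ 2 = v ⬝ᵥ v := by
  obtain ⟨h1, h2, h3⟩ := he
  have key : (v ⬝ᵥ (ξ ⨯₃ e)) ^ 2 = (v ⬝ᵥ v) * ((ξ ⬝ᵥ ξ) * (e ⬝ᵥ e) - (ξ ⬝ᵥ e) ^ 2)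
      - (ξ ⬝ᵥ v) ^ 2 * (e ⬝ᵥ e) - (v ⬝ᵥ e) ^ 2 * (ξ ⬝ᵥ ξ)
      + 2 * (ξ ⬝ᵥ v) * (v ⬝ᵥ e) * (ξ ⬝ᵥ e) := by
    simp [cross_apply, dotProduct, Fin.sum_univ_three]; ring
  simp only [Complex.normSq_apply, hor]
  rw [h1, h2, h3] at key
  linarith

/-- This identity translates the polar polygon into secants: the constant factor -i does not affect
angles, so the rotation of the polar polygon around the axis is the turning of the edges. -/
lemma hor_cross (a b : V3) : hor ξ e (a ⨯₃ b) = -Complex.I * secant ξ e a b := by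
  obtain ⟨h1, h2, h3⟩ := he
  have key : (a ⨯₃ b) ⬝ᵥ (ξ ⨯₃ e ⨯₃ ξ) = (a ⨯₃ b) ⬝ᵥ e * (ξ ⬝ᵥ ξ) - (a ⨯₃ b) ⬝ᵥ ξ * (ξ ⬝ᵥ e) := by
    simp [cross_apply, dotProduct, Fin.sum_univ_three]; ring
  rw [cross_dot_cross, h1, h3] at key
  apply Complex.ext
  · simp [hor, secant]
    rw [dotProduct_comm ξ a, dotProduct_comm ξ b]
    linarith
  · simp [hor, secant, cross_dot_cross]
    rw [dotProduct_comm ξ a, dotProduct_comm ξ b]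
    ring

lemma cross_dot_axis (a b : V3) :
    (a ⨯₃ b) ⬝ᵥ ξ = (starRingEnd ℂ (hor ξ e a) * hor ξ e b).im := by
  obtain ⟨h1, h2, h3⟩ := he
  have key : (a ⨯₃ b) ⬝ᵥ (e ⨯₃ (ξ ⨯₃ e)) = (a ⨯₃ b) ⬝ᵥ ξ * (e ⬝ᵥ e) - (a ⨯₃ b) ⬝ᵥ e * (ξ ⬝ᵥ e) := by
    simp [cross_apply, dotProduct, Fin.sum_univ_three]; ring
  rw [cross_dot_cross, h2, h3] at key
  simp [hor]
  linarith

lemma eq_zero {v : V3} (h : hor ξ e v = 0) (hz : ξ ⬝ᵥ v = 0) : v = 0 := by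
  have := he.normSq_hor v
  rw [h, hz] at this
  simp at this
  exact dotProduct_self_eq_zero.1 this.symm

lemma ext {v w : V3} (h : hor ξ e v = hor ξ e w) (hz : ξ ⬝ᵥ v = ξ ⬝ᵥ w) : v = w := by
  apply sub_eq_zero.1 (he.eq_zero (v := v - w) _ _)
  · rw [sub_eq_add_neg, hor_add, hor_neg, h]; ring
  · rw [dotProduct_sub, hz, sub_self]

lemma hor_ne_zero {v : V3} (hv : v ≠ 0) (hz : ξ ⬝ᵥ v = 0) : hor ξ e v ≠ 0 :=
  fun h => hv (he.eq_zero h hz)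

/-- Two points with vanishing secant that are not on the equator are proportional. -/
lemma eq_smul_of_secant_eq_zero {p q : V3} (h : secant ξ e p q = 0) (hp : ξ ⬝ᵥ p ≠ 0) :
    q = ((ξ ⬝ᵥ q) / (ξ ⬝ᵥ p)) • p := by
  have hp' : ((ξ ⬝ᵥ p : ℝ) : ℂ) ≠ 0 := by exact_mod_cast hp
  apply he.ext
  · rw [hor_smul]
    push_cast
    field_simp
    unfold secant at h
    linear_combination -h
  · rw [dotProduct_smul, smul_eq_mul]
    field_simp

end IsFrame

/-! ### The turning of arcs in a hemisphere -/

/-- An open polygon in the closed hemisphere with pole `ξ`, with its ends on the boundary, none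
of whose secants is vertical. -/
structure IsChordArc (ξ e : V3) (w : ℕ → V3) (m : ℕ) : Prop where
  two_le : 2 ≤ m
  first : ξ ⬝ᵥ w 0 = 0
  last : ξ ⬝ᵥ w m = 0
  pos : ∀ i, 0 < i → i < m → 0 < ξ ⬝ᵥ w i
  ends : NotOpposite (hor ξ e (w 0)) (-hor ξ e (w m))
  secant_ne : ∀ i j, i < j → j < m → ∀ s t : ℝ, 0 ≤ s → s ≤ 1 → 0 ≤ t → t ≤ 1 →
    secant ξ e ((1 - s) • w i + s • w (i + 1)) ((1 - t) • w j + t • w (j + 1)) = 0 →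
    (j = i + 1 ∧ s = 1 ∧ t = 0) ∨ (i = 0 ∧ s = 0 ∧ j + 1 = m ∧ t = 1)

/-- Summation over the cells of a triangle. -/
lemma sum_triangle (g : ℕ → ℕ → ℂ) (m : ℕ)
    (tri : ∀ i, i + 2 ≤ m → turnAngle (g i (i + 1)) (g i (i + 2)) +
      turnAngle (g i (i + 2)) (g (i + 1) (i + 2)) = turnAngle (g i (i + 1)) (g (i + 1) (i + 2)))
    (cell : ∀ i j, i + 1 < j → j + 1 ≤ m → turnAngle (g i j) (g (i + 1) j) +
      turnAngle (g (i + 1) j) (g (i + 1) (j + 1)) =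
      turnAngle (g i j) (g i (j + 1)) + turnAngle (g i (j + 1)) (g (i + 1) (j + 1)))
    (k : ℕ) (hk : k + 1 ≤ m) :
    ∑ i ∈ Finset.range k, turnAngle (g i (i + 1)) (g (i + 1) (i + 2)) =
      ∑ j ∈ Finset.range k, turnAngle (g 0 (j + 1)) (g 0 (j + 2)) +
      ∑ i ∈ Finset.range k, turnAngle (g i (k + 1)) (g (i + 1) (k + 1)) := by
  induction k with
  | zero => simp
  | succ k ih =>
    -- The cells between the rows k + 1 and k + 2: the vertical steps telescope, and those at the
    -- two ends of the strip remain.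
    have strip : ∀ l ≤ k, ∑ i ∈ Finset.range l, turnAngle (g i (k + 2)) (g (i + 1) (k + 2)) =
        ∑ i ∈ Finset.range l, turnAngle (g i (k + 1)) (g (i + 1) (k + 1)) +
        turnAngle (g l (k + 1)) (g l (k + 2)) - turnAngle (g 0 (k + 1)) (g 0 (k + 2)) := by
      intro l hl
      induction l with
      | zero => simp
      | succ l ihl =>
        rw [Finset.sum_range_succ, Finset.sum_range_succ, ihl (by omega)]
        linarith [cell l (k + 1) (by omega) (by omega)]
    rw [Finset.sum_range_succ, ih (by omega), Finset.sum_range_succ, Finset.sum_range_succ _ k,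
      strip k le_rfl]
    linarith [tri k (by omega)]

lemma quadTurn_eq_zero_iff {a b c d : ℂ} (hcd : NotOpposite c d) (hda : NotOpposite d a) :
    quadTurn a b c d = 0 ↔ turnAngle a b + turnAngle b c = turnAngle a d + turnAngle d c := by
  rw [quadTurn, turnAngle_symm hcd.symm, turnAngle_symm hda]
  constructor <;> intro h <;> linarith

lemma secant_segment_right (ξ e : V3) (t : ℝ) (a c d : V3) :
    secant ξ e a ((1 - t) • c + t • d) =
      ((1 - t : ℝ) : ℂ) * secant ξ e a c + (t : ℂ) * secant ξ e a d := by
  simp only [secant_add_right, secant_smul_right]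

lemma secant_segment_left (ξ e : V3) (s : ℝ) (a b c : V3) :
    secant ξ e ((1 - s) • a + s • b) c =
      ((1 - s : ℝ) : ℂ) * secant ξ e a c + (s : ℂ) * secant ξ e b c := by
  simp only [secant_add_left, secant_smul_left]

lemma sub_eq_cone {a b : ℝ} (ha : 0 < a) (hb : 0 < b) (x y : ℂ) :
    x - y = ((a⁻¹ : ℝ) : ℂ) * (a * x) + ((b⁻¹ : ℝ) : ℂ) * (b * -y) := by
  have ha' : (a : ℂ) ≠ 0 := by exact_mod_cast ha.ne'
  have hb' : (b : ℂ) ≠ 0 := by exact_mod_cast hb.ne'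
  push_cast
  field_simp
  ring

namespace IsChordArc
variable {ξ e : V3} {w : ℕ → V3} {m : ℕ} (hw : IsChordArc ξ e w m)
include hw

lemma secant_right_ne {i j : ℕ} (hij : i < j) (hj : j < m) {t : ℝ} (h0 : 0 ≤ t) (h1 : t ≤ 1)
    (hc : ¬(i = 0 ∧ j + 1 = m ∧ t = 1)) :
    secant ξ e (w i) ((1 - t) • w j + t • w (j + 1)) ≠ 0 := by
  intro h
  have := hw.secant_ne i j hij hj 0 t le_rfl zero_le_one h0 h1 (by simpa using h)
  rcases this with h | h
  · exact zero_ne_one h.2.1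
  · exact hc ⟨h.1, h.2.2⟩

lemma secant_left_ne {i j : ℕ} (hij : i + 1 < j) (hj : j ≤ m) {s : ℝ} (h0 : 0 ≤ s) (h1 : s ≤ 1)
    (hc : ¬(i = 0 ∧ j = m ∧ s = 0)) :
    secant ξ e ((1 - s) • w i + s • w (i + 1)) (w j) ≠ 0 := by
  intro h
  obtain ⟨j, rfl⟩ : ∃ k, j = k + 1 := ⟨j - 1, by omega⟩
  have := hw.secant_ne i j (by omega) (by omega) s 1 h0 h1 zero_le_one le_rfl (by simpa using h)
  rcases this with h | h
  · exact one_ne_zero h.2.2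
  · exact hc ⟨h.1, h.2.2.1, h.2.1⟩

lemma notOpposite_up {i j : ℕ} (hij : i < j) (hj : j < m) (hc : ¬(i = 0 ∧ j + 1 = m)) :
    NotOpposite (secant ξ e (w i) (w j)) (secant ξ e (w i) (w (j + 1))) :=
  .of_segment fun t h0 h1 => by
    rw [← secant_segment_right]
    exact hw.secant_right_ne hij hj h0 h1 fun h => hc ⟨h.1, h.2.1⟩

lemma notOpposite_across {i j : ℕ} (hij : i + 1 < j) (hj : j ≤ m) (hc : ¬(i = 0 ∧ j = m)) :
    NotOpposite (secant ξ e (w i) (w j)) (secant ξ e (w (i + 1)) (w j)) :=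
  .of_segment fun t h0 h1 => by
    rw [← secant_segment_left]
    exact hw.secant_left_ne hij hj h0 h1 fun h => hc ⟨h.1, h.2.1⟩

/-- Along this side of the triangle of index pairs the direction is constant, so the side
contributes no turning except at its corner. `secant_last` does the same for the other side. -/
lemma secant_first {j : ℕ} :
    secant ξ e (w 0) (w j) = ((ξ ⬝ᵥ w j : ℝ) : ℂ) * hor ξ e (w 0) :=
  secant_of_left ξ e hw.first _

lemma secant_last {j : ℕ} :
    secant ξ e (w j) (w m) = ((ξ ⬝ᵥ w j : ℝ) : ℂ) * -hor ξ e (w m) :=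
  secant_of_right ξ e hw.last _

lemma turn_cell {i j : ℕ} (hij : i + 1 < j) (hj : j + 1 ≤ m) (hc : ¬(i = 0 ∧ j + 1 = m)) :
    turnAngle (secant ξ e (w i) (w j)) (secant ξ e (w (i + 1)) (w j)) +
      turnAngle (secant ξ e (w (i + 1)) (w j)) (secant ξ e (w (i + 1)) (w (j + 1))) =
    turnAngle (secant ξ e (w i) (w j)) (secant ξ e (w i) (w (j + 1))) +
      turnAngle (secant ξ e (w i) (w (j + 1))) (secant ξ e (w (i + 1)) (w (j + 1))) := by
  rw [← quadTurn_eq_zero_iff]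
  · apply quadTurn_eq_zero
    intro s t hs0 hs1 ht0 ht1 h
    rw [← secant_lineMap] at h
    rcases hw.secant_ne i j (by omega) (by omega) s t hs0 hs1 ht0 ht1 h with h | h
    · omega
    · exact hc ⟨h.1, h.2.2.1⟩
  · exact (hw.notOpposite_across (by omega) hj hc).symm
  · exact (hw.notOpposite_up (by omega) (by omega) hc).symm

lemma turn_tri {i : ℕ} (hi : i + 2 ≤ m) (hc : ¬(i = 0 ∧ m = 2))
    (hno : NotOpposite (secant ξ e (w i) (w (i + 1))) (secant ξ e (w (i + 1)) (w (i + 2)))) :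
    turnAngle (secant ξ e (w i) (w (i + 1))) (secant ξ e (w i) (w (i + 2))) +
      turnAngle (secant ξ e (w i) (w (i + 2))) (secant ξ e (w (i + 1)) (w (i + 2))) =
    turnAngle (secant ξ e (w i) (w (i + 1))) (secant ξ e (w (i + 1)) (w (i + 2))) := by
  apply turnAngle_add_of_deform hno
  intro s t hs0 hs1 ht0 ht1 h
  have := hw.secant_ne i (i + 1) (by omega) (by omega) (1 - s) t (by linarith) (by linarith)
    ht0 ht1 (by
      rw [secant_lineMap, secant_self]
      push_cast at h ⊢
      linear_combination h)
  rcases this with h | h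
  · linarith [h.2.1]
  · omega

/-- The total turning of an arc in a hemisphere depends on its ends only. -/
theorem sum_turn
    (hno : ∀ i, i + 2 ≤ m →
      NotOpposite (secant ξ e (w i) (w (i + 1))) (secant ξ e (w (i + 1)) (w (i + 2)))) :
    ∑ i ∈ Finset.range (m - 1),
      turnAngle (secant ξ e (w i) (w (i + 1))) (secant ξ e (w (i + 1)) (w (i + 2))) =
    turnAngle (hor ξ e (w 0)) (-hor ξ e (w m)) := by
  obtain ⟨k, rfl⟩ : ∃ k, m = k + 2 := ⟨m - 2, by have := hw.two_le; omega⟩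
  -- The secant vanishes in the corner (0, k + 2), where both points are on the equator. D replaces
  -- it: it is P + Q, hence in the cone of the constant directions P and Q of the two adjacent
  -- sides.
  set D := hor ξ e (w 0) - hor ξ e (w (k + 2)) with hD
  have hz1 := hw.pos 1 (by omega) (by omega)
  have hzk := hw.pos (k + 1) (by omega) (by omega)
  set P := hor ξ e (w 0) with hP
  set Q := -hor ξ e (w (k + 2)) with hQ
  have hPQ : NotOpposite P Q := hw.ends
  have eP : secant ξ e (w 0) (w (k + 1)) = ((ξ ⬝ᵥ w (k + 1) : ℝ) : ℂ) * P := hw.secant_first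
  have eQ : secant ξ e (w 1) (w (k + 2)) = ((ξ ⬝ᵥ w 1 : ℝ) : ℂ) * Q := hw.secant_last
  have hPQ' := hPQ.smul_smul hzk hz1
  have hDeq : D = (((ξ ⬝ᵥ w (k + 1))⁻¹ : ℝ) : ℂ) * (((ξ ⬝ᵥ w (k + 1) : ℝ) : ℂ) * P) +
      (((ξ ⬝ᵥ w 1)⁻¹ : ℝ) : ℂ) * (((ξ ⬝ᵥ w 1 : ℝ) : ℂ) * Q) := by
    rw [hD, hQ]; exact sub_eq_cone hzk hz1 _ _
  have hi1 := inv_pos.2 hz1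
  have hik := inv_pos.2 hzk
  have hadd := turnAngle_add_of_cone hPQ' hik.le hi1.le (by linarith)
  rw [← hDeq, turnAngle_smul_smul _ _ hzk hz1] at hadd
  set g : ℕ → ℕ → ℂ := fun i j => if i = 0 ∧ j = k + 2 then D else secant ξ e (w i) (w j) with hg
  have g1 : ∀ i j, ¬(i = 0 ∧ j = k + 2) → g i j = secant ξ e (w i) (w j) := fun i j h => by
    simp only [hg]; rw [if_neg h]
  have g2 : g 0 (k + 2) = D := by simp [hg]
  have main := sum_triangle g (k + 2) ?_ ?_ (k + 1) le_rfl
  · have e1 : ∀ i ∈ Finset.range (k + 2 - 1),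
        turnAngle (secant ξ e (w i) (w (i + 1))) (secant ξ e (w (i + 1)) (w (i + 2))) =
        turnAngle (g i (i + 1)) (g (i + 1) (i + 2)) := fun i _ => by
      rw [g1 _ _ (by omega), g1 _ _ (by omega)]
    rw [Finset.sum_congr rfl e1]
    rw [show k + 2 - 1 = k + 1 by omega, main, Finset.sum_range_succ, Finset.sum_range_succ']
    rw [Finset.sum_eq_zero, Finset.sum_eq_zero]
    · rw [g2, g1 0 (k + 1) (by omega), g1 _ _ (by omega), eP, eQ]
      linarith
    · intro i hi
      rw [Finset.mem_range] at hi
      rw [g1 _ _ (by omega), g1 _ _ (by omega), hw.secant_last, hw.secant_last]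
      exact turnAngle_smul_self _ (hw.pos _ (by omega) (by omega)) (hw.pos _ (by omega) (by omega))
    · intro i hi
      rw [Finset.mem_range] at hi
      rw [g1 _ _ (by omega), g1 _ _ (by omega), hw.secant_first, hw.secant_first]
      exact turnAngle_smul_self _ (hw.pos _ (by omega) (by omega)) (hw.pos _ (by omega) (by omega))
  · intro i hi
    -- For a chord with only two edges the singular corner belongs to the triangular cell.
    by_cases hc : i = 0 ∧ k = 0
    · obtain ⟨rfl, rfl⟩ := hc
      simp only [zero_add] at *
      rw [g2, g1 0 1 (by omega), g1 1 2 (by omega), eP, eQ, turnAngle_smul_smul _ _ hzk hz1]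
      exact hadd
    · rw [g1 _ _ (by omega), g1 _ _ (by omega), g1 _ _ (by omega)]
      exact hw.turn_tri hi (by omega) (hno i hi)
  · intro i j hij hj
    by_cases hc : i = 0 ∧ j = k + 1
    · obtain ⟨rfl, rfl⟩ := hc
      rw [g2, g1 _ _ (by omega), g1 _ _ (by omega), g1 _ _ (by omega)]
      have hq : quadTurn D (secant ξ e (w 0) (w (k + 1))) (secant ξ e (w 1) (w (k + 1)))
          (secant ξ e (w 1) (w (k + 2))) = 0 := by
        rw [eP, eQ, hDeq]
        refine quadTurn_corner hPQ' ?_ hik.le hi1.le (by linarith)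
        intro s t hs0 hs1 ht0 ht1 hst h
        -- The substitution (t, 1 - s) turns the cell so that its zero, at (0, 1), comes to the
        -- corner (0, 0) required by `quadTurn_corner`.
        have hzero := hw.secant_ne 0 (k + 1) (by omega) (by omega) t (1 - s) ht0 ht1
          (by linarith) (by linarith) (by
            rw [secant_lineMap, zero_add, eP, show k + 1 + 1 = k + 2 by omega, eQ,
              hw.secant_first, hw.last]
            push_cast at h ⊢
            linear_combination h)
        rcases hzero with h | h
        · omega
        · linarith [h.2.1, h.2.2.2]
      have hPD : NotOpposite (secant ξ e (w 0) (w (k + 1))) D := by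
        rw [eP, hDeq]
        exact hPQ'.left_cone hik.le hi1.le (by linarith)
      have hDQ : NotOpposite D (secant ξ e (w 1) (w (k + 2))) := by
        rw [eQ, hDeq]
        exact hPQ'.cone_right hik.le hi1.le (by linarith)
      rw [← quadTurn_eq_zero_iff hDQ.symm hPD.symm]
      unfold quadTurn at *
      simp only [zero_add] at *
      linarith
    · rw [g1 _ _ (by omega), g1 _ _ (by omega), g1 _ _ (by omega), g1 _ _ (by omega)]
      exact hw.turn_cell hij hj (by omega)

end IsChordArc

/-! ### Disjoint arcs in a hemisphere -/

/-- Summation over the cells of a rectangle. -/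
lemma sum_rectangle (g : ℕ → ℕ → ℂ) (m n : ℕ)
    (cell : ∀ i j, i < m → j < n → turnAngle (g i j) (g (i + 1) j) +
      turnAngle (g (i + 1) j) (g (i + 1) (j + 1)) =
      turnAngle (g i j) (g i (j + 1)) + turnAngle (g i (j + 1)) (g (i + 1) (j + 1))) :
    ∑ i ∈ Finset.range m, turnAngle (g i 0) (g (i + 1) 0) +
      ∑ j ∈ Finset.range n, turnAngle (g m j) (g m (j + 1)) =
    ∑ j ∈ Finset.range n, turnAngle (g 0 j) (g 0 (j + 1)) +
      ∑ i ∈ Finset.range m, turnAngle (g i n) (g (i + 1) n) := by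
  induction m with
  | zero => simp
  | succ k ih =>
    have h1 : ∑ j ∈ Finset.range n, turnAngle (g (k + 1) j) (g (k + 1) (j + 1)) =
        ∑ j ∈ Finset.range n, turnAngle (g k j) (g k (j + 1)) +
        (turnAngle (g k n) (g (k + 1) n) - turnAngle (g k 0) (g (k + 1) 0)) := by
      rw [← Finset.sum_range_sub (fun j => turnAngle (g k j) (g (k + 1) j)),
        ← Finset.sum_add_distrib]
      refine Finset.sum_congr rfl fun j hj => ?_
      linarith [cell k j (by omega) (Finset.mem_range.1 hj)]
    rw [Finset.sum_range_succ, Finset.sum_range_succ, h1]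
    linarith [ih fun i j hi hj => cell i j (by omega) hj]

/-- A path of vectors that, apart from its ends, consists of multiples of `y`. -/
lemma turn_of_const_direction {m : ℕ} (hm : 2 ≤ m) {q : ℕ → ℂ} {x x' y : ℂ} (c : ℕ → ℝ)
    (h0 : NotOpposite x y) (h1 : NotOpposite x' y) (hq0 : q 0 = x + y) (hqm : q m = x' + y)
    (hq : ∀ i, 0 < i → i < m → 0 < c i ∧ q i = c i * y) :
    (∀ i < m, NotOpposite (q i) (q (i + 1))) ∧
    ∑ i ∈ Finset.range m, turnAngle (q i) (q (i + 1)) =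
      turnAngle (x + y) y + turnAngle y (x' + y) := by
  have hy := h0.right_ne_zero
  have n0 : NotOpposite (x + y) y := by
    simpa using h0.cone_right (s := 1) (t := 1) (by norm_num) (by norm_num) (by norm_num)
  have n1 : NotOpposite y (x' + y) := by
    simpa using (h1.cone_right (s := 1) (t := 1) (by norm_num) (by norm_num) (by norm_num)).symm
  have s1 : ∀ {u v : ℂ} {r : ℝ}, 0 < r → NotOpposite u v → NotOpposite u (r * v) :=
    fun hr h => by simpa using h.smul_smul one_pos hr
  have a1 : ∀ (u v : ℂ) {r : ℝ}, 0 < r → turnAngle u (r * v) = turnAngle u v :=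
    fun u v r hr => by simpa using turnAngle_smul_smul u v one_pos hr
  have a2 : ∀ (u v : ℂ) {r : ℝ}, 0 < r → turnAngle (r * u) v = turnAngle u v :=
    fun u v r hr => by simpa using turnAngle_smul_smul u v hr one_pos
  obtain ⟨k, rfl⟩ : ∃ k, m = k + 2 := ⟨m - 2, by omega⟩
  constructor
  · intro i hi
    rcases Nat.eq_zero_or_pos i with rfl | hi0
    · rw [hq0, (hq 1 (by omega) (by omega)).2]
      exact s1 (hq 1 (by omega) (by omega)).1 n0
    · obtain ⟨hc, e⟩ := hq i hi0 hi
      rcases eq_or_ne i (k + 1) with rfl | hne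
      · rw [hqm, e]
        exact (s1 hc n1.symm).symm
      · obtain ⟨hc', e'⟩ := hq (i + 1) (by omega) (by omega)
        rw [e, e']
        exact (NotOpposite.self hy).smul_smul hc hc'
  · rw [Finset.sum_range_succ, Finset.sum_range_succ', Finset.sum_eq_zero]
    · obtain ⟨hc, e⟩ := hq (k + 1) (by omega) (by omega)
      obtain ⟨hc', e'⟩ := hq 1 (by omega) (by omega)
      rw [hq0, hqm, e, zero_add, e', a1 _ _ hc', a2 _ _ hc]
    · intro i hi
      rw [Finset.mem_range] at hi
      obtain ⟨hc, e⟩ := hq (i + 1) (by omega) (by omega)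
      obtain ⟨hc', e'⟩ := hq (i + 1 + 1) (by omega) (by omega)
      rw [e, e']
      exact turnAngle_smul_self _ hc hc'

lemma quadTurn_rotate (a b c d : ℂ) : quadTurn b c d a = quadTurn a b c d := by
  unfold quadTurn; ring

/-- A version of `quadTurn_corner` for bilinear maps in standard form. -/
lemma quadTurn_of_corner_eq_zero {a b c d : ℂ} (ha : a = 0) (hbd : NotOpposite b d)
    (h : ∀ s t : ℝ, 0 ≤ s → s ≤ 1 → 0 ≤ t → t ≤ 1 →
      (((1 - s) * (1 - t) : ℝ) : ℂ) * a + ((s * (1 - t) : ℝ) : ℂ) * b + ((s * t : ℝ) : ℂ) * c +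
        (((1 - s) * t : ℝ) : ℂ) * d = 0 → s = 0 ∧ t = 0)
    {x y : ℝ} (hx : 0 < x) (hy : 0 < y) :
    quadTurn (x * b + y * d) b c d = 0 := by
  refine quadTurn_corner hbd ?_ hx.le hy.le (by linarith)
  intro s t hs0 hs1 ht0 ht1 hst h0
  have := h s t hs0 hs1 ht0 ht1 (by rw [ha, mul_zero, zero_add, h0])
  linarith [this.1, this.2]

/-- Two polygonal arcs in the closed hemisphere with pole `ξ`, with their ends on the boundary,
such that the secants between them vanish at most at the ends. -/
structure AreDisjointArcs (ξ e : V3) (v : ℕ → V3) (m : ℕ) (w : ℕ → V3) (n : ℕ) : Prop where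
  two_le : 2 ≤ m
  two_le' : 2 ≤ n
  ends : ∀ i j, (i = 0 ∨ i = m) → (j = 0 ∨ j = n) →
    ξ ⬝ᵥ v i = 0 ∧ ξ ⬝ᵥ w j = 0 ∧ NotOpposite (hor ξ e (v i)) (-hor ξ e (w j))
  pos : ∀ i, 0 < i → i < m → 0 < ξ ⬝ᵥ v i
  pos' : ∀ i, 0 < i → i < n → 0 < ξ ⬝ᵥ w i
  secant_ne : ∀ i j, i < m → j < n → ∀ s t : ℝ, 0 ≤ s → s ≤ 1 → 0 ≤ t → t ≤ 1 →
    secant ξ e ((1 - s) • v i + s • v (i + 1)) ((1 - t) • w j + t • w (j + 1)) = 0 →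
    ((i = 0 ∧ s = 0) ∨ (i + 1 = m ∧ s = 1)) ∧ ((j = 0 ∧ t = 0) ∨ (j + 1 = n ∧ t = 1))

namespace AreDisjointArcs
variable {ξ e : V3} {v w : ℕ → V3} {m n : ℕ} (H : AreDisjointArcs ξ e v m w n)
include H

lemma across {i j : ℕ} (hi : i < m) (hj0 : 0 < j) (hj : j < n) :
    NotOpposite (secant ξ e (v i) (w j)) (secant ξ e (v (i + 1)) (w j)) :=
  .of_segment fun t h0 h1 => by
    rw [← secant_segment_left]
    intro h
    have := H.secant_ne i j hi hj t 0 h0 h1 le_rfl zero_le_one (by simpa using h)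
    rcases this.2 with h | h
    · omega
    · exact zero_ne_one h.2

lemma up {i j : ℕ} (hi0 : 0 < i) (hi : i < m) (hj : j < n) :
    NotOpposite (secant ξ e (v i) (w j)) (secant ξ e (v i) (w (j + 1))) :=
  .of_segment fun t h0 h1 => by
    rw [← secant_segment_right]
    intro h
    have := H.secant_ne i j hi hj 0 t le_rfl zero_le_one h0 h1 (by simpa using h)
    rcases this.1 with h | h
    · omega
    · exact zero_ne_one h.2

/-- The four ends of two disjoint arcs in a hemisphere are not interlaced on the boundary. -/
theorem turn_eq :
    turnAngle (hor ξ e (v 0)) (-hor ξ e (w 0)) - turnAngle (hor ξ e (v m)) (-hor ξ e (w 0)) =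
    turnAngle (hor ξ e (v 0)) (-hor ξ e (w n)) - turnAngle (hor ξ e (v m)) (-hor ξ e (w n)) := by
  have hm := H.two_le
  have hn := H.two_le'
  -- All four corners of the rectangle are zeros of the secant. There it is replaced by the sum of
  -- the constant directions of the two sides that meet.
  set g : ℕ → ℕ → ℂ := fun i j =>
    if (i = 0 ∨ i = m) ∧ (j = 0 ∨ j = n) then hor ξ e (v i) + -hor ξ e (w j)
    else secant ξ e (v i) (w j) with hg
  have gc : ∀ i j, (i = 0 ∨ i = m) → (j = 0 ∨ j = n) →
      g i j = hor ξ e (v i) + -hor ξ e (w j) := fun i j hi hj => by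
    simp only [hg]; rw [if_pos ⟨hi, hj⟩]
  have gs : ∀ i j, ¬((i = 0 ∨ i = m) ∧ (j = 0 ∨ j = n)) → g i j = secant ξ e (v i) (w j) :=
    fun i j h => by simp only [hg]; rw [if_neg h]
  have row : ∀ j, (j = 0 ∨ j = n) → (∀ i < m, NotOpposite (g i j) (g (i + 1) j)) ∧
      ∑ i ∈ Finset.range m, turnAngle (g i j) (g (i + 1) j) =
        turnAngle (hor ξ e (v 0) + -hor ξ e (w j)) (-hor ξ e (w j)) +
        turnAngle (-hor ξ e (w j)) (hor ξ e (v m) + -hor ξ e (w j)) := by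
    intro j hj
    refine turn_of_const_direction hm (q := fun i => g i j) (fun i => ξ ⬝ᵥ v i)
      (H.ends 0 j (.inl rfl) hj).2.2 (H.ends m j (.inr rfl) hj).2.2
      (gc _ _ (.inl rfl) hj) (gc _ _ (.inr rfl) hj) fun i hi0 hi => ⟨H.pos i hi0 hi, ?_⟩
    show g _ _ = _
    rw [gs _ _ (by omega)]
    exact secant_of_right ξ e (H.ends 0 j (.inl rfl) hj).2.1 _
  have col : ∀ i, (i = 0 ∨ i = m) → (∀ j < n, NotOpposite (g i j) (g i (j + 1))) ∧
      ∑ j ∈ Finset.range n, turnAngle (g i j) (g i (j + 1)) =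
        turnAngle (hor ξ e (v i) + -hor ξ e (w 0)) (hor ξ e (v i)) +
        turnAngle (hor ξ e (v i)) (hor ξ e (v i) + -hor ξ e (w n)) := by
    intro i hi
    rw [add_comm (hor ξ e (v i)) (-hor ξ e (w 0)), add_comm (hor ξ e (v i)) (-hor ξ e (w n))]
    refine turn_of_const_direction hn (q := fun j => g i j) (fun j => ξ ⬝ᵥ w j)
      (H.ends i 0 hi (.inl rfl)).2.2.symm (H.ends i n hi (.inr rfl)).2.2.symm
      ((gc _ _ hi (.inl rfl)).trans (add_comm _ _)) ((gc _ _ hi (.inr rfl)).trans (add_comm _ _))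
      fun j hj0 hj => ⟨H.pos' j hj0 hj, ?_⟩
    show g _ _ = _
    rw [gs _ _ (by omega)]
    exact secant_of_left ξ e (H.ends i 0 hi (.inl rfl)).1 _
  have hacross : ∀ i j, i < m → j ≤ n → NotOpposite (g i j) (g (i + 1) j) := by
    intro i j hi hj
    by_cases h : j = 0 ∨ j = n
    · exact (row j h).1 i hi
    · rw [gs _ _ (by omega), gs _ _ (by omega)]
      exact H.across hi (by omega) (by omega)
  have hup : ∀ i j, i ≤ m → j < n → NotOpposite (g i j) (g i (j + 1)) := by
    intro i j hi hj
    by_cases h : i = 0 ∨ i = m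
    · exact (col i h).1 j hj
    · rw [gs _ _ (by omega), gs _ _ (by omega)]
      exact H.up (by omega) (by omega) hj
  have gzero : ∀ i j, (i = 0 ∨ i = m) → (j = 0 ∨ j = n) → secant ξ e (v i) (w j) = 0 := by
    intro i j hi hj
    rw [secant_of_left ξ e (H.ends i j hi hj).1, (H.ends i j hi hj).2.1]
    simp
  have corner : ∀ i j i' j', (i = 0 ∨ i = m) → (j = 0 ∨ j = n) → 0 < i' → i' < m → 0 < j' →
      j' < n → ∃ x y : ℝ, 0 < x ∧ 0 < y ∧ g i j = x * g i' j + y * g i j' ∧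
        NotOpposite (g i' j) (g i j') := by
    intro i j i' j' hi hj hi0 hi' hj0 hj'
    have p1 := H.pos i' hi0 hi'
    have p2 := H.pos' j' hj0 hj'
    obtain ⟨z1, z2, no⟩ := H.ends i j hi hj
    refine ⟨(ξ ⬝ᵥ v i')⁻¹, (ξ ⬝ᵥ w j')⁻¹, inv_pos.2 p1, inv_pos.2 p2, ?_, ?_⟩ <;>
      rw [gs i' j (by omega), gs i j' (by omega), secant_of_left ξ e z1, secant_of_right ξ e z2]
    · rw [gc _ _ hi hj, ← sub_eq_add_neg, sub_eq_cone p2 p1, add_comm]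
    · exact (no.smul_smul p2 p1).symm
  have main := sum_rectangle g m n ?_
  · have ee : ∀ i j, (i = 0 ∨ i = m) → (j = 0 ∨ j = n) →
        turnAngle (hor ξ e (v i)) (hor ξ e (v i) + -hor ξ e (w j)) +
          turnAngle (hor ξ e (v i) + -hor ξ e (w j)) (-hor ξ e (w j)) =
        turnAngle (hor ξ e (v i)) (-hor ξ e (w j)) ∧
        turnAngle (hor ξ e (v i) + -hor ξ e (w j)) (hor ξ e (v i)) =
          -turnAngle (hor ξ e (v i)) (hor ξ e (v i) + -hor ξ e (w j)) ∧
        turnAngle (-hor ξ e (w j)) (hor ξ e (v i) + -hor ξ e (w j)) =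
          -turnAngle (hor ξ e (v i) + -hor ξ e (w j)) (-hor ξ e (w j)) := by
      intro i j hi hj
      have no := (H.ends i j hi hj).2.2
      have h1 := no.left_cone (s := 1) (t := 1) (by norm_num) (by norm_num) (by norm_num)
      have h2 := no.cone_right (s := 1) (t := 1) (by norm_num) (by norm_num) (by norm_num)
      have h3 := turnAngle_add_of_cone no (s := 1) (t := 1) (by norm_num) (by norm_num)
        (by norm_num)
      simp only [Complex.ofReal_one, one_mul] at h1 h2 h3
      exact ⟨h3, turnAngle_symm h1, turnAngle_symm h2⟩
    obtain ⟨a1, a2, a3⟩ := ee 0 0 (.inl rfl) (.inl rfl)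
    obtain ⟨b1, b2, b3⟩ := ee m 0 (.inr rfl) (.inl rfl)
    obtain ⟨c1, c2, c3⟩ := ee 0 n (.inl rfl) (.inr rfl)
    obtain ⟨d1, d2, d3⟩ := ee m n (.inr rfl) (.inr rfl)
    rw [(row 0 (.inl rfl)).2, (row n (.inr rfl)).2, (col 0 (.inl rfl)).2,
      (col m (.inr rfl)).2] at main
    linarith
  · intro i j hi hj
    rw [← quadTurn_eq_zero_iff (hacross i (j + 1) hi hj).symm (hup i j hi.le hj).symm]
    have hne := H.secant_ne i j hi hj
    simp only [secant_lineMap] at hne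
    -- Since m, n ≥ 2, a cell contains at most one corner of the rectangle. In the four corner cells
    -- the quadrilateral is rotated until the singular corner comes first.
    by_cases c0 : i = 0 ∧ j = 0
    · obtain ⟨x, y, hx, hy, e, no⟩ := corner i j (i + 1) (j + 1) (by omega) (by omega) (by omega)
        (by omega) (by omega) (by omega)
      rw [e]
      refine quadTurn_of_corner_eq_zero (gzero i j (by omega) (by omega)) no ?_ hx hy
      rw [gs (i + 1) j (by omega), gs (i + 1) (j + 1) (by omega), gs i (j + 1) (by omega)]
      intro s t hs0 hs1 ht0 ht1 h
      have := hne s t (by linarith) (by linarith) (by linarith) (by linarith) (by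
        push_cast at h ⊢
        linear_combination h)
      obtain ⟨h1 | h1, h2 | h2⟩ := this <;> first | omega | (constructor <;> linarith [h1.2, h2.2])
    by_cases c1 : i + 1 = m ∧ j = 0
    · obtain ⟨x, y, hx, hy, e, no⟩ := corner (i + 1) j i (j + 1) (by omega) (by omega) (by omega)
        (by omega) (by omega) (by omega)
      rw [← quadTurn_rotate]
      replace e := e.trans (add_comm _ _)
      rw [e]
      refine quadTurn_of_corner_eq_zero (gzero (i + 1) j (by omega) (by omega)) no.symm ?_ hy hx
      rw [gs i j (by omega), gs i (j + 1) (by omega), gs (i + 1) (j + 1) (by omega)]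
      intro s t hs0 hs1 ht0 ht1 h
      have := hne (1 - t) s (by linarith) (by linarith) (by linarith) (by linarith) (by
        push_cast at h ⊢
        linear_combination h)
      obtain ⟨h1 | h1, h2 | h2⟩ := this <;> first | omega | (constructor <;> linarith [h1.2, h2.2])
    by_cases c2 : i + 1 = m ∧ j + 1 = n
    · obtain ⟨x, y, hx, hy, e, no⟩ := corner (i + 1) (j + 1) i j (by omega) (by omega) (by omega)
        (by omega) (by omega) (by omega)
      rw [← quadTurn_rotate, ← quadTurn_rotate]
      rw [e]
      refine quadTurn_of_corner_eq_zero (gzero (i + 1) (j + 1) (by omega) (by omega)) no ?_ hx hy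
      rw [gs i (j + 1) (by omega), gs i j (by omega), gs (i + 1) j (by omega)]
      intro s t hs0 hs1 ht0 ht1 h
      have := hne (1 - s) (1 - t) (by linarith) (by linarith) (by linarith) (by linarith) (by
        push_cast at h ⊢
        linear_combination h)
      obtain ⟨h1 | h1, h2 | h2⟩ := this <;> first | omega | (constructor <;> linarith [h1.2, h2.2])
    by_cases c3 : i = 0 ∧ j + 1 = n
    · obtain ⟨x, y, hx, hy, e, no⟩ := corner i (j + 1) (i + 1) j (by omega) (by omega) (by omega)
        (by omega) (by omega) (by omega)
      rw [← quadTurn_rotate, ← quadTurn_rotate, ← quadTurn_rotate]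
      replace e := e.trans (add_comm _ _)
      rw [e]
      refine quadTurn_of_corner_eq_zero (gzero i (j + 1) (by omega) (by omega)) no.symm ?_ hy hx
      rw [gs (i + 1) (j + 1) (by omega), gs (i + 1) j (by omega), gs i j (by omega)]
      intro s t hs0 hs1 ht0 ht1 h
      have := hne t (1 - s) (by linarith) (by linarith) (by linarith) (by linarith) (by
        push_cast at h ⊢
        linear_combination h)
      obtain ⟨h1 | h1, h2 | h2⟩ := this <;> first | omega | (constructor <;> linarith [h1.2, h2.2])
    rw [gs i j (by omega), gs (i + 1) j (by omega), gs (i + 1) (j + 1) (by omega),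
      gs i (j + 1) (by omega)]
    apply quadTurn_eq_zero
    intro s t hs0 hs1 ht0 ht1 h
    have := hne s t hs0 hs1 ht0 ht1 h
    omega

end AreDisjointArcs

/-! ### Secants of simple polygons -/

/-- On the equator the projection preserves lengths, so a vanishing point on the segment from a to
-b would have to be its midpoint, which forces a = b. -/
lemma notOpposite_neg_of_ne {ξ e : V3} (he : IsFrame ξ e) {a b : V3} (ha : a ⬝ᵥ a = 1)
    (hb : b ⬝ᵥ b = 1) (hza : ξ ⬝ᵥ a = 0) (hzb : ξ ⬝ᵥ b = 0) (hab : a ≠ b) :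
    NotOpposite (hor ξ e a) (-hor ξ e b) := by
  apply NotOpposite.of_segment
  intro t h0 h1 h
  have h2 : ((1 - t : ℝ) : ℂ) * hor ξ e a = (t : ℂ) * hor ξ e b := by linear_combination h
  have na := he.normSq_hor a
  have nb := he.normSq_hor b
  rw [hza, ha] at na
  rw [hzb, hb] at nb
  have h3 := congrArg Complex.normSq h2
  rw [Complex.normSq_mul, Complex.normSq_mul, Complex.normSq_ofReal, Complex.normSq_ofReal] at h3
  have ht : t = 1 / 2 := by
    have e1 : Complex.normSq (hor ξ e a) = 1 := by linarith
    have e2 : Complex.normSq (hor ξ e b) = 1 := by linarith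
    rw [e1, e2] at h3
    linarith
  subst ht
  apply hab
  apply he.ext
  · norm_num at h2
    exact h2
  · rw [hza, hzb]

namespace SphPolygon
variable (W : SphPolygon)

lemma w_ne_zero (i : ℤ) : W.w i ≠ 0 := by
  intro h
  have := W.unit i
  rw [h] at this
  simp at this

lemma n_pos : 0 < W.n := by have := W.three_le; omega

lemma w_add_mul (i k : ℤ) : W.w (i + W.n * k) = W.w i := by
  have hp : Function.Periodic W.w (W.n : ℤ) := fun i => W.periodic i
  have := hp.int_mul k i
  rw [mul_comm]; exact_mod_cast this

lemma w_eq_of_modEq {i j : ℤ} (h : i ≡ j [ZMOD W.n]) : W.w i = W.w j := by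
  obtain ⟨k, hk⟩ := h.dvd
  rw [show j = i + W.n * k by linarith, w_add_mul]

lemma eq_zero_of_comb_eq_zero {i : ℤ} {s t : ℝ} (h : s • W.w i + t • W.w (i + 1) = 0) :
    s = 0 ∧ t = 0 := by
  have key : ∀ {a b : V3} {s t : ℝ}, a ⬝ᵥ a = 1 → b ⬝ᵥ b = 1 → b ≠ a → b ≠ -a →
      s • a + t • b = 0 → t = 0 := by
    intro a b s t ha hb h1 h2 h
    by_contra ht
    have e : b = (-(s / t)) • a := by
      have : t • b = (-s) • a := by
        rw [neg_smul]; exact eq_neg_of_add_eq_zero_right h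
      rw [← one_smul ℝ b, ← inv_mul_cancel₀ ht, mul_smul, this, smul_smul]
      congr 1; ring
    rw [e] at hb
    simp only [smul_dotProduct, dotProduct_smul, ha, smul_eq_mul, mul_one] at hb
    rcases mul_self_eq_one_iff.1 hb with h | h
    · rw [h, one_smul] at e; exact h1 e
    · rw [h, neg_smul, one_smul] at e; exact h2 e
  refine ⟨?_, key (W.unit i) (W.unit (i + 1)) (W.ne_next i) (W.ne_neg_next i) h⟩
  refine key (W.unit (i + 1)) (W.unit i) (W.ne_next i).symm ?_ ((add_comm _ _).trans h)
  intro h'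
  apply W.ne_neg_next i
  rw [h', neg_neg]

lemma exists_smul_mem_sphArc {a b p : V3} {s t : ℝ} (hs : 0 ≤ s) (ht : 0 ≤ t)
    (hp : p = s • a + t • b) (h0 : p ≠ 0) : ∃ c : ℝ, 0 < c ∧ c • p ∈ sphArc a b := by
  have hpos : 0 < p ⬝ᵥ p := by
    refine lt_of_le_of_ne (Finset.sum_nonneg fun i _ => mul_self_nonneg (p i)) fun h => ?_
    exact h0 (dotProduct_self_eq_zero.1 h.symm)
  have hsq := Real.sqrt_pos.2 hpos
  refine ⟨(Real.sqrt (p ⬝ᵥ p))⁻¹, inv_pos.2 hsq, ?_, (Real.sqrt (p ⬝ᵥ p))⁻¹ * s,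
    (Real.sqrt (p ⬝ᵥ p))⁻¹ * t, by positivity, by positivity, ?_⟩
  · simp only [smul_dotProduct, dotProduct_smul, smul_eq_mul]
    have h2 := Real.mul_self_sqrt hpos.le
    field_simp
    nlinarith
  · rw [mul_smul, mul_smul, ← smul_add, ← hp]

lemma segment_ne_zero (i : ℤ) (s : ℝ) : (1 - s) • W.w i + s • W.w (i + 1) ≠ 0 := by
  intro h
  have := W.eq_zero_of_comb_eq_zero h
  linarith [this.1, this.2]

lemma left_mem_edge (i : ℤ) : W.w i ∈ W.edge i :=
  ⟨W.unit i, 1, 0, zero_le_one, le_rfl, by simp⟩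

lemma right_mem_edge (i : ℤ) : W.w (i + 1) ∈ W.edge i :=
  ⟨W.unit _, 0, 1, le_rfl, zero_le_one, by simp⟩

variable {W}

lemma not_modEq_of_lt {i j : ℤ} (h1 : i < j) (h2 : j < i + W.n) : ¬ i ≡ j [ZMOD W.n] := by
  intro h
  have := Int.le_of_dvd (by linarith) h.dvd
  linarith

/-- Two points of a simple polygon that are positively proportional. -/
lemma IsSimple.eq_of_smul (hW : W.IsSimple) {i j : ℤ} {s t c : ℝ} (hs0 : 0 ≤ s) (hs1 : s ≤ 1)
    (ht0 : 0 ≤ t) (ht1 : t ≤ 1) (hc : 0 < c)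
    (h : (1 - t) • W.w j + t • W.w (j + 1) = c • ((1 - s) • W.w i + s • W.w (i + 1))) :
    i ≡ j [ZMOD W.n] ∨ (j ≡ i + 1 [ZMOD W.n] ∧ s = 1 ∧ t = 0) ∨
      (i ≡ j + 1 [ZMOD W.n] ∧ s = 0 ∧ t = 1) := by
  set p := (1 - s) • W.w i + s • W.w (i + 1) with hp
  have hp0 : p ≠ 0 := W.segment_ne_zero i s
  obtain ⟨d, hd, hdp⟩ := exists_smul_mem_sphArc (sub_nonneg.2 hs1) hs0 hp hp0
  have hdq : d • p ∈ W.edge j := by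
    refine ⟨hdp.1, d * c⁻¹ * (1 - t), d * c⁻¹ * t, by have := sub_nonneg.2 ht1; positivity,
      by positivity, ?_⟩
    rw [mul_smul (d * c⁻¹) (1 - t), mul_smul (d * c⁻¹) t, ← smul_add, h, smul_smul]
    congr 1
    field_simp
  have hs' : ∀ {k : ℤ} {x : ℝ} {d : ℝ}, 0 < d →
      d • ((1 - x) • W.w k + x • W.w (k + 1)) = W.w (k + 1) → x = 1 := by
    intro k x d hd h
    have := W.eq_zero_of_comb_eq_zero (i := k) (s := d * (1 - x)) (t := d * x - 1) (by
      rw [← sub_eq_zero.2 h, sub_smul, one_smul, mul_smul, mul_smul, smul_add]; abel)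
    linarith [(mul_eq_zero.1 this.1).resolve_left hd.ne']
  have hs2 : ∀ {k : ℤ} {x : ℝ} {d : ℝ}, 0 < d →
      d • ((1 - x) • W.w k + x • W.w (k + 1)) = W.w k → x = 0 := by
    intro k x d hd h
    have := W.eq_zero_of_comb_eq_zero (i := k) (s := d * (1 - x) - 1) (t := d * x) (by
      rw [← sub_eq_zero.2 h, sub_smul, one_smul, mul_smul, mul_smul, smul_add]; abel)
    exact (mul_eq_zero.1 this.2).resolve_left hd.ne'
  have hq : (d * c⁻¹) • ((1 - t) • W.w j + t • W.w (j + 1)) = d • p := by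
    rw [h, smul_smul]; congr 1; field_simp
  have hdc : 0 < d * c⁻¹ := by positivity
  rcases hW i j (d • p) hdp hdq with h1 | ⟨h1, h2⟩ | ⟨h1, h2⟩
  · exact .inl h1
  · refine .inr (.inl ⟨h1, ?_, ?_⟩)
    · exact hs' hd (h2.trans (W.w_eq_of_modEq h1))
    · exact hs2 hdc (hq.trans h2)
  · refine .inr (.inr ⟨h1, ?_, ?_⟩)
    · exact hs2 hd h2
    · exact hs' hdc ((hq.trans h2).trans (W.w_eq_of_modEq h1))

lemma IsSimple.w_injective (hW : W.IsSimple) {i j : ℤ} (h : W.w i = W.w j) :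
    i ≡ j [ZMOD W.n] := by
  have hn := W.three_le
  rcases hW.eq_of_smul (i := i) (j := j) (s := 0) (t := 0) (c := 1) le_rfl zero_le_one le_rfl
    zero_le_one one_pos (by simpa using h.symm) with h | h | h
  · exact h
  · exact absurd h.2.1 zero_ne_one
  · exact absurd h.2.2 zero_ne_one

/-- The secant of two points on the same side vanishes only where simplicity permits. -/
lemma IsSimple.secant_eq_zero (hW : W.IsSimple) {ξ e : V3} (he : IsFrame ξ e) {i j : ℤ} {s t : ℝ}
    (hs0 : 0 ≤ s) (hs1 : s ≤ 1) (ht0 : 0 ≤ t) (ht1 : t ≤ 1)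
    (hz : 0 < (ξ ⬝ᵥ ((1 - s) • W.w i + s • W.w (i + 1))) *
      (ξ ⬝ᵥ ((1 - t) • W.w j + t • W.w (j + 1))))
    (h : secant ξ e ((1 - s) • W.w i + s • W.w (i + 1)) ((1 - t) • W.w j + t • W.w (j + 1)) = 0) :
    i ≡ j [ZMOD W.n] ∨ (j ≡ i + 1 [ZMOD W.n] ∧ s = 1 ∧ t = 0) ∨
      (i ≡ j + 1 [ZMOD W.n] ∧ s = 0 ∧ t = 1) := by
  have hp := left_ne_zero_of_mul hz.ne'
  exact hW.eq_of_smul hs0 hs1 ht0 ht1 (div_pos_iff_of_mul_pos hz)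
    (he.eq_smul_of_secant_eq_zero h hp)
where
  div_pos_iff_of_mul_pos {a b : ℝ} (h : 0 < a * b) : 0 < b / a := by
    rcases pos_and_pos_or_neg_and_neg_of_mul_pos h with h | h
    · exact div_pos h.2 h.1
    · exact div_pos_of_neg_of_neg h.2 h.1

/-- The directions of consecutive vertices of the polar polygon are not opposite. -/
lemma IsSimple.notOpposite_secant (hW : W.IsSimple) {ξ e : V3} (he : IsFrame ξ e)
    (hadm : W.IsAdmissible ξ) (i : ℤ) :
    NotOpposite (secant ξ e (W.w i) (W.w (i + 1))) (secant ξ e (W.w (i + 1)) (W.w (i + 2))) := by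
  have hn := W.three_le
  have e2 : i + 1 + 1 = i + 2 := by ring
  apply NotOpposite.of_segment
  intro t h0 h1 h
  -- At a vertex on the equator both secants are multiples of its projection, with factors of the
  -- same sign because the neighbours have heights of opposite signs.
  by_cases hz : ξ ⬝ᵥ W.w (i + 1) = 0
  · have ha := hadm (i + 1) hz
    rw [add_sub_cancel_right, e2] at ha
    rw [secant_of_left ξ e hz, secant_of_right ξ e hz] at h
    have hne := he.hor_ne_zero (W.w_ne_zero (i + 1)) hz
    have h3 : (((1 - t) * (ξ ⬝ᵥ W.w i) - t * (ξ ⬝ᵥ W.w (i + 2)) : ℝ) : ℂ) *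
        hor ξ e (W.w (i + 1)) = 0 := by
      push_cast at h ⊢
      linear_combination -h
    have h4 : (1 - t) * (ξ ⬝ᵥ W.w i) - t * (ξ ⬝ᵥ W.w (i + 2)) = 0 := by
      exact_mod_cast (mul_eq_zero.1 h3).resolve_right hne
    have h5 : (1 - t) * ((ξ ⬝ᵥ W.w i) * (ξ ⬝ᵥ W.w (i + 2))) = t * (ξ ⬝ᵥ W.w (i + 2)) ^ 2 := by
      linear_combination (ξ ⬝ᵥ W.w (i + 2)) * h4
    have h6 : (ξ ⬝ᵥ W.w (i + 2)) ≠ 0 := right_ne_zero_of_mul ha.ne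
    have h7 : 0 < (ξ ⬝ᵥ W.w (i + 2)) ^ 2 := by positivity
    rcases h0.eq_or_lt with rfl | ht
    · nlinarith
    · nlinarith [mul_pos ht h7]
  -- Off the equator a zero means that (1 - t) w_i - t w_{i+2} = μ w_{i+1}, so the polygon folds
  -- back on itself. The sign of μ decides whether w_i lies on the next edge or w_{i+2} on the
  -- previous one; either contradicts simplicity.
  · set x := (1 - t) • W.w i + (-t) • W.w (i + 2) with hx
    have h2 : secant ξ e (W.w (i + 1)) x = 0 := by
      rw [hx, secant_add_right, secant_smul_right, secant_smul_right]
      have : secant ξ e (W.w (i + 1)) (W.w i) = -secant ξ e (W.w i) (W.w (i + 1)) := by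
        unfold secant; ring
      rw [this]
      push_cast at h ⊢
      linear_combination -h
    have h3 := he.eq_smul_of_secant_eq_zero h2 hz
    set μ := (ξ ⬝ᵥ x) / (ξ ⬝ᵥ W.w (i + 1)) with hμ
    rcases h0.eq_or_lt with rfl | ht
    · have := W.eq_zero_of_comb_eq_zero (i := i) (s := 1) (t := -μ) (by
        rw [neg_smul, ← h3, hx]; simp)
      exact one_ne_zero this.1
    rcases h1.eq_or_lt with rfl | ht1
    · have := W.eq_zero_of_comb_eq_zero (i := i + 1) (s := μ) (t := 1) (by
        rw [← h3, hx, e2]; simp)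
      exact one_ne_zero this.2
    have ht1' : 0 < 1 - t := by linarith
    rcases le_total 0 μ with hμ0 | hμ0
    · have hmem : W.w i ∈ W.edge (i + 1) := by
        refine ⟨W.unit i, μ / (1 - t), t / (1 - t), by positivity, by positivity, ?_⟩
        rw [e2]
        have : (1 - t) • W.w i = μ • W.w (i + 1) + t • W.w (i + 2) := by
          rw [← h3, hx, neg_smul]; abel
        rw [div_eq_inv_mul, div_eq_inv_mul, mul_smul, mul_smul, ← smul_add, ← this, smul_smul,
          inv_mul_cancel₀ ht1'.ne', one_smul]
      rcases hW i (i + 1) _ (W.left_mem_edge i) hmem with h | ⟨_, h⟩ | ⟨h, _⟩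
      · exact not_modEq_of_lt (by omega) (by omega) h
      · exact W.ne_next i h.symm
      · exact not_modEq_of_lt (by omega) (by omega) h
    · have hmem : W.w (i + 2) ∈ W.edge i := by
        refine ⟨W.unit _, (1 - t) / t, -μ / t, by positivity,
          div_nonneg (by linarith) ht.le, ?_⟩
        have : t • W.w (i + 2) = (1 - t) • W.w i + (-μ) • W.w (i + 1) := by
          rw [neg_smul, ← h3, hx, neg_smul]; abel
        rw [div_eq_inv_mul, div_eq_inv_mul, mul_smul, mul_smul, ← smul_add, ← this, smul_smul,
          inv_mul_cancel₀ ht.ne', one_smul]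
      have hmem' := W.right_mem_edge (i + 1)
      rw [e2] at hmem'
      rcases hW i (i + 1) _ hmem hmem' with h | ⟨_, h⟩ | ⟨h, _⟩
      · exact not_modEq_of_lt (by omega) (by omega) h
      · rw [← e2] at h; exact W.ne_next (i + 1) h
      · exact not_modEq_of_lt (by omega) (by omega) h

end SphPolygon

/-! ### The chords of a polygon -/

/-- The alternating sign that distinguishes the two hemispheres. -/
def altSign (k : ℤ) : ℝ := if Even k then 1 else -1

lemma altSign_succ (k : ℤ) : altSign (k + 1) = -altSign k := by
  unfold altSign
  by_cases h : Even k
  · have : ¬ Even (k + 1) := by rw [Int.even_add_one]; exact not_not.2 h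
    simp [h, this]
  · have : Even (k + 1) := by rw [Int.even_add_one]; exact h
    simp [h, this]

lemma altSign_eq (k : ℤ) : altSign k = 1 ∨ altSign k = -1 := by
  unfold altSign; split_ifs <;> simp

namespace SphPolygon

/-- `c` runs through the vertices of the subdivided polygon `Y` on the equator. -/
structure IsCrossingSeq (Y : SphPolygon) (ξ : V3) (c : ℤ → ℤ) : Prop where
  admissible : Y.IsAdmissible ξ
  subdivided : Y.IsSubdivided ξ
  mono : StrictMono c
  zero_iff : ∀ j : ℤ, ξ ⬝ᵥ Y.w j = 0 ↔ ∃ k, c k = j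

/-- `c` enumerates the vertices of the subdivided simple polygon `Y` on the equator; the chords
with even numbers lie in the upper hemisphere. -/
structure IsEnumeration (Y : SphPolygon) (ξ : V3) (r : ℕ) (c : ℤ → ℤ) : Prop
    extends IsCrossingSeq Y ξ c where
  simple : Y.IsSimple
  r_pos : 0 < r
  shift : ∀ k, c (k + 2 * r) = c k + Y.n
  up : ∀ i : ℤ, 0 < ξ ⬝ᵥ Y.w (c (2 * i) + 1)

/-- The vertices of the `k`-th chord, reflected to the upper hemisphere. -/
def chordArc (Y : SphPolygon) (c : ℤ → ℤ) (k : ℤ) (i : ℕ) : V3 := altSign k • Y.w (c k + i)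

/-- The number of edges of the `k`-th chord. -/
def chordLen (c : ℤ → ℤ) (k : ℤ) : ℕ := (c (k + 1) - c k).toNat

/-- Otherwise the edge would have a point on the equator in its interior, namely the combination of
its ends with the absolute values of the opposite heights as weights. -/
lemma IsSubdivided.mul_pos {Y : SphPolygon} {ξ : V3} (h : Y.IsSubdivided ξ) {j : ℤ}
    (h1 : ξ ⬝ᵥ Y.w j ≠ 0) (h2 : ξ ⬝ᵥ Y.w (j + 1) ≠ 0) :
    0 < (ξ ⬝ᵥ Y.w j) * (ξ ⬝ᵥ Y.w (j + 1)) := by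
  by_contra hneg
  have hlt : (ξ ⬝ᵥ Y.w j) * (ξ ⬝ᵥ Y.w (j + 1)) < 0 :=
    lt_of_le_of_ne (not_lt.1 hneg) (mul_ne_zero h1 h2)
  set a := ξ ⬝ᵥ Y.w j with ha
  set b := ξ ⬝ᵥ Y.w (j + 1) with hb
  have hp0 : |b| • Y.w j + |a| • Y.w (j + 1) ≠ 0 := fun h0 => by
    exact h2 (abs_eq_zero.1 (Y.eq_zero_of_comb_eq_zero h0).1)
  obtain ⟨d, hd, hmem⟩ := exists_smul_mem_sphArc (abs_nonneg b) (abs_nonneg a) rfl hp0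
  have hz : ξ ⬝ᵥ (d • (|b| • Y.w j + |a| • Y.w (j + 1))) = 0 := by
    simp only [dotProduct_smul, dotProduct_add, smul_eq_mul, ← ha, ← hb]
    have : |b| * a + |a| * b = 0 := by
      rcases mul_neg_iff.1 hlt with ⟨h3, h4⟩ | ⟨h3, h4⟩
      · rw [abs_of_pos h3, abs_of_neg h4]; ring
      · rw [abs_of_neg h3, abs_of_pos h4]; ring
    rw [this, mul_zero]
  rcases h j _ hmem hz with h3 | h3 <;> rw [h3] at hz
  · exact h1 hz
  · exact h2 hz

namespace IsCrossingSeq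
variable {Y : SphPolygon} {ξ : V3} {c : ℤ → ℤ} (E : Y.IsCrossingSeq ξ c)
include E

lemma zero (k : ℤ) : ξ ⬝ᵥ Y.w (c k) = 0 := (E.zero_iff _).2 ⟨k, rfl⟩

lemma ne_zero {k j : ℤ} (h1 : c k < j) (h2 : j < c (k + 1)) : ξ ⬝ᵥ Y.w j ≠ 0 := by
  intro h
  obtain ⟨l, rfl⟩ := (E.zero_iff j).1 h
  have := E.mono.lt_iff_lt.1 h1
  have := E.mono.lt_iff_lt.1 h2
  omega

lemma same_sign {k : ℤ} (i : ℕ) (h : c k + 1 + i < c (k + 1)) :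
    0 < (ξ ⬝ᵥ Y.w (c k + 1)) * (ξ ⬝ᵥ Y.w (c k + 1 + i)) := by
  induction i with
  | zero =>
    have := E.ne_zero (k := k) (j := c k + 1) (by omega) (by push_cast at h; omega)
    simp only [Nat.cast_zero, add_zero]
    exact mul_self_pos.2 this
  | succ i ih =>
    have h1 := ih (by push_cast at h; omega)
    have h2 := E.subdivided.mul_pos (j := c k + 1 + i) (right_ne_zero_of_mul h1.ne')
      (E.ne_zero (k := k) (by omega) (by push_cast at h; omega))
    push_cast
    rw [← add_assoc]
    have h3 := _root_.mul_pos h1 h2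
    have h4 : 0 < (ξ ⬝ᵥ Y.w (c k + 1 + i)) ^ 2 := by
      have := right_ne_zero_of_mul h1.ne'
      positivity
    by_contra h5
    have := mul_nonneg h4.le (neg_nonneg.2 (not_lt.1 h5))
    linarith

lemma adm (k : ℤ) : (ξ ⬝ᵥ Y.w (c k - 1)) * (ξ ⬝ᵥ Y.w (c k + 1)) < 0 :=
  E.admissible _ (E.zero k)

lemma add_two_le (k : ℤ) : c k + 2 ≤ c (k + 1) := by
  have h1 := E.mono (lt_add_one k)
  have h2 : c k + 1 ≠ c (k + 1) := by
    intro h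
    have := E.adm k
    rw [h, E.zero] at this
    simp at this
  omega

/-- The height keeps its sign between two crossings and changes it at the crossing by admissibility.
-/
lemma alternating (k : ℤ) :
    (ξ ⬝ᵥ Y.w (c k + 1)) * (ξ ⬝ᵥ Y.w (c (k + 1) + 1)) < 0 := by
  have h2 := E.add_two_le k
  have h3 := E.same_sign (k := k) (c (k + 1) - c k - 2).toNat (by omega)
  have h4 := E.adm (k + 1)
  rw [show c k + 1 + ((c (k + 1) - c k - 2).toNat : ℤ) = c (k + 1) - 1 by omega] at h3
  have h5 := mul_neg_of_pos_of_neg h3 h4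
  have h6 : 0 < (ξ ⬝ᵥ Y.w (c (k + 1) - 1)) ^ 2 := by
    have := left_ne_zero_of_mul h4.ne
    positivity
  by_contra hc
  have := mul_nonneg h6.le (not_lt.1 hc)
  nlinarith

lemma chordLen_cast (k : ℤ) : (chordLen c k : ℤ) = c (k + 1) - c k := by
  have := E.add_two_le k
  unfold chordLen; omega

lemma two_le_chordLen (k : ℤ) : 2 ≤ chordLen c k := by
  have := E.add_two_le k
  have := E.chordLen_cast k
  omega

lemma sum_chords {M : Type*} [AddCommMonoid M] (g : ℤ → M) (l : ℕ) :
    ∑ i ∈ Finset.range (c l - c 0).toNat, g (c 0 + i) =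
      ∑ k ∈ Finset.range l, ∑ i ∈ Finset.range (chordLen c k), g (c k + i) := by
  induction l with
  | zero => simp
  | succ l ih =>
    have h1 := E.chordLen_cast l
    have h2 : c 0 ≤ c l := E.mono.monotone (by omega)
    rw [Finset.sum_range_succ, ← ih]
    rw [show (c ((l + 1 : ℕ) : ℤ) - c 0).toNat = (c l - c 0).toNat + chordLen c l by
      push_cast; omega, Finset.sum_range_add]
    congr 1
    refine Finset.sum_congr rfl fun i _ => ?_
    congr 1
    push_cast
    omega

end IsCrossingSeq

/-! ### Chords as arcs in the upper hemisphere -/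

namespace IsEnumeration
variable {Y : SphPolygon} {ξ e : V3} {r : ℕ} {c : ℤ → ℤ} (E : Y.IsEnumeration ξ r c)
include E

lemma sign_first (k : ℤ) : 0 < altSign k * (ξ ⬝ᵥ Y.w (c k + 1)) := by
  rcases Int.even_or_odd' k with ⟨i, rfl | rfl⟩
  · simpa [altSign] using E.up i
  · have := (pos_iff_neg_of_mul_neg (E.alternating (2 * i))).1 (E.up i)
    rw [altSign_succ, show altSign (2 * i) = 1 by simp [altSign]]
    linarith

lemma sign {k : ℤ} {j : ℤ} (h1 : c k < j) (h2 : j < c (k + 1)) :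
    0 < altSign k * (ξ ⬝ᵥ Y.w j) := by
  have h3 := E.sign_first k
  have h4 := E.same_sign (k := k) (j - c k - 1).toNat (by omega)
  rw [show c k + 1 + ((j - c k - 1).toNat : ℤ) = j by omega] at h4
  have h5 := _root_.mul_pos h3 h4
  have h6 : 0 < (ξ ⬝ᵥ Y.w (c k + 1)) ^ 2 := by
    have := left_ne_zero_of_mul h4.ne'
    positivity
  by_contra h7
  have := mul_nonneg h6.le (neg_nonneg.2 (not_lt.1 h7))
  nlinarith

lemma chordArc_last (k : ℤ) : Y.chordArc c k (chordLen c k) = altSign k • Y.w (c (k + 1)) := by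
  unfold chordArc
  rw [E.chordLen_cast]
  congr 2
  ring

omit E in
lemma chordArc_zero (k : ℤ) : Y.chordArc c k 0 = altSign k • Y.w (c k) := by
  simp [chordArc]

lemma vertex_ne {k l : ℤ} (h1 : k < l) (h2 : l < k + 2 * r) : Y.w (c k) ≠ Y.w (c l) := by
  intro h
  have h3 := E.simple.w_injective h
  refine not_modEq_of_lt (E.mono h1) ?_ h3
  rw [← E.shift]
  exact E.mono h2

lemma notOpposite_ends (he : IsFrame ξ e) {k l : ℤ} (h1 : k < l) (h2 : l < k + 2 * r) :
    NotOpposite (hor ξ e (Y.w (c k))) (-hor ξ e (Y.w (c l))) :=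
  notOpposite_neg_of_ne he (Y.unit _) (Y.unit _) (E.zero k) (E.zero l) (E.vertex_ne h1 h2)

lemma height_arc {k : ℤ} {i : ℕ} (hi : 0 < i) (h : i < chordLen c k) :
    0 < ξ ⬝ᵥ Y.chordArc c k i := by
  have := E.chordLen_cast k
  rw [chordArc, dotProduct_smul]
  exact E.sign (by omega) (by omega)

lemma height_arc_nonneg {k : ℤ} {i : ℕ} (h : i ≤ chordLen c k) :
    0 ≤ ξ ⬝ᵥ Y.chordArc c k i := by
  rcases Nat.eq_zero_or_pos i with rfl | hi
  · rw [chordArc_zero, dotProduct_smul, E.zero]; simp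
  rcases h.eq_or_lt with rfl | h
  · rw [E.chordArc_last, dotProduct_smul, E.zero]; simp
  · exact (E.height_arc hi h).le

/-- Interior points of a chord are off the equator. -/
lemma height_segment {k : ℤ} {i : ℕ} (h : i < chordLen c k) {s : ℝ} (h0 : 0 ≤ s) (h1 : s ≤ 1) :
    (0 < ξ ⬝ᵥ ((1 - s) • Y.chordArc c k i + s • Y.chordArc c k (i + 1))) ∨
      (i = 0 ∧ s = 0) ∨ (i + 1 = chordLen c k ∧ s = 1) := by
  have h2 := E.two_le_chordLen k
  have a := E.height_arc_nonneg (k := k) h.le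
  have b := E.height_arc_nonneg (k := k) (i := i + 1) h
  simp only [dotProduct_add, dotProduct_smul, smul_eq_mul]
  have h1' := sub_nonneg.2 h1
  rcases Nat.eq_zero_or_pos i with rfl | hi
  · have hb := E.height_arc (k := k) (i := 1) (by omega) (by omega)
    rcases h0.eq_or_lt with rfl | hs
    · exact .inr (.inl ⟨rfl, rfl⟩)
    · left
      have := _root_.mul_pos hs hb
      have := mul_nonneg h1' a
      linarith
  · have ha := E.height_arc (k := k) hi h
    rcases h1.eq_or_lt with rfl | hs
    · by_cases hl : i + 1 = chordLen c k
      · exact .inr (.inr ⟨hl, rfl⟩)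
      · left
        simpa using E.height_arc (k := k) (i := i + 1) (by omega) (by omega)
    · left
      have := _root_.mul_pos (sub_pos.2 hs) ha
      have := mul_nonneg h0 b
      linarith

omit E in
lemma segment_chordArc (k : ℤ) (i : ℕ) (s : ℝ) :
    (1 - s) • Y.chordArc c k i + s • Y.chordArc c k (i + 1) =
      altSign k • ((1 - s) • Y.w (c k + i) + s • Y.w (c k + i + 1)) := by
  unfold chordArc
  push_cast
  rw [smul_add, smul_comm, smul_comm s, add_assoc]

omit E in
lemma altSign_smul_ne_zero (k : ℤ) {v : V3} (h : v ≠ 0) : altSign k • v ≠ 0 := by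
  apply smul_ne_zero _ h
  rcases altSign_eq k with h | h <;> rw [h] <;> norm_num

/-- Vanishing secants between two chords in the same hemisphere. -/
lemma secant_chordArc (he : IsFrame ξ e) {k l : ℤ} (hkl : altSign k = altSign l) {i j : ℕ}
    (hi : i < chordLen c k) (hj : j < chordLen c l) {s t : ℝ} (hs0 : 0 ≤ s) (hs1 : s ≤ 1)
    (ht0 : 0 ≤ t) (ht1 : t ≤ 1)
    (h : secant ξ e ((1 - s) • Y.chordArc c k i + s • Y.chordArc c k (i + 1))
      ((1 - t) • Y.chordArc c l j + t • Y.chordArc c l (j + 1)) = 0) :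
    (((i = 0 ∧ s = 0) ∨ (i + 1 = chordLen c k ∧ s = 1)) ∧
      ((j = 0 ∧ t = 0) ∨ (j + 1 = chordLen c l ∧ t = 1))) ∨
    c k + i ≡ c l + j [ZMOD Y.n] ∨ (c l + j ≡ c k + i + 1 [ZMOD Y.n] ∧ s = 1 ∧ t = 0) ∨
      (c k + i ≡ c l + j + 1 [ZMOD Y.n] ∧ s = 0 ∧ t = 1) := by
  -- The secant of a point on the equator and a point above it never vanishes. So for a zero either
  -- both points are on the equator, i.e. ends of chords, or both are above it and simplicity
  -- applies.
  have key : ∀ {a b : V3}, a ≠ 0 → 0 < ξ ⬝ᵥ b → secant ξ e a b = 0 → ξ ⬝ᵥ a ≠ 0 := by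
    intro a b ha hb hab hza
    rw [secant_of_left ξ e hza] at hab
    rcases mul_eq_zero.1 hab with h | h
    · exact hb.ne' (by exact_mod_cast h)
    · exact he.hor_ne_zero ha hza h
  have hne : ∀ (k : ℤ) (i : ℕ) (s : ℝ),
      (1 - s) • Y.chordArc c k i + s • Y.chordArc c k (i + 1) ≠ 0 := fun k i s => by
    rw [segment_chordArc]
    exact altSign_smul_ne_zero k (Y.segment_ne_zero _ s)
  have hzz : ∀ (k : ℤ) (i : ℕ) (s : ℝ), (i = 0 ∧ s = 0) ∨ (i + 1 = chordLen c k ∧ s = 1) →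
      ξ ⬝ᵥ ((1 - s) • Y.chordArc c k i + s • Y.chordArc c k (i + 1)) = 0 := by
    rintro k i s (⟨rfl, rfl⟩ | ⟨h, rfl⟩)
    · simp [chordArc_zero, dotProduct_smul, E.zero]
    · rw [h, E.chordArc_last]
      simp [dotProduct_smul, E.zero]
  have hsymm : ∀ a b : V3, secant ξ e a b = -secant ξ e b a := fun a b => by
    unfold secant; ring
  rcases E.height_segment hi hs0 hs1 with h1 | h1 <;> rcases E.height_segment hj ht0 ht1 with h2 | h2
  · right
    rw [segment_chordArc, segment_chordArc, hkl, secant_smul_left, secant_smul_right] at h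
    rw [segment_chordArc, hkl, dotProduct_smul] at h1
    rw [segment_chordArc, dotProduct_smul] at h2
    apply E.simple.secant_eq_zero he hs0 hs1 ht0 ht1
    · have := _root_.mul_pos h1 h2
      simp only [smul_eq_mul] at this
      rcases altSign_eq l with h | h <;> rw [h] at this <;> linarith
    · rcases altSign_eq l with h' | h' <;> simpa [h'] using h
  · exact absurd (hzz _ _ _ h2) (key (hne _ _ _) h1 (by rw [hsymm, h, neg_zero]))
  · exact absurd (hzz _ _ _ h1) (key (hne _ _ _) h2 h)
  · exact .inl ⟨h1, h2⟩

omit E in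
lemma hor_chord_ends (k : ℤ) {P : ℂ → ℂ → ℝ} (hP : ∀ x y, P (-x) (-y) = P x y) (x y : V3) :
    P (hor ξ e (altSign k • x)) (-hor ξ e (altSign k • y)) = P (hor ξ e x) (-hor ξ e y) := by
  rcases altSign_eq k with h | h
  · simp [h]
  · have := hP (hor ξ e x) (-hor ξ e y)
    rw [neg_neg] at this
    simpa [h] using this

lemma isChordArc (he : IsFrame ξ e) (k : ℤ) :
    IsChordArc ξ e (Y.chordArc c k) (chordLen c k) := by
  have hr := E.r_pos
  have hlen := E.chordLen_cast k
  have hlt : c (k + 1) < c k + Y.n := by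
    rw [← E.shift]
    exact E.mono (by omega)
  refine ⟨E.two_le_chordLen k, ?_, ?_, fun i hi h => E.height_arc hi h, ?_, ?_⟩
  · rw [chordArc_zero, dotProduct_smul, E.zero, smul_zero]
  · rw [E.chordArc_last, dotProduct_smul, E.zero, smul_zero]
  · rw [chordArc_zero, E.chordArc_last]
    have := E.notOpposite_ends he (k := k) (l := k + 1) (by omega) (by omega)
    rcases altSign_eq k with h | h
    · simpa [h] using this
    · rw [h]
      unfold NotOpposite at *
      simpa using this
  · intro i j hij hj s t hs0 hs1 ht0 ht1 h
    rcases E.secant_chordArc he rfl (hij.trans hj) hj hs0 hs1 ht0 ht1 h with h | h | h | h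
    · right
      refine ⟨?_, ?_, ?_, ?_⟩ <;> obtain ⟨h3 | h3, h4 | h4⟩ := h <;>
        first | omega | exact h3.2 | exact h4.2
    · exact absurd h (not_modEq_of_lt (by omega) (by omega))
    · left
      refine ⟨?_, h.2⟩
      by_contra hne
      exact not_modEq_of_lt (by omega) (by omega) h.1.symm
    · exact absurd h.1 (not_modEq_of_lt (by omega) (by omega))

/-- Different chords in the same hemisphere are disjoint arcs. -/
lemma areDisjointArcs (he : IsFrame ξ e) {k l : ℤ} (hkl : altSign k = altSign l)
    (h1 : k + 1 < l) (h2 : l + 1 < k + 2 * r) :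
    AreDisjointArcs ξ e (Y.chordArc c k) (chordLen c k) (Y.chordArc c l) (chordLen c l) := by
  have hlenk := E.chordLen_cast k
  have hlenl := E.chordLen_cast l
  have c1 : c (k + 1) < c l := E.mono h1
  have c2 : c (l + 1) < c k + Y.n := by rw [← E.shift]; exact E.mono h2
  refine ⟨E.two_le_chordLen k, E.two_le_chordLen l, ?_, fun i hi h => E.height_arc hi h,
    fun i hi h => E.height_arc hi h, ?_⟩
  · have key : ∀ k' l', k ≤ k' → k' ≤ k + 1 → l ≤ l' → l' ≤ l + 1 →
        ξ ⬝ᵥ (altSign k • Y.w (c k')) = 0 ∧ ξ ⬝ᵥ (altSign l • Y.w (c l')) = 0 ∧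
        NotOpposite (hor ξ e (altSign k • Y.w (c k'))) (-hor ξ e (altSign l • Y.w (c l'))) := by
      intro k' l' a1 a2 a3 a4
      refine ⟨by rw [dotProduct_smul, E.zero, smul_zero],
        by rw [dotProduct_smul, E.zero, smul_zero], ?_⟩
      have := E.notOpposite_ends he (k := k') (l := l') (by omega) (by omega)
      rw [hkl]
      rcases altSign_eq l with h | h
      · simpa [h] using this
      · rw [h]
        unfold NotOpposite at *
        simpa using this
    rintro i j (rfl | rfl) (rfl | rfl) <;> simp only [chordArc_zero, E.chordArc_last] <;>
      apply key <;> omega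
  · intro i j hi hj s t hs0 hs1 ht0 ht1 h
    rcases E.secant_chordArc he hkl hi hj hs0 hs1 ht0 ht1 h with h | h | h | h
    · exact h
    · exact absurd h (not_modEq_of_lt (by omega) (by omega))
    · exact absurd h.1.symm (not_modEq_of_lt (by omega) (by omega))
    · have := h.1.add_right (Y.n : ℤ)
      have h3 : c k + i + Y.n ≡ c l + j + 1 [ZMOD Y.n] := by
        refine Int.ModEq.trans ?_ h.1
        simp [Int.ModEq]
      exact absurd h3.symm (not_modEq_of_lt (by omega) (by omega))

/-- The angle from the `k`-th crossing to the antipode of the `l`-th one. -/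
noncomputable def _root_.SphPolygon.crossAngle (Y : SphPolygon) (ξ e : V3) (c : ℤ → ℤ)
    (k l : ℤ) : ℝ := turnAngle (hor ξ e (Y.w (c k))) (-hor ξ e (Y.w (c l)))

/-- Disjointness in one hemisphere, stated for the original vertices: the common reflection of both
chords does not change angles. The bounds on l exclude chords with a common end. -/
lemma crossAngle_eq (he : IsFrame ξ e) {k l : ℤ} (hkl : altSign k = altSign l)
    (h1 : k + 1 < l) (h2 : l + 1 < k + 2 * r) :
    Y.crossAngle ξ e c k l - Y.crossAngle ξ e c (k + 1) l =
      Y.crossAngle ξ e c k (l + 1) - Y.crossAngle ξ e c (k + 1) (l + 1) := by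
  have := (E.areDisjointArcs he hkl h1 h2).turn_eq
  simp only [chordArc_zero, E.chordArc_last, hkl, hor_chord_ends l turnAngle_neg_neg] at this
  exact this

/-- The turning of a polygon at its `i`-th edge. -/
noncomputable def _root_.SphPolygon.turn (Y : SphPolygon) (ξ e : V3) (i : ℤ) : ℝ :=
  turnAngle (secant ξ e (Y.w i) (Y.w (i + 1))) (secant ξ e (Y.w (i + 1)) (Y.w (i + 2)))

omit E in
lemma secant_altSign (k : ℤ) (a b : V3) :
    secant ξ e (altSign k • a) (altSign k • b) = secant ξ e a b := by
  rcases altSign_eq k with h | h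
  · simp [h]
  · simp [h, secant_neg_neg]

/-- The inner turning angles are given by `IsChordArc.sum_turn`. The sum on the left has one more
term, the turning at the crossing where the next chord begins, and this is zero. -/
lemma sum_turn_chord (he : IsFrame ξ e) (k : ℤ) :
    ∑ i ∈ Finset.range (chordLen c k), Y.turn ξ e (c k + i) = Y.crossAngle ξ e c k (k + 1) := by
  have hlen := E.chordLen_cast k
  have h2 := E.two_le_chordLen k
  obtain ⟨m, hm⟩ : ∃ m, chordLen c k = m + 1 := ⟨chordLen c k - 1, by omega⟩
  have main := (E.isChordArc he k).sum_turn (fun i _ => by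
    have := E.simple.notOpposite_secant he E.admissible (c k + i)
    simp only [chordArc, secant_altSign k]
    push_cast
    simpa only [add_assoc] using this)
  rw [chordArc_zero, E.chordArc_last, hor_chord_ends k turnAngle_neg_neg] at main
  rw [crossAngle, ← main, hm, Finset.sum_range_succ]
  -- At a crossing both secants are multiples of its projection; admissibility makes them point in
  -- the same direction.
  have hlast : Y.turn ξ e (c k + m) = 0 := by
    have e1 : c k + m + 1 = c (k + 1) := by omega
    unfold turn
    rw [e1, show c k + m + 2 = c (k + 1) + 1 by omega, secant_of_right ξ e (E.zero _),
      secant_of_left ξ e (E.zero _)]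
    have hadm := E.adm (k + 1)
    rw [show c (k + 1) - 1 = c k + m by omega] at hadm
    rcases mul_neg_iff.1 hadm with ⟨h3, h4⟩ | ⟨h3, h4⟩
    · have := turnAngle_smul_self (-hor ξ e (Y.w (c (k + 1)))) h3 (neg_pos.2 h4)
      rw [← this]
      congr 1
      push_cast; ring
    · have := turnAngle_smul_self (hor ξ e (Y.w (c (k + 1)))) (neg_pos.2 h3) h4
      rw [← this]
      congr 1
      push_cast; ring
  rw [hlast, add_zero, Nat.add_sub_cancel]
  refine Finset.sum_congr rfl fun i _ => ?_
  simp only [chordArc, secant_altSign k, turn]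
  push_cast
  simp only [add_assoc]

lemma sum_turn_chords (he : IsFrame ξ e) (l : ℕ) :
    ∑ i ∈ Finset.range (c l - c 0).toNat, Y.turn ξ e (c 0 + i) =
      ∑ k ∈ Finset.range l, Y.crossAngle ξ e c k (k + 1) := by
  rw [E.sum_chords]
  exact Finset.sum_congr rfl fun k _ => E.sum_turn_chord he k

end IsEnumeration

/-! ### The total turning of a closed polygon -/

/-- The total turning of the polar polygon around the axis. -/
noncomputable def totalTurn (Y : SphPolygon) (ξ e : V3) : ℝ :=
  ∑ i ∈ Finset.range Y.n, Y.turn ξ e i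

lemma turn_periodic (Y : SphPolygon) (ξ e : V3) : Function.Periodic (Y.turn ξ e) (Y.n : ℤ) := by
  intro i
  have h : ∀ j : ℤ, Y.w (i + Y.n + j) = Y.w (i + j) := fun j => by
    rw [show i + Y.n + j = i + j + Y.n by ring, Y.periodic]
  simp only [turn, h, Y.periodic]

lemma _root_.Function.Periodic.sum_range_add {M : Type*} [AddCommGroup M] {g : ℤ → M} {n : ℕ}
    (hg : Function.Periodic g (n : ℤ)) (k : ℤ) :
    ∑ i ∈ Finset.range n, g (k + i) = ∑ i ∈ Finset.range n, g i := by
  have step : ∀ k : ℤ, ∑ i ∈ Finset.range n, g (k + 1 + i) = ∑ i ∈ Finset.range n, g (k + i) := by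
    intro k
    have h := Finset.sum_range_sub (fun i : ℕ => g (k + i)) n
    rw [Finset.sum_sub_distrib] at h
    simp only [Nat.cast_zero, add_zero, hg k, sub_self] at h
    rw [← sub_eq_zero, ← h]
    congr 1
    refine Finset.sum_congr rfl fun i _ => ?_
    congr 1
    push_cast; ring
  induction k using Int.induction_on with
  | zero => simp
  | succ i ih => rw [step, ih]
  | pred i ih => rw [← ih, ← step]; simp

lemma IsEnumeration.totalTurn_eq {Y : SphPolygon} {ξ e : V3} {r : ℕ} {c : ℤ → ℤ}
    (E : Y.IsEnumeration ξ r c) (he : IsFrame ξ e) :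
    Y.totalTurn ξ e = ∑ k ∈ Finset.range (2 * r), Y.crossAngle ξ e c k (k + 1) := by
  rw [← E.sum_turn_chords he, totalTurn, ← (Y.turn_periodic ξ e).sum_range_add (c 0)]
  have := E.shift 0
  congr 2
  push_cast
  rw [← zero_add (2 * (r : ℤ)), this]
  omega

end SphPolygon

/-! ### Angles of the crossings -/

/-- Passing to the antipode shifts the angle by π, and the sign is the one that brings b - a ± π
into (-π, π). -/
lemma turnAngle_exp_neg {z : ℂ} (hz : z ≠ 0) {a b : ℝ} (hab : a ≠ b) (h1 : b - a < 2 * Real.pi)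
    (h2 : a - b < 2 * Real.pi) :
    turnAngle (Complex.exp (a * Complex.I) * z) (-(Complex.exp (b * Complex.I) * z)) =
      b - a - Real.pi * (SignType.sign (b - a) : ℝ) := by
  have hN := Complex.normSq_pos.2 hz
  have hpi := Real.pi_pos
  have key : ∀ c : ℝ, -Real.pi < c → c ≤ Real.pi →
      Complex.exp (c * Complex.I) = -Complex.exp ((b - a : ℝ) * Complex.I) →
      turnAngle (Complex.exp (a * Complex.I) * z) (-(Complex.exp (b * Complex.I) * z)) = c := by
    intro c hc1 hc2 hc
    unfold turnAngle
    have : starRingEnd ℂ (Complex.exp (a * Complex.I) * z) * -(Complex.exp (b * Complex.I) * z) =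
        (Complex.normSq z : ℂ) * Complex.exp (c * Complex.I) := by
      rw [hc, map_mul, ← Complex.exp_conj, Complex.normSq_eq_conj_mul_self]
      push_cast
      rw [sub_mul, sub_eq_neg_add, Complex.exp_add]
      simp only [map_mul, Complex.conj_ofReal, Complex.conj_I]
      rw [mul_neg]
      ring_nf
    rw [this, Complex.arg_real_mul _ hN, Complex.arg_exp_mul_I]
    exact (toIocMod_eq_self _).2 ⟨hc1, by linarith⟩
  rcases lt_or_gt_of_ne hab with h | h
  · rw [sign_pos (sub_pos.2 h)]
    simp only [SignType.coe_one, mul_one]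
    apply key
    · linarith
    · linarith
    · push_cast
      rw [sub_mul _ (Real.pi : ℂ), Complex.exp_sub, Complex.exp_pi_mul_I]
      rw [div_neg, div_one]
  · rw [sign_neg (sub_neg.2 h)]
    simp only [SignType.coe_neg_one, mul_neg, mul_one, sub_neg_eq_add]
    apply key
    · linarith
    · linarith
    · push_cast
      rw [add_mul _ (Real.pi : ℂ), Complex.exp_add, Complex.exp_pi_mul_I]
      simp

lemma exists_angle {z : ℂ} (hz : Complex.normSq z = 1) :
    ∃ a : ℝ, 0 ≤ a ∧ a < 2 * Real.pi ∧ Complex.exp (a * Complex.I) = z := by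
  have hn : ‖z‖ = 1 := by
    have := Complex.normSq_eq_norm_sq z
    rw [hz] at this
    nlinarith [norm_nonneg z]
  have h := Complex.norm_mul_exp_arg_mul_I z
  rw [hn, Complex.ofReal_one, one_mul] at h
  have h1 := Complex.neg_pi_lt_arg z
  have h2 := Complex.arg_le_pi z
  have hpi := Real.pi_pos
  by_cases h0 : 0 ≤ Complex.arg z
  · exact ⟨_, h0, by linarith, h⟩
  · refine ⟨Complex.arg z + 2 * Real.pi, by linarith, by linarith, ?_⟩
    push_cast
    rw [add_mul, Complex.exp_add, h, Complex.exp_two_pi_mul_I, mul_one]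

lemma angle_unique {a b : ℝ} (ha0 : 0 ≤ a) (ha1 : a < 2 * Real.pi) (hb0 : 0 ≤ b)
    (hb1 : b < 2 * Real.pi) (h : Complex.exp (a * Complex.I) = Complex.exp (b * Complex.I)) :
    a = b := by
  obtain ⟨n, hn⟩ := Complex.exp_eq_exp_iff_exists_int.1 h
  have h1 : (a : ℂ) = b + n * (2 * Real.pi) := by
    apply mul_right_cancel₀ Complex.I_ne_zero
    rw [hn]; ring
  have h2 : a = b + n * (2 * Real.pi) := by exact_mod_cast h1
  have hpi := Real.two_pi_pos
  have h3 : n < 1 := by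
    by_contra hc
    have : (1 : ℝ) ≤ n := by exact_mod_cast not_lt.1 hc
    nlinarith
  have h4 : -1 < n := by
    by_contra hc
    have : (n : ℝ) ≤ -1 := by exact_mod_cast not_lt.1 hc
    nlinarith
  have : n = 0 := by omega
  simpa [this] using h2

/-! ### Alternating sums for pairs of non-crossing families -/

lemma sum_Ico_sub_of_le (u : ℕ → ℝ) {a b : ℕ} (h : a ≤ b) :
    ∑ l ∈ Finset.Ico a b, (u (l + 1) - u l) = u b - u a := by
  induction b, h using Nat.le_induction with
  | base => simp
  | succ b hb ih => rw [Finset.sum_Ico_succ_top hb, ih]; ring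

/-- A discrete version of the theorem of turning tangents. -/
lemma sum_alternating (s : ℕ → ℕ → ℝ) (ε : ℕ → ℝ) (m : ℕ) (anti : ∀ k l, s k l = -s l k)
    (first : ∀ k, 0 < k → k < m + 2 → s k 0 = 1) (last : ∀ k, s (m + 2) k = s 0 k)
    (h : ∀ k l, k < l → l < m + 2 →
      (ε k + ε l) * (s (l + 1) k - s l k - s (l + 1) (k + 1) + s l (k + 1)) = 0) :
    ∑ k ∈ Finset.range (m + 2), ε k * s (k + 1) k = ε 0 - ε (m + 1) := by
  have diag : ∀ k, s k k = 0 := fun k => by linarith [anti k k]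
  set B : ℕ → ℕ → ℝ := fun k l => s (l + 1) k - s l k - s (l + 1) (k + 1) + s l (k + 1) with hB
  -- B is a mixed second difference. In the sum over k < l the part with ε k telescopes in l, and
  -- the part with ε l telescopes in k once the order of summation is exchanged; both leave the same
  -- boundary terms.
  have h1 : ∑ k ∈ Finset.Ico 0 (m + 2), ∑ l ∈ Finset.Ico (k + 1) (m + 2), (ε k + ε l) * B k l
      = 0 :=
    Finset.sum_eq_zero fun k _ => Finset.sum_eq_zero fun l hl => by
      rw [Finset.mem_Ico] at hl
      exact h k l (by omega) hl.2
  simp only [add_mul, Finset.sum_add_distrib] at h1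
  rw [Finset.sum_Ico_Ico_comm' 0 (m + 2) fun k l => ε l * B k l] at h1
  have h2 : ∀ k ∈ Finset.Ico 0 (m + 2), ∑ l ∈ Finset.Ico (k + 1) (m + 2), ε k * B k l =
      ε k * (s 0 k - s 0 (k + 1)) - ε k * s (k + 1) k := by
    intro k hk
    rw [Finset.mem_Ico] at hk
    rw [← Finset.mul_sum]
    have := sum_Ico_sub_of_le (fun l => s l k - s l (k + 1)) (a := k + 1) (b := m + 2) (by omega)
    rw [last, last, diag] at this
    rw [← mul_sub, sub_zero] at *
    rw [← this]
    congr 1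
    exact Finset.sum_congr rfl fun l _ => by simp only [hB]; ring
  have h3 : ∀ l ∈ Finset.Ico 0 (m + 2), ∑ k ∈ Finset.Ico 0 l, ε l * B k l =
      ε l * (s 0 l - s 0 (l + 1)) - ε l * s (l + 1) l := by
    intro l hl
    rw [← Finset.mul_sum]
    have := sum_Ico_sub_of_le (fun k => s l k - s (l + 1) k) (a := 0) (b := l) (by omega)
    rw [diag, anti l 0, anti (l + 1) 0] at this
    rw [← mul_sub]
    have e : s 0 l - s 0 (l + 1) - s (l + 1) l =
        0 - s (l + 1) l - (-s 0 l - -s 0 (l + 1)) := by ring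
    rw [e, ← this]
    congr 1
    exact Finset.sum_congr rfl fun l _ => by simp only [hB]; ring
  rw [Finset.sum_congr rfl h2, Finset.sum_congr rfl h3] at h1
  simp only [Finset.sum_sub_distrib, Nat.Ico_zero_eq_range] at h1
  -- As k goes from 0 to m + 2, s 0 k is 0, then constantly -1, then 0 again, so only the first and
  -- the last difference count.
  have h4 : ∑ k ∈ Finset.range (m + 2), ε k * (s 0 k - s 0 (k + 1)) = ε 0 - ε (m + 1) := by
    rw [Finset.sum_range_succ, Finset.sum_range_succ', Finset.sum_eq_zero]
    · have a1 := first (m + 1) (by omega) (by omega)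
      have a2 := first (0 + 1) (by omega) (by omega)
      rw [anti 0 (m + 1), anti 0 (0 + 1), a1, a2, anti 0 (m + 1 + 1), last, diag]
      ring
    · intro k hk
      rw [Finset.mem_range] at hk
      rw [anti 0, anti 0 (k + 1 + 1), first (k + 1) (by omega) (by omega),
        first (k + 1 + 1) (by omega) (by omega)]
      ring
  linarith

lemma sum_range_two_mul (g : ℕ → ℝ) (r : ℕ) :
    ∑ k ∈ Finset.range (2 * r), g k = ∑ i ∈ Finset.range r, (g (2 * i) + g (2 * i + 1)) := by
  induction r with
  | zero => simp
  | succ r ih =>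
    rw [show 2 * (r + 1) = 2 * r + 1 + 1 by ring, Finset.sum_range_succ, Finset.sum_range_succ,
      Finset.sum_range_succ, ih]
    ring

/-! ### Position angles of the crossings and the total turning -/

namespace SphPolygon.IsEnumeration
variable {Y : SphPolygon} {ξ e : V3} {r : ℕ} {c : ℤ → ℤ}

/-- `φ k` is the angle of the `k`-th crossing, measured from the `0`-th one. -/
structure IsAngle (Y : SphPolygon) (ξ e : V3) (c : ℤ → ℤ) (φ : ℤ → ℝ) : Prop where
  nonneg : ∀ k, 0 ≤ φ k
  lt : ∀ k, φ k < 2 * Real.pi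
  exp : ∀ k, hor ξ e (Y.w (c k)) = Complex.exp (φ k * Complex.I) * hor ξ e (Y.w (c 0))

variable (E : Y.IsEnumeration ξ r c)
include E

lemma normSq_hor (he : IsFrame ξ e) (k : ℤ) : Complex.normSq (hor ξ e (Y.w (c k))) = 1 := by
  have := he.normSq_hor (Y.w (c k))
  rw [E.zero, Y.unit] at this
  linarith

lemma hor_ne_zero (he : IsFrame ξ e) (k : ℤ) : hor ξ e (Y.w (c k)) ≠ 0 :=
  he.hor_ne_zero (Y.w_ne_zero _) (E.zero k)

lemma exists_isAngle (he : IsFrame ξ e) : ∃ φ, IsAngle Y ξ e c φ := by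
  have h : ∀ k, ∃ a : ℝ, 0 ≤ a ∧ a < 2 * Real.pi ∧ Complex.exp (a * Complex.I) =
      hor ξ e (Y.w (c k)) / hor ξ e (Y.w (c 0)) := fun k => by
    apply exists_angle
    rw [Complex.normSq_div, E.normSq_hor he, E.normSq_hor he, div_one]
  choose φ h1 h2 h3 using h
  refine ⟨φ, h1, h2, fun k => ?_⟩
  rw [h3, div_mul_cancel₀ _ (E.hor_ne_zero he 0)]

section Angle
variable {φ : ℤ → ℝ} (A : IsAngle Y ξ e c φ) (he : IsFrame ξ e)
include A he

lemma angle_eq_of_eq {k l : ℤ} (h : Y.w (c k) = Y.w (c l)) : φ k = φ l := by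
  apply angle_unique (A.nonneg k) (A.lt k) (A.nonneg l) (A.lt l)
  apply mul_right_cancel₀ (E.hor_ne_zero he 0)
  rw [← A.exp, ← A.exp, h]

lemma angle_zero : φ 0 = 0 := by
  apply angle_unique (A.nonneg 0) (A.lt 0) le_rfl Real.two_pi_pos
  apply mul_right_cancel₀ (E.hor_ne_zero he 0)
  rw [← A.exp]
  simp

lemma angle_ne {k l : ℤ} (h1 : k < l) (h2 : l < k + 2 * r) : φ k ≠ φ l := by
  intro h
  apply E.vertex_ne h1 h2
  apply he.ext
  · rw [A.exp k, A.exp l, h]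
  · rw [E.zero, E.zero]

lemma angle_shift (k : ℤ) : φ (k + 2 * r) = φ k := by
  apply E.angle_eq_of_eq A he
  rw [E.shift, Y.periodic]

lemma angle_shift_mul (k m : ℤ) : φ (k + 2 * r * m) = φ k := by
  have h : Function.Periodic φ (2 * (r : ℤ)) := E.angle_shift A he
  have := h.int_mul m k
  rw [mul_comm]; exact_mod_cast this

lemma crossAngle_eq_angle {k l : ℤ} (h : φ k ≠ φ l) :
    Y.crossAngle ξ e c k l = φ l - φ k - Real.pi * (SignType.sign (φ l - φ k) : ℝ) := by
  unfold crossAngle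
  rw [A.exp k, A.exp l]
  exact turnAngle_exp_neg (E.hor_ne_zero he 0) h
    (by linarith [A.lt l, A.nonneg k]) (by linarith [A.lt k, A.nonneg l])

/-- The angles themselves cancel in the mixed difference of `crossAngle_eq`; what remains is π times
a relation between signs, which says that the two pairs of ends do not separate each other. -/
lemma sign_relation {k l : ℤ} (hkl : altSign k = altSign l) (h1 : k + 1 < l)
    (h2 : l + 1 < k + 2 * r) :
    (SignType.sign (φ (l + 1) - φ k) : ℝ) - SignType.sign (φ l - φ k) -
      SignType.sign (φ (l + 1) - φ (k + 1)) + SignType.sign (φ l - φ (k + 1)) = 0 := by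
  have h := E.crossAngle_eq he hkl h1 h2
  rw [E.crossAngle_eq_angle A he (E.angle_ne A he (by omega) (by omega)),
    E.crossAngle_eq_angle A he (E.angle_ne A he (by omega) (by omega)),
    E.crossAngle_eq_angle A he (E.angle_ne A he (by omega) (by omega)),
    E.crossAngle_eq_angle A he (E.angle_ne A he (by omega) (by omega))] at h
  apply mul_left_cancel₀ Real.pi_ne_zero
  linarith

/-- The total turning counts the upper chords with signs. -/
lemma totalTurn_eq_sum :
    Y.totalTurn ξ e = 2 * Real.pi *
      (1 - ∑ i ∈ Finset.range r, (SignType.sign (φ (2 * i + 1) - φ (2 * i)) : ℝ)) := by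
  obtain ⟨m, hm⟩ : ∃ m, 2 * r = m + 2 := ⟨2 * r - 2, by have := E.r_pos; omega⟩
  have hm' : (2 * r : ℤ) = m + 2 := by exact_mod_cast hm
  have h0 := E.angle_zero A he
  have hN : φ (m + 2 : ℕ) = 0 := by
    rw [← h0, ← E.angle_shift A he 0]
    congr 1
    push_cast
    omega
  have comb := sum_alternating
    (fun k l : ℕ => (SignType.sign (φ k - φ l) : ℝ)) (fun k => altSign k) m ?_ ?_ ?_ ?_
  · rw [E.totalTurn_eq he]
    -- The differences of the angles telescope to 0 around the polygon, so only the terms with signs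
    -- survive.
    have e1 : ∑ k ∈ Finset.range (2 * r), Y.crossAngle ξ e c k (k + 1) =
        -(Real.pi * ∑ k ∈ Finset.range (2 * r),
          (SignType.sign (φ ((k + 1 : ℕ) : ℤ) - φ (k : ℤ)) : ℝ)) := by
      have tele := Finset.sum_range_sub (fun k : ℕ => φ k) (2 * r)
      rw [hm, hN, Nat.cast_zero, h0, sub_zero] at tele
      rw [← sub_zero (∑ k ∈ Finset.range (2 * r), Y.crossAngle ξ e c k (k + 1)), ← tele, hm,
        Finset.mul_sum, ← Finset.sum_sub_distrib, ← Finset.sum_neg_distrib]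
      refine Finset.sum_congr rfl fun k _ => ?_
      have := E.crossAngle_eq_angle A he (E.angle_ne A he (k := k) (l := k + 1) (by omega)
        (by omega))
      rw [this]
      push_cast
      ring
    rw [← hm, sum_range_two_mul] at comb
    rw [e1, sum_range_two_mul]
    have ev : ∀ i : ℕ, altSign ((2 * i : ℕ) : ℤ) = 1 := fun i => by simp [altSign]
    have od : ∀ i : ℕ, altSign ((2 * i + 1 : ℕ) : ℤ) = -1 := fun i => by
      rw [Nat.cast_succ, altSign_succ, ev]
    have em : altSign ((m + 1 : ℕ) : ℤ) = -1 := by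
      rw [show m + 1 = 2 * (r - 1) + 1 by omega]
      exact od _
    simp only [ev, od, em, Finset.sum_add_distrib, one_mul, neg_mul] at comb ⊢
    rw [Finset.sum_neg_distrib, show altSign ((0 : ℕ) : ℤ) = 1 by simp [altSign]] at comb
    push_cast at comb ⊢
    set U := ∑ x ∈ Finset.range r, (SignType.sign (φ (2 * x + 1) - φ (2 * x)) : ℝ)
    linear_combination Real.pi * comb
  · intro k l
    rw [← neg_sub, Left.sign_neg]
    simp
  · intro k hk0 hk
    have h1 := E.angle_ne A he (k := 0) (l := k) (by omega) (by omega)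
    rw [h0] at h1
    have h2 := lt_of_le_of_ne (A.nonneg k) h1
    rw [Nat.cast_zero, h0, sub_zero, sign_pos h2]
    rfl
  · intro k
    rw [hN, Nat.cast_zero, h0]
  · intro k l hkl hl
    rcases altSign_eq k with hk | hk <;> rcases altSign_eq l with hl' | hl'
    all_goals first
      | (rw [hk, hl']; norm_num; done)
      | skip
    -- For chords in opposite hemispheres the weight is zero. Chords with numbers of the same parity
    -- are not neighbours, not even across the end of the period, so `sign_relation` applies.
    all_goals
      have hs : altSign k = altSign l := hk.trans hl'.symm
      have h1 : (k : ℤ) + 1 ≠ l := by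
        intro h
        rw [← h, altSign_succ, hk] at hs
        norm_num at hs
      have h2 : (l : ℤ) + 1 ≠ k + 2 * r := by
        intro h
        have : altSign (l + 1) = altSign k := by
          rw [h]; unfold altSign; simp [Int.even_add]
        rw [altSign_succ, ← hs, hk] at this
        norm_num at this
      have := E.sign_relation A he hs (by omega) (by omega)
      push_cast
      rw [this, mul_zero]

end Angle

end SphPolygon.IsEnumeration

/-- The summand 1 is the contribution of the distinguished chord, which both counts leave out. -/
lemma sum_sign_eq_numPos_sub_numNeg {r : ℕ} (σ : Equiv.Perm (Fin (2 * r))) (g : ℕ → ℝ)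
    (hr : 0 < r) (h0 : g 0 = 1) (hpos : ∀ i : Fin r, σ.symm (chordFst i) < σ.symm (chordSnd i) →
      g i = 1) (hneg : ∀ i : Fin r, σ.symm (chordSnd i) < σ.symm (chordFst i) → g i = -1) :
    ∑ i ∈ Finset.range r, g i = 1 + numPos σ - numNeg σ := by
  rw [← Fin.sum_univ_eq_sum_range]
  unfold numPos numNeg
  rw [Finset.card_filter, Finset.card_filter]
  push_cast
  have h1 : (1 : ℝ) = ∑ i : Fin r, if i = ⟨0, hr⟩ then (1 : ℝ) else 0 := by simp
  rw [h1, ← Finset.sum_add_distrib, ← Finset.sum_sub_distrib]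
  refine Finset.sum_congr rfl fun i _ => ?_
  rcases lt_trichotomy (σ.symm (chordFst i)) (σ.symm (chordSnd i)) with h | h | h
  · have h' := hpos i h
    by_cases hi : i = ⟨0, hr⟩
    · subst hi; simp [h0]
    · have : (i : ℕ) ≠ 0 := fun h => hi (Fin.ext h)
      simp [h', hi, this, h, h.asymm]
  · have := σ.symm.injective h
    simp [chordFst, chordSnd] at this
  · have h' := hneg i h
    by_cases hi : i = ⟨0, hr⟩
    · subst hi; simp [h0]
    · have : (i : ℕ) ≠ 0 := fun h => hi (Fin.ext h)
      simp [h', hi, this, h, h.asymm]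

namespace SphPolygon

/-- The angles read off along the great circle are the position angles of the crossings, and they
increase with the position. So the sign attached to an upper chord compares the positions of its two
ends. -/
lemma ReadsOff.totalTurn_eq {Y : SphPolygon} {ξ e : V3} {r : ℕ} {σ : Equiv.Perm (Fin (2 * r))}
    (hY : Y.ReadsOff ξ r σ) (hs : Y.IsSimple) (ha : Y.IsAdmissible ξ) (hr : 0 < r)
    (he : IsFrame ξ e) :
    Y.totalTurn ξ e = 2 * Real.pi * (-(numPos σ : ℝ) + numNeg σ) := by
  obtain ⟨hsub, c, θ, hmono, hshift, hzero, hup, hθ, hθ2, hσ, -⟩ := hY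
  have E : Y.IsEnumeration ξ r c := ⟨⟨ha, hsub, hmono, hzero⟩, hs, hr, hshift, hup⟩
  obtain ⟨φ, A⟩ := E.exists_isAngle he
  have hφ : ∀ k : Fin (2 * r), φ ((σ k : ℕ) : ℤ) = θ k := by
    intro k
    apply angle_unique (A.nonneg _) (A.lt _) (hθ2 k).1 (hθ2 k).2
    apply mul_right_cancel₀ (E.hor_ne_zero he 0)
    rw [← A.exp, hσ k, hor_add, hor_smul, hor_smul, he.hor_cross_axis, Complex.exp_mul_I]
    push_cast
    ring
  have hφ' : ∀ l : Fin (2 * r), φ ((l : ℕ) : ℤ) = θ (σ.symm l) := fun l => by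
    rw [← hφ, Equiv.apply_symm_apply]
  have h0 := E.angle_zero A he
  have e1 : ∀ i : Fin r, φ (2 * ((i : ℕ) : ℤ)) = θ (σ.symm (chordFst i)) := fun i => by
    rw [← hφ']; simp [chordFst]
  have e2 : ∀ i : Fin r, φ (2 * ((i : ℕ) : ℤ) + 1) = θ (σ.symm (chordSnd i)) := fun i => by
    rw [← hφ']; simp [chordSnd]
  rw [E.totalTurn_eq_sum A he, sum_sign_eq_numPos_sub_numNeg σ
    (fun i : ℕ => (SignType.sign (φ (2 * i + 1) - φ (2 * i)) : ℝ)) hr]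
  · ring
  · have h1 := E.angle_ne A he (k := 0) (l := 1) (by omega) (by omega)
    rw [h0] at h1
    have h2 := lt_of_le_of_ne (A.nonneg 1) h1
    simp [h0, sign_pos h2]
  · intro i h
    rw [e1, e2, sign_pos (sub_pos.2 (hθ h))]
    rfl
  · intro i h
    rw [e1, e2, sign_neg (sub_neg.2 (hθ h))]
    rfl

end SphPolygon

/-! ### The normal degree as a rotation number -/

/-- The angle between two vectors in terms of their arguments and the crossing of the cut. -/
lemma turnAngle_eq_arg_sub {x y : ℂ} (hx : x ∈ Complex.slitPlane) (hy : y ∈ Complex.slitPlane)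
    (hno : NotOpposite x y) :
    ∃ k : ℤ, turnAngle x y = Complex.arg y - Complex.arg x + 2 * Real.pi * k ∧
      ((∃ s t b : ℝ, 0 ≤ s ∧ 0 ≤ t ∧ 0 < s + t ∧ 0 ≤ b ∧ (s : ℂ) * x + t * y = -(b : ℂ)) →
        k = SignType.sign (starRingEnd ℂ x * y).im) ∧
      ((¬∃ s t b : ℝ, 0 ≤ s ∧ 0 ≤ t ∧ 0 < s + t ∧ 0 ≤ b ∧ (s : ℂ) * x + t * y = -(b : ℂ)) →
        k = 0) := by
  have hx0 := hno.left_ne_zero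
  have hy0 := hno.right_ne_zero
  have hpi := Real.pi_pos
  have argpos : ∀ z : ℂ, z ∈ Complex.slitPlane → (0 < Complex.arg z ↔ 0 < z.im) := by
    intro z hz
    obtain ⟨h1, h2⟩ := Complex.mem_slitPlane_iff_arg.1 hz
    constructor
    · intro h
      refine lt_of_le_of_ne (Complex.arg_nonneg_iff.1 h.le) fun h3 => ?_
      rw [Complex.mem_slitPlane_iff] at hz
      have h4 : 0 < z.re := hz.resolve_right (not_not.2 h3.symm)
      exact h.ne' (Complex.arg_eq_zero_iff.2 ⟨h4.le, h3.symm⟩)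
    · intro h
      refine lt_of_le_of_ne (Complex.arg_nonneg_iff.2 h.le) fun h3 => ?_
      exact h.ne' (Complex.arg_eq_zero_iff.1 h3.symm).2
  have bound : ∀ z : ℂ, z ∈ Complex.slitPlane → -Real.pi < Complex.arg z ∧ Complex.arg z < Real.pi :=
    fun z hz => ⟨Complex.neg_pi_lt_arg z,
      lt_of_le_of_ne (Complex.arg_le_pi z) (Complex.mem_slitPlane_iff_arg.1 hz).1⟩
  obtain ⟨bx1, bx2⟩ := bound x hx
  obtain ⟨by1, by2⟩ := bound y hy
  obtain ⟨bt1, bt2⟩ := bound _ hno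
  have hI : (starRingEnd ℂ x * y).im = x.re * y.im - x.im * y.re := by
    simp; ring
  have hpos := argpos _ hno
  have hneg : Complex.arg (starRingEnd ℂ x * y) < 0 ↔ (starRingEnd ℂ x * y).im < 0 :=
    Complex.arg_neg_iff
  have hcoe := turnAngle_coe hx0 hy0
  rw [← Real.Angle.coe_sub, Real.Angle.angle_eq_iff_two_pi_dvd_sub] at hcoe
  obtain ⟨k, hk⟩ := hcoe
  change -Real.pi < turnAngle x y at bt1
  change turnAngle x y < Real.pi at bt2
  change 0 < turnAngle x y ↔ _ at hpos
  change turnAngle x y < 0 ↔ _ at hneg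
  have k1 : k < 2 := by
    by_contra hc
    have : (2 : ℝ) ≤ k := by exact_mod_cast not_lt.1 hc
    nlinarith
  have k2 : -2 < k := by
    by_contra hc
    have : (k : ℝ) ≤ -2 := by exact_mod_cast not_lt.1 hc
    nlinarith
  refine ⟨k, by linarith, ?_, ?_⟩
  · rintro ⟨s, t, b, hs, ht, hst, hb, h⟩
    have h1 := congrArg Complex.re h
    have h2 := congrArg Complex.im h
    simp at h1 h2
    have hs' : 0 < s := by
      refine lt_of_le_of_ne hs fun h0 => ?_
      subst h0
      have ht' : 0 < t := by linarith
      have e1 : y.im = 0 := by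
        have : t * y.im = 0 := by linarith
        exact (mul_eq_zero.1 this).resolve_left ht'.ne'
      rw [Complex.mem_slitPlane_iff] at hy
      have := mul_pos ht' (hy.resolve_right (not_not.2 e1))
      linarith
    have ht' : 0 < t := by
      refine lt_of_le_of_ne ht fun h0 => ?_
      subst h0
      have e1 : x.im = 0 := by
        have : s * x.im = 0 := by linarith
        exact (mul_eq_zero.1 this).resolve_left hs'.ne'
      rw [Complex.mem_slitPlane_iff] at hx
      have := mul_pos hs' (hx.resolve_right (not_not.2 e1))
      linarith
    -- Cross products of s x + t y = -b with y and x. They determine on which sides of the real axis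
    -- x and y lie, hence the sign of the jump of the argument.
    have e1 : s * (starRingEnd ℂ x * y).im = -(b * y.im) := by
      rw [hI]; linear_combination y.im * h1 - y.re * h2
    have e2 : t * (starRingEnd ℂ x * y).im = b * x.im := by
      rw [hI]; linear_combination -x.im * h1 + x.re * h2
    rcases lt_trichotomy (starRingEnd ℂ x * y).im 0 with hi | hi | hi
    · have t1 := hneg.2 hi
      have p1 := mul_neg_of_pos_of_neg hs' hi
      have p2 := mul_neg_of_pos_of_neg ht' hi
      have y1 : 0 < y.im := by by_contra hc; nlinarith
      have x1 : x.im < 0 := by by_contra hc; nlinarith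
      have := (argpos y hy).2 y1
      have := Complex.arg_neg_iff.2 x1
      rw [sign_neg hi]
      have k3 : k < 0 := by
        by_contra hc
        have : (0 : ℝ) ≤ k := by exact_mod_cast not_lt.1 hc
        nlinarith
      simp
      omega
    · have t0 : turnAngle x y = 0 := by
        apply le_antisymm
        · by_contra hc; exact (hpos.1 (not_le.1 hc)).ne' hi
        · by_contra hc; exact (hneg.1 (not_le.1 hc)).ne hi
      have hb0 : b ≠ 0 := by
        intro hb0
        have := hno.cone_ne_zero hs ht hst
        rw [h, hb0] at this
        simp at this
      rw [hi, mul_zero] at e1 e2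
      have y1 : y.im = 0 := by
        have : b * y.im = 0 := by linarith
        exact (mul_eq_zero.1 this).resolve_left hb0
      have x1 : x.im = 0 := (mul_eq_zero.1 e2.symm).resolve_left hb0
      rw [Complex.mem_slitPlane_iff] at hx hy
      have := mul_pos ht' (hy.resolve_right (not_not.2 y1))
      have := mul_pos hs' (hx.resolve_right (not_not.2 x1))
      linarith
    · have t1 := hpos.2 hi
      have p1 := mul_pos hs' hi
      have p2 := mul_pos ht' hi
      have y1 : y.im < 0 := by by_contra hc; nlinarith
      have x1 : 0 < x.im := by by_contra hc; nlinarith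
      have := (argpos x hx).2 x1
      have := Complex.arg_neg_iff.2 y1
      rw [sign_pos hi]
      have k3 : 0 < k := by
        by_contra hc
        have : (k : ℝ) ≤ 0 := by exact_mod_cast not_lt.1 hc
        nlinarith
      simp
      omega
  · intro hno'
    by_contra hk0
    apply hno'
    -- A jump of the argument forces imaginary parts of opposite signs. Then the combination of x
    -- and y whose imaginary part cancels has positive weights, and its real part is ± Im(conj x ·
    -- y), on the negative side.
    have hk' : k = -1 ∨ k = 1 := by omega
    rcases hk' with rfl | rfl
    · push_cast at hk
      have y1 := (argpos y hy).1 (by linarith)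
      have x1 := Complex.arg_neg_iff.1 (show Complex.arg x < 0 by linarith)
      have i1 := hneg.1 (by linarith)
      refine ⟨y.im, -x.im, -(starRingEnd ℂ x * y).im, y1.le, by linarith, by linarith,
        by linarith, ?_⟩
      rw [hI]
      apply Complex.ext <;> simp <;> ring
    · push_cast at hk
      have x1 := (argpos x hx).1 (by linarith)
      have y1 := Complex.arg_neg_iff.1 (show Complex.arg y < 0 by linarith)
      have i1 := hpos.1 (by linarith)
      refine ⟨-y.im, x.im, (starRingEnd ℂ x * y).im, by linarith, x1.le, by linarith,
        by linarith, ?_⟩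
      rw [hI]
      apply Complex.ext <;> simp <;> ring

lemma conj_mul_mul_of_normSq {z : ℂ} (hz : Complex.normSq z = 1) (x y : ℂ) :
    starRingEnd ℂ (z * x) * (z * y) = starRingEnd ℂ x * y := by
  have h : starRingEnd ℂ z * z = 1 := by
    rw [← Complex.normSq_eq_conj_mul_self, hz, Complex.ofReal_one]
  rw [map_mul]
  linear_combination (starRingEnd ℂ x * y) * h

lemma unitize_dotProduct {v : V3} (h : v ≠ 0) : unitize v ⬝ᵥ unitize v = 1 := by
  have hpos : 0 < v ⬝ᵥ v := by
    refine lt_of_le_of_ne (Finset.sum_nonneg fun i _ => mul_self_nonneg (v i)) fun h' => ?_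
    exact h (dotProduct_self_eq_zero.1 h'.symm)
  have hsq := Real.sqrt_pos.2 hpos
  have h2 := Real.mul_self_sqrt hpos.le
  simp only [unitize, smul_dotProduct, dotProduct_smul, smul_eq_mul]
  field_simp
  nlinarith

namespace SphPolygon
variable {W : SphPolygon} {ξ e : V3}

lemma hor_axis (he : IsFrame ξ e) : hor ξ e ξ = 0 := by
  have h := he.normSq_hor ξ
  rw [he.axis] at h
  exact Complex.normSq_eq_zero.1 (by linarith)

lemma mem_meridian_of_hor (he : IsFrame ξ e) {u p : V3} (hu : ξ ⬝ᵥ u = 0) (hp : p ⬝ᵥ p = 1) {b : ℝ}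
    (hb : 0 ≤ b) (h : hor ξ e p = b * hor ξ e u) : p ∈ meridian ξ u := by
  refine ⟨hp, ξ ⬝ᵥ p, b, hb, ?_⟩
  apply he.ext
  · rw [hor_add, hor_smul, hor_smul, hor_axis he, h]; ring
  · rw [dotProduct_add, dotProduct_smul, dotProduct_smul, hu, he.axis]; simp

section
variable (hW : W.IsSimple) (hadm : W.IsAdmissible ξ) (he : IsFrame ξ e)
include hW hadm he

lemma IsSimple.cross_ne_zero (i : ℤ) : W.w i ⨯₃ W.w (i + 1) ≠ 0 := by
  intro h
  have := (hW.notOpposite_secant he hadm i).left_ne_zero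
  have h2 := he.hor_cross (W.w i) (W.w (i + 1))
  rw [h] at h2
  have h3 : hor ξ e (0 : V3) = 0 := by apply Complex.ext <;> simp [hor]
  rw [h3] at h2
  simp at h2
  exact this h2

lemma IsSimple.polar_unit (i : ℤ) : W.polar i ⬝ᵥ W.polar i = 1 :=
  unitize_dotProduct (hW.cross_ne_zero hadm he i)

lemma IsSimple.hor_polar (i : ℤ) : ∃ ρ : ℝ, 0 < ρ ∧
    hor ξ e (W.polar i) = ρ * (-Complex.I * secant ξ e (W.w i) (W.w (i + 1))) := by
  have h0 := hW.cross_ne_zero hadm he i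
  have hpos : 0 < (W.w i ⨯₃ W.w (i + 1)) ⬝ᵥ (W.w i ⨯₃ W.w (i + 1)) := by
    refine lt_of_le_of_ne (Finset.sum_nonneg fun j _ => mul_self_nonneg _) fun h' => ?_
    exact h0 (dotProduct_self_eq_zero.1 h'.symm)
  refine ⟨_, inv_pos.2 (Real.sqrt_pos.2 hpos), ?_⟩
  rw [← he.hor_cross, ← hor_smul]
  rfl

lemma IsSimple.notOpposite_polar (i : ℤ) :
    NotOpposite (hor ξ e (W.polar i)) (hor ξ e (W.polar (i + 1))) ∧
    turnAngle (hor ξ e (W.polar i)) (hor ξ e (W.polar (i + 1))) = W.turn ξ e i := by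
  obtain ⟨a, ha, h1⟩ := hW.hor_polar hadm he i
  obtain ⟨b, hb, h2⟩ := hW.hor_polar hadm he (i + 1)
  have hno := hW.notOpposite_secant he hadm i
  have hI : Complex.normSq (-Complex.I) = 1 := by simp
  rw [show i + 1 + 1 = i + 2 by ring] at h2
  rw [h1, h2]
  constructor
  · refine NotOpposite.smul_smul ?_ ha hb
    unfold NotOpposite at *
    rwa [conj_mul_mul_of_normSq hI]
  · rw [turnAngle_smul_smul _ _ ha hb]
    unfold turnAngle turn turnAngle
    rw [conj_mul_mul_of_normSq hI]

/-- Choose the branch of the argument whose cut is the projected meridian. Each turning angle is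
then a difference of arguments plus 2π times the signed crossing of the cut, and the differences
telescope over the closed polar polygon. -/
lemma IsSimple.totalTurn_eq_degreeAlong {u : V3} (hu : W.IsTransversal ξ u) :
    W.totalTurn ξ e = 2 * Real.pi * W.degreeAlong ξ u := by
  obtain ⟨hu1, hu2, hu3⟩ := hu
  set U := hor ξ e u with hU
  have hUn : Complex.normSq U = 1 := by
    have := he.normSq_hor u
    rw [hu1, hu2] at this
    linarith
  have hUn' : Complex.normSq (-starRingEnd ℂ U) = 1 := by simpa using hUn
  have hUU : U * starRingEnd ℂ U = 1 := by
    rw [Complex.mul_conj, hUn, Complex.ofReal_one]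
  set x : ℤ → ℂ := fun i => hor ξ e (W.polar i) with hx
  -- This rotation takes the direction U of the meridian to the negative real axis, the cut of
  -- `Complex.arg`.
  set y : ℤ → ℂ := fun i => -starRingEnd ℂ U * x i with hy
  have hxy : ∀ i, x i = -U * y i := fun i => by
    simp only [hy]; linear_combination -(x i) * hUU
  have hno : ∀ i, NotOpposite (x i) (x (i + 1)) := fun i => (hW.notOpposite_polar hadm he i).1
  have hslit : ∀ i, y i ∈ Complex.slitPlane := by
    intro i
    by_contra hc
    rw [Complex.mem_slitPlane_iff] at hc
    push Not at hc
    apply hu3 i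
    refine mem_meridian_of_hor he hu2 (hW.polar_unit hadm he i) (b := -(y i).re)
      (by linarith) ?_
    have : y i = ((y i).re : ℂ) := by apply Complex.ext <;> simp [hc.2]
    change x i = _
    rw [hxy, this]
    push_cast
    simp
    ring
  have hyno : ∀ i, NotOpposite (y i) (y (i + 1)) := fun i => by
    have := hno i
    unfold NotOpposite at *
    simp only [hy]
    rwa [conj_mul_mul_of_normSq hUn']
  have hyt : ∀ i, turnAngle (y i) (y (i + 1)) = W.turn ξ e i := fun i => by
    rw [← (hW.notOpposite_polar hadm he i).2]
    unfold turnAngle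
    simp only [hy]
    rw [conj_mul_mul_of_normSq hUn']
  have hcross : ∀ i, (sphArc (W.polar i) (W.polar (i + 1)) ∩ meridian ξ u).Nonempty ↔
      ∃ s t b : ℝ, 0 ≤ s ∧ 0 ≤ t ∧ 0 < s + t ∧ 0 ≤ b ∧ (s : ℂ) * y i + t * y (i + 1) = -(b : ℂ) := by
    intro i
    constructor
    · rintro ⟨p, ⟨hp1, s, t, hs, ht, hp⟩, -, a, b, hb, hp'⟩
      refine ⟨s, t, b, hs, ht, ?_, hb, ?_⟩
      · rcases hs.eq_or_lt with h1 | h1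
        · rcases ht.eq_or_lt with h2 | h2
          · rw [hp, ← h1, ← h2] at hp1; simp at hp1
          · linarith
        · linarith
      · have h := congrArg (hor ξ e) (hp.symm.trans hp')
        simp only [hor_add, hor_smul, hor_axis he] at h
        simp only [hy, hx]
        linear_combination -starRingEnd ℂ U * h - (b : ℂ) * hUU
    · rintro ⟨s, t, b, hs, ht, hst, hb, h⟩
      set p := s • W.polar i + t • W.polar (i + 1) with hp
      have hpU : hor ξ e p = b * hor ξ e u := by
        rw [hp, hor_add, hor_smul, hor_smul]
        change s * x i + t * x (i + 1) = b * U
        rw [hxy i, hxy (i + 1)]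
        linear_combination -U * h
      have hp0 : p ≠ 0 := by
        intro h0
        apply (hno i).cone_ne_zero hs ht hst
        have h3 : hor ξ e (0 : V3) = 0 := by apply Complex.ext <;> simp [hor]
        rw [← h3, ← h0, hp, hor_add, hor_smul, hor_smul]
      obtain ⟨d, hd, hmem⟩ := exists_smul_mem_sphArc hs ht hp hp0
      refine ⟨d • p, hmem, mem_meridian_of_hor he hu2 hmem.1 (b := d * b) (by positivity) ?_⟩
      rw [hor_smul, hpU]
      push_cast; ring
  have hsign : ∀ i, (W.polar i ⨯₃ W.polar (i + 1)) ⬝ᵥ ξ =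
      (starRingEnd ℂ (y i) * y (i + 1)).im := fun i => by
    rw [he.cross_dot_axis]
    simp only [hy]
    rw [conj_mul_mul_of_normSq hUn']
  have hterm : ∀ i : ℤ, W.turn ξ e i = Complex.arg (y (i + 1)) - Complex.arg (y i) +
      2 * Real.pi * ((open Classical in
        if (sphArc (W.polar i) (W.polar (i + 1)) ∩ meridian ξ u).Nonempty then
        (SignType.sign ((W.polar i ⨯₃ W.polar (i + 1)) ⬝ᵥ ξ) : ℤ) else 0 : ℤ) : ℝ) := by
    intro i
    obtain ⟨k, h1, h2, h3⟩ := turnAngle_eq_arg_sub (hslit i) (hslit (i + 1)) (hyno i)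
    rw [← hyt, h1, hsign]
    by_cases hc : (sphArc (W.polar i) (W.polar (i + 1)) ∩ meridian ξ u).Nonempty
    · rw [if_pos hc, h2 ((hcross i).1 hc)]
    · rw [if_neg hc, h3 (mt (hcross i).2 hc)]
  unfold totalTurn degreeAlong
  simp only [hterm]
  rw [Finset.sum_add_distrib, ← Finset.mul_sum]
  have htele := Finset.sum_range_sub (fun i : ℕ => Complex.arg (y i)) W.n
  have hper : y (W.n : ℤ) = y 0 := by
    simp only [hy, hx, polar]
    have h1 := W.periodic 0
    have h2 := W.periodic 1
    rw [zero_add] at h1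
    rw [h1, add_comm (W.n : ℤ) 1, h2, zero_add]
  rw [hper] at htele
  push_cast at htele ⊢
  rw [htele, sub_self, zero_add]

/-- Each vertex of the polar polygon projects to a nonzero vector and excludes a single direction,
so only finitely many points of the unit circle are forbidden. -/
lemma IsSimple.exists_isTransversal : ∃ u, W.IsTransversal ξ u := by
  set bad : Finset ℂ := (Finset.range W.n).image fun i : ℕ =>
    hor ξ e (W.polar i) / (‖hor ξ e (W.polar i)‖ : ℂ)
  have hinf : ((fun a : ℝ => Complex.exp (a * Complex.I)) '' Set.Ico 0 (2 * Real.pi)).Infinite := by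
    refine Set.Infinite.image ?_ (Set.Ico_infinite Real.two_pi_pos)
    intro a ha b hb h
    exact angle_unique ha.1 ha.2 hb.1 hb.2 h
  obtain ⟨_, ⟨a, ha, rfl⟩, hbad⟩ := hinf.exists_notMem_finset bad
  set U := Complex.exp (a * Complex.I) with hU
  have hUn : ‖U‖ = 1 := Complex.norm_exp_ofReal_mul_I a
  set u := Real.cos a • e + Real.sin a • (ξ ⨯₃ e) with hu
  have hore : hor ξ e e = 1 := by
    apply Complex.ext <;> simp [hor, he.unit]
  have horu : hor ξ e u = U := by
    rw [hu, hor_add, hor_smul, hor_smul, he.hor_cross_axis, hore, hU, Complex.exp_mul_I]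
    push_cast; ring
  have hu0 : ξ ⬝ᵥ u = 0 := by
    rw [hu, dotProduct_add, dotProduct_smul, dotProduct_smul, he.orth]
    simp
  refine ⟨u, ?_, hu0, ?_⟩
  · rw [← he.normSq_hor, horu, hu0, Complex.normSq_eq_norm_sq, hUn]; norm_num
  · rintro i ⟨-, c, b, hb, hp⟩
    set j := (i % W.n).toNat with hj
    have hn : (0 : ℤ) < W.n := by exact_mod_cast W.n_pos
    have h1 := Int.emod_nonneg i hn.ne'
    have h2 := Int.emod_lt_of_pos i hn
    have h3 := Int.emod_add_mul_ediv i W.n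
    have hpol : W.polar i = W.polar j := by
      unfold polar
      rw [show i = j + W.n * (i / W.n) by omega, w_add_mul,
        show (j : ℤ) + W.n * (i / W.n) + 1 = j + 1 + W.n * (i / W.n) by ring, w_add_mul]
    apply hbad
    rw [Finset.mem_image]
    refine ⟨j, Finset.mem_range.2 (by omega), ?_⟩
    rw [← hpol]
    have hx0 := (hW.notOpposite_polar hadm he i).1.left_ne_zero
    have h4 := congrArg (hor ξ e) hp
    rw [hor_add, hor_smul, hor_smul, hor_axis he, horu, mul_zero, zero_add] at h4
    have hb0 : b ≠ 0 := by
      rintro rfl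
      rw [h4] at hx0; simp at hx0
    rw [h4, norm_mul, hUn, Complex.norm_real, Real.norm_of_nonneg hb, mul_one]
    have hb0' : (b : ℂ) ≠ 0 := by exact_mod_cast hb0
    field_simp
    rfl

/-- The normal degree is the rotation number of the polar polygon around the axis. -/
theorem IsSimple.hasNormalDegree {d : ℤ} (h : W.totalTurn ξ e = 2 * Real.pi * d) :
    W.HasNormalDegree ξ d := by
  refine ⟨hW.exists_isTransversal hadm he, fun u hu => ?_⟩
  rw [hW.totalTurn_eq_degreeAlong hadm he hu] at h
  exact_mod_cast mul_left_cancel₀ Real.two_pi_pos.ne' h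

end

end SphPolygon

/-! ### Invariance under the elementary moves -/

namespace SphPolygon

/-- Heights that vanish nowhere along the isotopy keep their signs, so admissibility persists. Hence
consecutive secants never become opposite, and the rotation number cannot change. -/
lemma totalTurn_eq_of_isIsotopic {U V : SphPolygon} {ξ e : V3} (he : IsFrame ξ e)
    (h : IsIsotopic ξ U V) : (U.IsSimple ∧ V.IsSimple) ∧ (U.IsAdmissible ξ ↔ V.IsAdmissible ξ) ∧
      (U.IsAdmissible ξ → U.totalTurn ξ e = V.totalTurn ξ e) := by
  obtain ⟨F, rfl, rfl, hn, hc, hs, hz⟩ := h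
  have hzc : ∀ i, Continuous fun t => ξ ⬝ᵥ (F t).w i := fun i =>
    continuous_const.dotProduct (hc i)
  have hadm : ∀ s t, (F s).IsAdmissible ξ → (F t).IsAdmissible ξ := by
    intro s t h i hi
    have h1 := h i ((hz s i).2 ((hz t i).1 hi))
    have hne : ∀ x, (ξ ⬝ᵥ (F x).w (i - 1)) * (ξ ⬝ᵥ (F x).w (i + 1)) ≠ 0 := fun x => by
      refine mul_ne_zero (fun h2 => ?_) (fun h2 => ?_)
      · exact left_ne_zero_of_mul h1.ne ((hz s _).2 ((hz x _).1 h2))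
      · exact right_ne_zero_of_mul h1.ne ((hz s _).2 ((hz x _).1 h2))
    by_contra hc'
    have hmem : (0 : ℝ) ∈ Set.Icc ((ξ ⬝ᵥ (F s).w (i - 1)) * (ξ ⬝ᵥ (F s).w (i + 1)))
        ((ξ ⬝ᵥ (F t).w (i - 1)) * (ξ ⬝ᵥ (F t).w (i + 1))) := ⟨h1.le, not_lt.1 hc'⟩
    obtain ⟨x, hx⟩ := intermediate_value_univ s t ((hzc (i - 1)).mul (hzc (i + 1))) hmem
    exact hne x hx
  refine ⟨⟨hs 0, hs 1⟩, ⟨hadm 0 1, hadm 1 0⟩, fun ha => ?_⟩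
  have main := sum_turnAngle_deform
    (fun t (i : ℕ) => secant ξ e ((F t).w i) ((F t).w ((i : ℤ) + 1))) (F 0).n
    (fun i => continuous_secant ξ e (hc _) (hc _)) (fun t i _ => ?_) (fun t => ?_) 0 1
  · unfold totalTurn
    rw [hn 1]
    simpa only [turn, Nat.cast_add, Nat.cast_one, add_assoc, one_add_one_eq_two] using main
  · have := (hs t).notOpposite_secant he (hadm 0 t ha) i
    simpa only [Nat.cast_add, Nat.cast_one, add_assoc, one_add_one_eq_two] using this
  · have h1 := (F t).periodic 0
    have h2 := (F t).periodic 1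
    rw [hn t] at h1 h2
    rw [zero_add] at h1
    simp only [Nat.cast_zero, h1, zero_add]
    rw [add_comm, h2]

lemma IsShift.symm {U V : SphPolygon} (h : IsShift U V) : IsShift V U := by
  obtain ⟨hn, k, hk⟩ := h
  exact ⟨hn.symm, -k, fun i => by rw [hk]; simp⟩

lemma IsShift.isSimple {U V : SphPolygon} (h : IsShift U V) (hU : U.IsSimple) : V.IsSimple := by
  obtain ⟨hn, k, hk⟩ := h
  intro i j p hi hj
  have he : ∀ i, V.edge i = U.edge (i + k) := fun i => by
    unfold edge
    rw [hk, hk, add_right_comm]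
  rw [he] at hi hj
  rw [hn, hk, hk]
  rcases hU _ _ p hi hj with h | ⟨h, h'⟩ | ⟨h, h'⟩
  · exact .inl (Int.ModEq.add_right_cancel' k h)
  · exact .inr (.inl ⟨Int.ModEq.add_right_cancel' k (by rwa [add_right_comm]), h'⟩)
  · exact .inr (.inr ⟨Int.ModEq.add_right_cancel' k (by rwa [add_right_comm]), h'⟩)

lemma IsShift.isAdmissible {U V : SphPolygon} {ξ : V3} (h : IsShift U V)
    (hU : U.IsAdmissible ξ) : V.IsAdmissible ξ := by
  obtain ⟨hn, k, hk⟩ := h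
  intro i hi
  rw [hk] at hi
  rw [hk, hk, show i - 1 + k = i + k - 1 by ring, add_right_comm]
  exact hU _ hi

lemma IsShift.totalTurn_eq {U V : SphPolygon} (ξ e : V3) (h : IsShift U V) :
    U.totalTurn ξ e = V.totalTurn ξ e := by
  obtain ⟨hn, k, hk⟩ := h
  unfold totalTurn
  rw [hn, ← (U.turn_periodic ξ e).sum_range_add k]
  refine Finset.sum_congr rfl fun i _ => ?_
  unfold turn
  simp only [hk]
  congr 3 <;> ring_nf

/-- Reduction to ordered pairs in one period. It is needed for insertions, where the two polygons
have different periods and can be compared only within one of them. -/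
lemma isSimple_iff (W : SphPolygon) : W.IsSimple ↔ ∀ i j : ℤ, 0 ≤ i → i < j → j < W.n →
    ∀ p, p ∈ W.edge i → p ∈ W.edge j →
      (j = i + 1 ∧ p = W.w j) ∨ (i = 0 ∧ j = W.n - 1 ∧ p = W.w 0) := by
  have hn : (0 : ℤ) < W.n := by exact_mod_cast W.n_pos
  constructor
  · intro h i j hi hij hj p hp hq
    rcases h i j p hp hq with h | ⟨h, h'⟩ | ⟨h, h'⟩
    · exact absurd h (not_modEq_of_lt hij (by omega))
    · left
      refine ⟨?_, h'⟩
      by_contra hne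
      exact not_modEq_of_lt (by omega) (by omega) h.symm
    · right
      by_cases h0 : j + 1 < i + W.n
      · exact absurd h (not_modEq_of_lt (by omega) h0)
      · have : i = 0 := by omega
        subst this
        exact ⟨rfl, by omega, h'⟩
  · intro h
    have hmod : ∀ i : ℤ, i ≡ i % W.n [ZMOD W.n] := fun i => (Int.mod_modEq i W.n).symm
    have he : ∀ i : ℤ, W.edge i = W.edge (i % W.n) := fun i => by
      unfold edge
      rw [W.w_eq_of_modEq (hmod i), W.w_eq_of_modEq ((hmod i).add_right 1)]
    have key : ∀ i j : ℤ, i % W.n < j % W.n → ∀ p, p ∈ W.edge i → p ∈ W.edge j →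
        (j ≡ i + 1 [ZMOD W.n] ∧ p = W.w j) ∨ (i ≡ j + 1 [ZMOD W.n] ∧ p = W.w i) := by
      intro i j hij p hp hq
      rw [he] at hp hq
      have b1 := Int.emod_nonneg i hn.ne'
      have b2 := Int.emod_lt_of_pos j hn
      rcases h _ _ b1 hij b2 p hp hq with ⟨h1, h2⟩ | ⟨h1, h2, h3⟩
      · left
        refine ⟨?_, by rw [h2, ← W.w_eq_of_modEq (hmod j)]⟩
        exact (hmod j).trans (by rw [h1]; exact (hmod i).symm.add_right 1)
      · right
        refine ⟨?_, by rw [h3, W.w_eq_of_modEq (hmod i), h1]⟩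
        refine (hmod i).trans (Int.ModEq.trans ?_ ((hmod j).symm.add_right 1))
        rw [h1, h2, sub_add_cancel]
        simp [Int.ModEq]
    intro i j p hp hq
    rcases lt_trichotomy (i % W.n) (j % W.n) with hij | hij | hij
    · exact .inr (key i j hij p hp hq)
    · exact .inl hij
    · exact .inr (key j i hij p hq hp).symm

lemma isAdmissible_iff (W : SphPolygon) (ξ : V3) : W.IsAdmissible ξ ↔
    ∀ i : ℤ, 0 ≤ i → i < W.n → ξ ⬝ᵥ W.w i = 0 →
      (ξ ⬝ᵥ W.w (i - 1)) * (ξ ⬝ᵥ W.w (i + 1)) < 0 := by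
  have hn : (0 : ℤ) < W.n := by exact_mod_cast W.n_pos
  refine ⟨fun h i _ _ => h i, fun h i hi => ?_⟩
  have hmod : i ≡ i % W.n [ZMOD W.n] := (Int.mod_modEq i W.n).symm
  rw [W.w_eq_of_modEq hmod] at hi
  rw [W.w_eq_of_modEq (hmod.add_right 1), W.w_eq_of_modEq (hmod.sub_right 1)]
  exact h _ (Int.emod_nonneg i hn.ne') (Int.emod_lt_of_pos i hn) hi

/-! #### Subdivision of an arc -/

section Arc
variable {a b v : V3} {s t : ℝ} (hs : 0 < s) (ht : 0 < t) (hv : v = s • a + t • b)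
include hs ht hv

lemma sphArc_subset_left : sphArc a v ⊆ sphArc a b := by
  rintro p ⟨hp, x, y, hx, hy, rfl⟩
  refine ⟨hp, x + y * s, y * t, by positivity, by positivity, ?_⟩
  rw [hv, smul_add, smul_smul, smul_smul, add_smul, add_assoc]

lemma sphArc_subset_right : sphArc v b ⊆ sphArc a b := by
  rintro p ⟨hp, x, y, hx, hy, rfl⟩
  refine ⟨hp, x * s, x * t + y, by positivity, by positivity, ?_⟩
  rw [hv, smul_add, smul_smul, smul_smul, add_smul, add_assoc]

lemma sphArc_subset_union : sphArc a b ⊆ sphArc a v ∪ sphArc v b := by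
  rintro p ⟨hp, x, y, hx, hy, rfl⟩
  rcases le_total (s * y) (x * t) with h | h
  · left
    refine ⟨hp, x - s * y / t, y / t, ?_, by positivity, ?_⟩
    · rw [sub_nonneg, div_le_iff₀ ht]; exact h
    · rw [hv, smul_add, smul_smul, smul_smul, ← add_assoc, ← add_smul]
      congr 2 <;> field_simp
      ring
  · right
    refine ⟨hp, x / s, y - x * t / s, by positivity, ?_, ?_⟩
    · rw [sub_nonneg, div_le_iff₀ hs]; linarith
    · rw [hv, smul_add, smul_smul, smul_smul, add_assoc, ← add_smul]
      congr 2 <;> field_simp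
      ring

variable (hind : ∀ x y : ℝ, x • a + y • b = 0 → x = 0 ∧ y = 0)
include hind

omit ht in
lemma right_notMem_sphArc : b ∉ sphArc a v := by
  rintro ⟨-, x, y, hx, hy, h⟩
  have := hind (x + y * s) (y * t - 1) (by
    rw [hv] at h
    rw [sub_smul, one_smul]
    nth_rewrite 2 [h]
    module)
  have h1 : y * t = 1 := by linarith [this.2]
  have h2 : 0 < y := by
    refine lt_of_le_of_ne hy ?_
    rintro rfl; simp at h1
  have h3 := mul_pos h2 hs
  linarith [this.1]

omit hs in
lemma left_notMem_sphArc : a ∉ sphArc v b := by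
  rintro ⟨-, x, y, hx, hy, h⟩
  have := hind (x * s - 1) (x * t + y) (by
    rw [hv] at h
    rw [sub_smul, one_smul]
    nth_rewrite 2 [h]
    module)
  have h1 : x * s = 1 := by linarith [this.1]
  have h2 : 0 < x := by
    refine lt_of_le_of_ne hx ?_
    rintro rfl; simp at h1
  have h3 := mul_pos h2 ht
  linarith [this.2]

lemma eq_of_mem_sphArc_inter (hvu : v ⬝ᵥ v = 1) {p : V3} (h1 : p ∈ sphArc a v)
    (h2 : p ∈ sphArc v b) : p = v := by
  obtain ⟨hp, x, y, hx, hy, h1⟩ := h1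
  obtain ⟨-, x', y', hx', hy', h2⟩ := h2
  obtain ⟨e1, e2⟩ := hind (x + y * s - x' * s) (y * t - x' * t - y') (by
    have h3 := h1.symm.trans h2
    rw [hv] at h3
    rw [← sub_eq_zero] at h3
    rw [← h3]
    module)
  have h3 : y ≤ x' := by
    by_contra hc
    have := mul_pos (sub_pos.2 (not_le.1 hc)) hs
    linarith
  have h4 : x' ≤ y := by
    by_contra hc
    have := mul_pos (sub_pos.2 (not_le.1 hc)) ht
    linarith
  have h5 : y = x' := le_antisymm h3 h4
  have h6 : x = 0 := by rw [h5] at e1; linarith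
  rw [h6, zero_smul, zero_add] at h1
  rw [h1] at hp
  simp only [smul_dotProduct, dotProduct_smul, hvu, smul_eq_mul, mul_one] at hp
  have : y = 1 := by nlinarith
  rw [h1, this, one_smul]

end Arc

/-! ### Insertion of a vertex -/

/-- The data of an insertion. -/
lemma IsInsertion.exists_eq {U V : SphPolygon} (h : IsInsertion U V) :
    ∃ s t : ℝ, 0 < s ∧ 0 < t ∧ V.w U.n = s • U.w (U.n - 1) + t • U.w 0 := by
  obtain ⟨hn, hw, hv, s, t, hs, ht, h⟩ := h
  have h3 := U.three_le
  have hb : U.w ((U.n : ℤ) - 1 + 1) = U.w 0 := by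
    rw [sub_add_cancel]
    have := U.periodic 0
    rwa [zero_add] at this
  rw [hb] at h
  have hu := V.unit U.n
  have hone : ∀ {x : ℝ} {p : V3}, 0 ≤ x → p ⬝ᵥ p = 1 → V.w U.n = x • p → V.w U.n = p := by
    intro x p hx hp h
    rw [h] at hu
    simp only [smul_dotProduct, dotProduct_smul, hp, smul_eq_mul, mul_one] at hu
    rw [h, show x = 1 by nlinarith, one_smul]
  refine ⟨s, t, lt_of_le_of_ne hs ?_, lt_of_le_of_ne ht ?_, h⟩
  · rintro rfl
    rw [zero_smul, zero_add] at h
    have h1 := hone ht (U.unit 0) h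
    apply V.ne_next U.n
    rw [h1, ← hw 0 le_rfl (by omega)]
    have := V.periodic 0
    rw [zero_add, hn] at this
    push_cast at this
    exact this
  · rintro rfl
    rw [zero_smul, add_zero] at h
    have h1 := hone hs (U.unit _) h
    apply V.ne_next (U.n - 1)
    rw [sub_add_cancel, h1, hw _ (by omega) (by omega)]

section Insertion
variable {U V : SphPolygon} (h : IsInsertion U V)
include h

lemma IsInsertion.w_eq {i : ℤ} (h0 : 0 ≤ i) (h1 : i < U.n) : V.w i = U.w i := h.2.1 i h0 h1

lemma IsInsertion.w_succ_n (k : ℤ) : V.w (U.n + 1 + k) = V.w k := by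
  have := V.periodic k
  rw [h.1] at this
  rw [← this]
  congr 1
  push_cast
  ring

omit h in
lemma w_n_add (U : SphPolygon) (k : ℤ) : U.w (U.n + k) = U.w k := by
  rw [add_comm]; exact U.periodic k

/-- The new vertex is strictly inside the old edge. The old edge is the union of the two new ones,
these meet only in the new vertex, and neither contains the far end of the old edge. -/
lemma IsInsertion.isSimple_iff : U.IsSimple ↔ V.IsSimple := by
  obtain ⟨s, t, hs, ht, hv⟩ := h.exists_eq
  have h3 := U.three_le
  have hn : (V.n : ℤ) = U.n + 1 := by rw [h.1]; push_cast; rfl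
  have hind : ∀ x y : ℝ, x • U.w (U.n - 1) + y • U.w 0 = 0 → x = 0 ∧ y = 0 := by
    intro x y hxy
    apply U.eq_zero_of_comb_eq_zero (i := U.n - 1)
    have := w_n_add U 0
    rw [add_zero] at this
    rwa [sub_add_cancel, this]
  have hV0 : V.w 0 = U.w 0 := h.w_eq le_rfl (by omega)
  have hVn1 : V.w (U.n - 1) = U.w (U.n - 1) := h.w_eq (by omega) (by omega)
  have hVs : V.w (U.n + 1) = U.w 0 := by
    have := h.w_succ_n 0
    rw [add_zero] at this
    rw [this, hV0]
  have e1 : ∀ i : ℤ, 0 ≤ i → i < U.n - 1 → V.edge i = U.edge i := fun i h0 h1 => by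
    unfold edge
    rw [h.w_eq h0 (by omega), h.w_eq (by omega) (by omega)]
  have e2 : V.edge (U.n - 1) = sphArc (U.w (U.n - 1)) (V.w U.n) := by
    unfold edge
    rw [sub_add_cancel, hVn1]
  have e3 : V.edge U.n = sphArc (V.w U.n) (U.w 0) := by
    unfold edge
    rw [hVs]
  have e4 : U.edge (U.n - 1) = sphArc (U.w (U.n - 1)) (U.w 0) := by
    unfold edge
    have := w_n_add U 0
    rw [add_zero] at this
    rw [sub_add_cancel, this]
  have s1 := sphArc_subset_left hs ht hv
  have s2 := sphArc_subset_right hs ht hv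
  have s3 := sphArc_subset_union hs ht hv
  have s4 := right_notMem_sphArc hs hv hind
  have s5 := left_notMem_sphArc ht hv hind
  rw [U.isSimple_iff, V.isSimple_iff]
  constructor
  · intro hU i j hi hij hj p hp hq
    rw [hn] at hj
    rcases lt_trichotomy j (U.n - 1) with hj' | rfl | hj'
    · rw [e1 i hi (by omega)] at hp
      rw [e1 j (by omega) hj'] at hq
      rcases hU i j hi hij (by omega) p hp hq with ⟨h1, h2⟩ | ⟨h1, h2, h3⟩
      · exact .inl ⟨h1, by rw [h2, h.w_eq (by omega) (by omega)]⟩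
      · omega
    · rw [e1 i hi (by omega)] at hp
      rw [e2] at hq
      rcases hU i _ hi hij (by omega) p hp (by rw [e4]; exact s1 hq) with ⟨h1, h2⟩ | ⟨h1, h2, h3⟩
      · exact .inl ⟨h1, by rw [h2, hVn1]⟩
      · rw [h3] at hq; exact absurd hq s4
    · obtain rfl : j = U.n := by omega
      rw [e3] at hq
      rcases lt_or_ge i (U.n - 1) with hi' | hi'
      · rw [e1 i hi hi'] at hp
        rcases hU i (U.n - 1) hi hi' (by omega) p hp (by rw [e4]; exact s2 hq) with
          ⟨h1, h2⟩ | ⟨h1, h2, h3⟩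
        · rw [h2] at hq; exact absurd hq s5
        · exact .inr ⟨h1, by omega, by rw [h3, hV0]⟩
      · obtain rfl : i = U.n - 1 := by omega
        rw [e2] at hp
        exact .inl ⟨by ring, eq_of_mem_sphArc_inter hs ht hv hind (V.unit _) hp hq⟩
  · intro hV i j hi hij hj p hp hq
    rcases lt_or_ge j (U.n - 1) with hj' | hj'
    · rw [← e1 i hi (by omega)] at hp
      rw [← e1 j (by omega) hj'] at hq
      rcases hV i j hi hij (by omega) p hp hq with ⟨h1, h2⟩ | ⟨h1, h2, h3⟩
      · exact .inl ⟨h1, by rw [h2, h.w_eq (by omega) (by omega)]⟩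
      · omega
    · obtain rfl : j = U.n - 1 := by omega
      rw [← e1 i hi (by omega)] at hp
      rw [e4] at hq
      rcases s3 hq with hq | hq
      · rw [← e2] at hq
        rcases hV i _ hi hij (by omega) p hp hq with ⟨h1, h2⟩ | ⟨h1, h2, h3⟩
        · exact .inl ⟨h1, by rw [h2, hVn1]⟩
        · omega
      · rw [← e3] at hq
        rcases hV i _ hi (by omega) (by omega) p hp hq with ⟨h1, h2⟩ | ⟨h1, h2, h3⟩
        · omega
        · exact .inr ⟨h1, rfl, by rw [h3, hV0]⟩

/-- If one end of the old edge is on the equator, the height of the new vertex is a positive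
multiple of that of the other end. If the new vertex is on the equator, admissibility of `U`
prevents the ends from being there too, so their heights have opposite signs. -/
lemma IsInsertion.isAdmissible_iff (ξ : V3) : U.IsAdmissible ξ ↔ V.IsAdmissible ξ := by
  obtain ⟨s, t, hs, ht, hv⟩ := h.exists_eq
  have h3 := U.three_le
  have hn : (V.n : ℤ) = U.n + 1 := by rw [h.1]; push_cast; rfl
  have hV0 : V.w 0 = U.w 0 := h.w_eq le_rfl (by omega)
  have hVn1 : V.w (U.n - 1) = U.w (U.n - 1) := h.w_eq (by omega) (by omega)
  have hVs : V.w (U.n + 1) = U.w 0 := by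
    have := h.w_succ_n 0
    rw [add_zero] at this
    rw [this, hV0]
  have hVm : V.w (0 - 1) = V.w U.n := by rw [← h.w_succ_n (0 - 1)]; congr 1; ring
  have hUm : U.w (0 - 1) = U.w (U.n - 1) := by rw [← w_n_add U (0 - 1)]; congr 1
  have hUn : U.w U.n = U.w 0 := by simpa using w_n_add U 0
  have hz : ξ ⬝ᵥ V.w U.n = s * (ξ ⬝ᵥ U.w (U.n - 1)) + t * (ξ ⬝ᵥ U.w 0) := by
    rw [hv, dotProduct_add, dotProduct_smul, dotProduct_smul, smul_eq_mul, smul_eq_mul]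
  have key : ∀ i : ℤ, 0 ≤ i → i < U.n → ξ ⬝ᵥ U.w i = 0 →
      ((ξ ⬝ᵥ U.w (i - 1)) * (ξ ⬝ᵥ U.w (i + 1)) < 0 ↔ (ξ ⬝ᵥ V.w (i - 1)) * (ξ ⬝ᵥ V.w (i + 1)) < 0) := by
    intro i h0 h1 hzero
    rcases h0.eq_or_lt with rfl | h0
    · rw [hVm, hUm, hz, hzero, h.w_eq (i := 0 + 1) (by omega) (by omega), mul_zero, add_zero,
        mul_assoc]
      exact ⟨fun h => mul_neg_of_pos_of_neg hs h, fun h => by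
        by_contra hc; nlinarith [mul_nonneg hs.le (not_lt.1 hc)]⟩
    · rcases eq_or_ne i (U.n - 1) with rfl | hne
      · rw [sub_add_cancel, hUn, hz, hzero, h.w_eq (i := (U.n : ℤ) - 1 - 1) (by omega) (by omega),
          mul_zero, zero_add, mul_left_comm]
        exact ⟨fun h => mul_neg_of_pos_of_neg ht h, fun h => by
          by_contra hc; nlinarith [mul_nonneg ht.le (not_lt.1 hc)]⟩
      · rw [h.w_eq (i := i - 1) (by omega) (by omega), h.w_eq (i := i + 1) (by omega) (by omega)]
  rw [U.isAdmissible_iff, V.isAdmissible_iff]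
  constructor
  · intro hU i h0 h1 hzero
    rcases lt_or_ge i U.n with h1' | h1'
    · rw [h.w_eq h0 h1'] at hzero
      exact (key i h0 h1' hzero).1 (hU i h0 h1' hzero)
    · obtain rfl : i = U.n := by omega
      rw [hVs, hVn1]
      rw [hz] at hzero
      have ha : ξ ⬝ᵥ U.w (U.n - 1) ≠ 0 := by
        intro ha
        have := hU (U.n - 1) (by omega) (by omega) ha
        rw [sub_add_cancel, hUn] at this
        rw [ha, mul_zero, zero_add] at hzero
        rw [(mul_eq_zero.1 hzero).resolve_left ht.ne', mul_zero] at this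
        exact lt_irrefl _ this
      have h4 : 0 < s * (ξ ⬝ᵥ U.w (U.n - 1)) ^ 2 := by positivity
      have h5 : t * ((ξ ⬝ᵥ U.w (U.n - 1)) * (ξ ⬝ᵥ U.w 0)) = -(s * (ξ ⬝ᵥ U.w (U.n - 1)) ^ 2) := by
        linear_combination (ξ ⬝ᵥ U.w (U.n - 1)) * hzero
      by_contra hc
      nlinarith [mul_nonneg ht.le (not_lt.1 hc)]
  · intro hV i h0 h1 hzero
    refine (key i h0 h1 hzero).2 (hV i h0 (by omega) ?_)
    rw [h.w_eq h0 h1]; exact hzero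

/-- A sum over the edges of a subdivided polygon. -/
lemma IsInsertion.sum_split {M : Type*} [AddCommMonoid M] (f : ℤ → M) :
    ∑ i ∈ Finset.range V.n, f i =
      ∑ i ∈ Finset.range (U.n - 1), f i + f (U.n - 1) + f U.n := by
  have := U.three_le
  obtain ⟨m, hm⟩ : ∃ m, U.n = m + 1 := ⟨U.n - 1, by omega⟩
  rw [h.1, hm, Finset.sum_range_succ, Finset.sum_range_succ]
  simp

omit h in
lemma sum_split (U : SphPolygon) {M : Type*} [AddCommMonoid M] (f : ℤ → M) :
    ∑ i ∈ Finset.range U.n, f i = ∑ i ∈ Finset.range (U.n - 1), f i + f (U.n - 1) := by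
  have := U.three_le
  obtain ⟨m, hm⟩ : ∃ m, U.n = m + 1 := ⟨U.n - 1, by omega⟩
  rw [hm, Finset.sum_range_succ]
  simp

/-- The secants of the two new edges are positive multiples of that of the old edge, so the
additional turning angle is 0 and the others are unchanged. -/
lemma IsInsertion.totalTurn_eq (ξ e : V3) : U.totalTurn ξ e = V.totalTurn ξ e := by
  obtain ⟨s, t, hs, ht, hv⟩ := h.exists_eq
  have h3 := U.three_le
  have hV0 : V.w 0 = U.w 0 := h.w_eq le_rfl (by omega)
  have hVn1 : V.w (U.n - 1) = U.w (U.n - 1) := h.w_eq (by omega) (by omega)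
  have hVs : V.w (U.n + 1) = U.w 0 := by
    have := h.w_succ_n 0
    rw [add_zero] at this
    rw [this, hV0]
  have hVs' : V.w (U.n + 2) = U.w 1 := by
    have := h.w_succ_n 1
    rw [add_assoc, one_add_one_eq_two] at this
    rw [this, h.w_eq (by omega) (by omega)]
  have hUn : U.w U.n = U.w 0 := by simpa using w_n_add U 0
  have hUs := w_n_add U 1
  have n2 : U.n - 1 = (U.n - 2) + 1 := by omega
  have a1 : ∀ (u v : ℂ) {r : ℝ}, 0 < r → turnAngle u (r * v) = turnAngle u v :=
    fun u v r hr => by simpa using turnAngle_smul_smul u v one_pos hr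
  have a2 : ∀ (u v : ℂ) {r : ℝ}, 0 < r → turnAngle (r * u) v = turnAngle u v :=
    fun u v r hr => by simpa using turnAngle_smul_smul u v hr one_pos
  have f1 : secant ξ e (U.w (U.n - 1)) (V.w U.n) = t * secant ξ e (U.w (U.n - 1)) (U.w 0) := by
    rw [hv, secant_add_right, secant_smul_right, secant_smul_right, secant_self, mul_zero,
      zero_add]
  have f2 : secant ξ e (V.w U.n) (U.w 0) = s * secant ξ e (U.w (U.n - 1)) (U.w 0) := by
    rw [hv, secant_add_left, secant_smul_left, secant_smul_left, secant_self, mul_zero,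
      add_zero]
  have c2 : ((U.n - 2 : ℕ) : ℤ) = (U.n : ℤ) - 2 := by omega
  unfold totalTurn
  rw [h.sum_split, U.sum_split, n2, Finset.sum_range_succ, Finset.sum_range_succ, c2]
  have hfirst : ∑ i ∈ Finset.range (U.n - 2), U.turn ξ e i =
      ∑ i ∈ Finset.range (U.n - 2), V.turn ξ e i := by
    refine Finset.sum_congr rfl fun i hi => ?_
    rw [Finset.mem_range] at hi
    unfold turn
    rw [h.w_eq (by omega) (by omega), h.w_eq (by omega) (by omega), h.w_eq (by omega) (by omega)]
  have g1 : V.turn ξ e (U.n - 2) = U.turn ξ e (U.n - 2) := by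
    unfold turn
    rw [h.w_eq (i := (U.n : ℤ) - 2) (by omega) (by omega),
      show (U.n : ℤ) - 2 + 1 = U.n - 1 by ring, sub_add_cancel, hVn1, f1, hUn, a1 _ _ ht]
  have g2 : V.turn ξ e (U.n - 1) = 0 := by
    unfold turn
    rw [show (U.n : ℤ) - 1 + 2 = U.n + 1 by ring, sub_add_cancel, hVn1, f1, hVs, f2,
      turnAngle_smul_self _ ht hs]
  have g3 : V.turn ξ e U.n = U.turn ξ e (U.n - 1) := by
    unfold turn
    rw [show (U.n : ℤ) - 1 + 2 = U.n + 1 by ring, sub_add_cancel, hUs, hUn, hVs', hVs, f2,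
      a2 _ _ hs]
  rw [hfirst, g1, g2, g3, add_zero]

end Insertion

/-! ### Invariants of the class and the formula for the degree -/

/-- Simplicity, admissibility and the total turning are invariants of the class. -/
theorem SameClass.invariant {U V : SphPolygon} {ξ e : V3} (he : IsFrame ξ e)
    (h : SameClass ξ U V) :
    ((U.IsSimple ∧ U.IsAdmissible ξ) ↔ (V.IsSimple ∧ V.IsAdmissible ξ)) ∧
    (U.IsSimple ∧ U.IsAdmissible ξ → U.totalTurn ξ e = V.totalTurn ξ e) := by
  induction h with
  | rel U V h =>
    rcases h with h | h | h
    · have := totalTurn_eq_of_isIsotopic he h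
      exact ⟨by simp [this.1, this.2.1], fun h => this.2.2 h.2⟩
    · exact ⟨⟨fun g => ⟨h.isSimple g.1, h.isAdmissible g.2⟩,
        fun g => ⟨h.symm.isSimple g.1, h.symm.isAdmissible g.2⟩⟩, fun _ => h.totalTurn_eq ξ e⟩
    · exact ⟨and_congr h.isSimple_iff (h.isAdmissible_iff ξ), fun _ => h.totalTurn_eq ξ e⟩
  | refl U => exact ⟨Iff.rfl, fun _ => rfl⟩
  | symm U V _ ih => exact ⟨ih.1.symm, fun g => (ih.2 (ih.1.2 g)).symm⟩
  | trans U V W _ _ ih1 ih2 =>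
    exact ⟨ih1.1.trans ih2.1, fun g => (ih1.2 g).trans (ih2.2 (ih1.1.1 g))⟩

/-- The formula for the normal degree. -/
theorem IsRepresentedBy.hasNormalDegree {W : SphPolygon} {ξ : V3} {r : ℕ}
    {σ : Equiv.Perm (Fin (2 * r))} (h : W.IsRepresentedBy ξ r σ) (hW : W.IsSimple)
    (hadm : W.IsAdmissible ξ) (hξ : ξ ⬝ᵥ ξ = 1) (hr : 0 < r) :
    W.HasNormalDegree ξ (-(numPos σ : ℤ) + (numNeg σ : ℤ)) := by
  obtain ⟨e, he⟩ := exists_isFrame hξ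
  obtain ⟨Y, hWY, hY⟩ := h
  obtain ⟨h1, h2⟩ := hWY.invariant he
  obtain ⟨hs, ha⟩ := h1.1 ⟨hW, hadm⟩
  apply hW.hasNormalDegree hadm he
  rw [h2 ⟨hW, hadm⟩, hY.totalTurn_eq hs ha hr he]
  push_cast
  ring

end SphPolygon

/-! ### Subdivision at the equator -/

namespace SphPolygon

open Classical in
/-- The number of edges that cross the equator in an interior point. -/
noncomputable def crossCount (W : SphPolygon) (ξ : V3) : ℤ :=
  ∑ i ∈ Finset.range W.n, if (ξ ⬝ᵥ W.w i) * (ξ ⬝ᵥ W.w ((i : ℤ) + 1)) < 0 then 1 else 0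

open Classical in
/-- The number of edges that lead from the closed lower to the open upper hemisphere. -/
noncomputable def upCount (W : SphPolygon) (ξ : V3) : ℤ :=
  ∑ i ∈ Finset.range W.n, if ξ ⬝ᵥ W.w i ≤ 0 ∧ 0 < ξ ⬝ᵥ W.w ((i : ℤ) + 1) then 1 else 0

/-- Each vertex with height at most 0 cancels against the edge that starts there, unless that edge
ends strictly above the equator. -/
lemma index_eq_one_sub_upCount (W : SphPolygon) (ξ : V3) : W.index ξ = 1 - W.upCount ξ := by
  classical
  unfold index upCount
  rw [Finset.card_filter, Finset.card_filter]
  push_cast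
  rw [sub_add, ← Finset.sum_sub_distrib]
  congr 1
  refine Finset.sum_congr rfl fun i _ => ?_
  by_cases h1 : ξ ⬝ᵥ W.w i ≤ 0 <;> by_cases h2 : ξ ⬝ᵥ W.w ((i : ℤ) + 1) ≤ 0 <;>
    simp [h1, h2, not_lt.2, lt_of_not_ge]

lemma sum_periodic_pairs (W : SphPolygon) {M : Type*} [AddCommGroup M] (f : V3 → V3 → M) (k : ℤ) :
    ∑ i ∈ Finset.range W.n, f (W.w (k + i)) (W.w (k + i + 1)) =
      ∑ i ∈ Finset.range W.n, f (W.w i) (W.w ((i : ℤ) + 1)) :=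
  Function.Periodic.sum_range_add (g := fun i : ℤ => f (W.w i) (W.w (i + 1))) (fun i => by
    simp only [W.periodic, add_right_comm i (W.n : ℤ) 1]) k

lemma IsShift.sum_pairs {U V : SphPolygon} (h : IsShift U V) {M : Type*} [AddCommGroup M]
    (f : V3 → V3 → M) : ∑ i ∈ Finset.range V.n, f (V.w i) (V.w ((i : ℤ) + 1)) =
      ∑ i ∈ Finset.range U.n, f (U.w i) (U.w ((i : ℤ) + 1)) := by
  obtain ⟨hn, k, hk⟩ := h
  rw [hn, ← U.sum_periodic_pairs f k]
  refine Finset.sum_congr rfl fun i _ => ?_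
  rw [hk, hk]
  congr 2 <;> ring

/-- The polygon with another starting point. -/
def rotate (U : SphPolygon) (k : ℤ) : SphPolygon where
  n := U.n
  three_le := U.three_le
  w i := U.w (i + k)
  periodic i := by rw [add_right_comm, U.periodic]
  unit i := U.unit _
  ne_next i := by rw [add_right_comm]; exact U.ne_next _
  ne_neg_next i := by rw [add_right_comm]; exact U.ne_neg_next _

lemma isShift_rotate (U : SphPolygon) (k : ℤ) : IsShift U (U.rotate k) :=
  ⟨rfl, k, fun _ => rfl⟩

lemma exists_isInsertion (U : SphPolygon) {v : V3} {s t : ℝ} (hs : 0 < s) (ht : 0 < t)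
    (hv : v = s • U.w (U.n - 1) + t • U.w 0) (hu : v ⬝ᵥ v = 1) :
    ∃ V : SphPolygon, IsInsertion U V ∧ V.w U.n = v := by
  have h3 := U.three_le
  have hUn : U.w ((U.n : ℤ) - 1 + 1) = U.w 0 := by
    rw [sub_add_cancel]; simpa using w_n_add U 0
  have hind : ∀ x y : ℝ, x • U.w (U.n - 1) + y • U.w 0 = 0 → x = 0 ∧ y = 0 := by
    intro x y hxy
    apply U.eq_zero_of_comb_eq_zero (i := U.n - 1)
    rwa [hUn]
  have n1 : v ≠ U.w (U.n - 1) := fun h => by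
    have := hind (s - 1) t (by rw [sub_smul, one_smul, sub_add_eq_add_sub, ← hv, h, sub_self])
    linarith [this.2]
  have n2 : v ≠ -U.w (U.n - 1) := fun h => by
    have := hind (s + 1) t (by
      rw [add_smul, one_smul, add_right_comm, ← hv, h, neg_add_cancel])
    linarith [this.2]
  have n3 : U.w 0 ≠ v := fun h => by
    have := hind s (t - 1) (by rw [sub_smul, one_smul, ← add_sub_assoc, ← hv, h, sub_self])
    linarith [this.1]
  have n4 : U.w 0 ≠ -v := fun h => by
    have := hind s (t + 1) (by
      rw [add_smul, one_smul, ← add_assoc, ← hv, h, add_neg_cancel])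
    linarith [this.1]
  set f : ℤ → V3 := fun j => if j = U.n then v else U.w j with hf
  have fn : f U.n = v := by simp [hf]
  have fl : ∀ j : ℤ, j ≠ U.n → f j = U.w j := fun j hj => by simp [hf, hj]
  have hpos : (0 : ℤ) < U.n + 1 := by omega
  have step : ∀ {P : V3 → V3 → Prop}, (∀ i, P (U.w i) (U.w (i + 1))) → P (U.w (U.n - 1)) v →
      P v (U.w 0) → ∀ i : ℤ, P (f (i % (U.n + 1))) (f ((i + 1) % (U.n + 1))) := by
    intro P p1 p2 p3 i
    have h0 := Int.emod_nonneg i hpos.ne'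
    have h1 := Int.emod_lt_of_pos i hpos
    have h2 : (i + 1) % ((U.n : ℤ) + 1) = (i % (U.n + 1) + 1) % (U.n + 1) := by
      rw [Int.emod_add_emod]
    rw [h2]
    set k := i % ((U.n : ℤ) + 1)
    rcases lt_trichotomy k (U.n - 1) with hk | hk | hk
    · rw [Int.emod_eq_of_lt (by omega) (by omega), fl _ (by omega), fl _ (by omega)]
      exact p1 k
    · rw [hk, Int.emod_eq_of_lt (by omega) (by omega), fl _ (by omega), sub_add_cancel, fn]
      exact p2
    · have hk' : k = U.n := by omega
      rw [hk', Int.emod_self, fn, fl 0 (by omega)]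
      exact p3
  refine ⟨⟨U.n + 1, by omega, fun j => f (j % (U.n + 1)), fun i => ?_, fun i => ?_,
    step (P := fun a b => b ≠ a) U.ne_next n1 n3,
    step (P := fun a b => b ≠ -a) U.ne_neg_next n2 n4⟩, ⟨rfl, ?_, ?_⟩, ?_⟩
  · push_cast
    rw [Int.add_emod_right]
  · simp only [hf]
    split_ifs
    · exact hu
    · exact U.unit _
  · intro i h0 h1
    simp only
    rw [Int.emod_eq_of_lt h0 (by omega), fl _ (by omega)]
  · simp only
    rw [Int.emod_eq_of_lt (by omega) (by omega), fn]
    refine ⟨hu, s, t, hs.le, ht.le, ?_⟩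
    rw [hUn, hv]
  · simp only
    rw [Int.emod_eq_of_lt (by omega) (by omega), fn]

/-- Renumber so that a crossing edge becomes the last one, then insert its point on the equator.
Neither new edge crosses in its interior, and exactly one of them goes up if the old one did. -/
lemma exists_subdivision_step (U : SphPolygon) (ξ : V3) (h : 0 < U.crossCount ξ) :
    ∃ V : SphPolygon, SameClass ξ U V ∧ V.crossCount ξ = U.crossCount ξ - 1 ∧
      V.upCount ξ = U.upCount ξ := by
  classical
  obtain ⟨i, -, hi⟩ : ∃ i ∈ Finset.range U.n,
      (ξ ⬝ᵥ U.w i) * (ξ ⬝ᵥ U.w ((i : ℤ) + 1)) < 0 := by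
    by_contra hc
    push Not at hc
    unfold crossCount at h
    rw [Finset.sum_eq_zero fun i hi => if_neg (not_lt.2 (hc i hi))] at h
    exact lt_irrefl _ h
  have h3 := U.three_le
  set R := U.rotate (i + 1) with hR
  have hRs := U.isShift_rotate (i + 1)
  set a := ξ ⬝ᵥ U.w i with ha
  set b := ξ ⬝ᵥ U.w ((i : ℤ) + 1) with hb
  have hRa : R.w (R.n - 1) = U.w i := by
    change U.w ((U.n : ℤ) - 1 + (i + 1)) = _
    rw [← w_n_add U i]
    congr 1; ring
  have hRb : R.w 0 = U.w ((i : ℤ) + 1) := by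
    change U.w (0 + ((i : ℤ) + 1)) = _
    rw [zero_add]
  have ha0 : a ≠ 0 := left_ne_zero_of_mul hi.ne
  have hb0 : b ≠ 0 := right_ne_zero_of_mul hi.ne
  have hp0 : |b| • U.w i + |a| • U.w ((i : ℤ) + 1) ≠ 0 := fun h0 =>
    hb0 (abs_eq_zero.1 (U.eq_zero_of_comb_eq_zero h0).1)
  obtain ⟨d, hd, hmem⟩ := exists_smul_mem_sphArc (abs_nonneg b) (abs_nonneg a) rfl hp0
  have hz : ξ ⬝ᵥ (d • (|b| • U.w i + |a| • U.w ((i : ℤ) + 1))) = 0 := by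
    simp only [dotProduct_smul, dotProduct_add, smul_eq_mul, ← ha, ← hb]
    have : |b| * a + |a| * b = 0 := by
      rcases mul_neg_iff.1 hi with ⟨h3, h4⟩ | ⟨h3, h4⟩
      · rw [abs_of_pos h3, abs_of_neg h4]; ring
      · rw [abs_of_neg h3, abs_of_pos h4]; ring
    rw [this, mul_zero]
  obtain ⟨V, hV, hVv⟩ := R.exists_isInsertion (s := d * |b|) (t := d * |a|)
    (v := d • (|b| • U.w i + |a| • U.w ((i : ℤ) + 1))) (by positivity) (by positivity)
    (by rw [hRa, hRb, smul_add, smul_smul, smul_smul]) hmem.1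
  have hRn : (3 : ℤ) ≤ R.n := by exact_mod_cast R.three_le
  have hV0 : V.w 0 = R.w 0 := hV.w_eq le_rfl (by omega)
  have hVn1 : V.w (R.n - 1) = R.w (R.n - 1) := hV.w_eq (by omega) (by omega)
  have hVs : V.w (R.n + 1) = R.w 0 := by
    have := hV.w_succ_n 0
    rw [add_zero] at this
    rw [this, hV0]
  have hRn' : R.w ((R.n : ℤ) - 1 + 1) = R.w 0 := by
    rw [sub_add_cancel]; simpa using w_n_add R 0
  -- For any sum over edges, the insertion replaces the term of one edge by the terms of its two
  -- parts; both counts are of this form.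
  have count : ∀ f : V3 → V3 → ℤ,
      ∑ i ∈ Finset.range V.n, f (V.w i) (V.w ((i : ℤ) + 1)) =
      ∑ i ∈ Finset.range U.n, f (U.w i) (U.w ((i : ℤ) + 1)) - f (U.w i) (U.w ((i : ℤ) + 1)) +
        f (U.w i) (V.w R.n) + f (V.w R.n) (U.w ((i : ℤ) + 1)) := by
    intro f
    rw [← hRs.sum_pairs f, hV.sum_split (f := fun i : ℤ => f (V.w i) (V.w (i + 1))),
      sum_split (U.rotate (i + 1)) (f := fun i : ℤ => f (R.w i) (R.w (i + 1)))]
    have : ∑ i ∈ Finset.range (R.n - 1), f (V.w i) (V.w ((i : ℤ) + 1)) =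
        ∑ i ∈ Finset.range (R.n - 1), f (R.w i) (R.w ((i : ℤ) + 1)) := by
      refine Finset.sum_congr rfl fun j hj => ?_
      rw [Finset.mem_range] at hj
      rw [hV.w_eq (by omega) (by omega), hV.w_eq (by omega) (by omega)]
    change _ = ∑ i ∈ Finset.range (R.n - 1), f (R.w i) (R.w ((i : ℤ) + 1)) +
      f (R.w (R.n - 1)) (R.w (R.n - 1 + 1)) - _ + _ + _
    rw [this, hVn1, sub_add_cancel, hVs, ← hRa, ← hRb]
    have hRn'' : R.w (R.n : ℤ) = R.w 0 := by simpa using w_n_add R 0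
    rw [hRn'']
    ring
  rw [hVv] at count
  refine ⟨V, (Relation.EqvGen.rel _ _ (.inr (.inl hRs))).trans _ _ _
    (Relation.EqvGen.rel _ _ (.inr (.inr hV))), ?_, ?_⟩
  · unfold crossCount
    have := count fun x y => if (ξ ⬝ᵥ x) * (ξ ⬝ᵥ y) < 0 then 1 else 0
    rw [this, hz, if_pos hi]
    simp
  · unfold upCount
    have := count fun x y => if ξ ⬝ᵥ x ≤ 0 ∧ 0 < ξ ⬝ᵥ y then 1 else 0
    rw [this, hz, ← ha, ← hb]
    rcases mul_neg_iff.1 hi with ⟨h3, h4⟩ | ⟨h3, h4⟩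
    · simp [h4.not_gt]
    · simp [h4, h3.le]

/-- If the heights of the ends of an edge do not have opposite signs, an interior point on the
equator forces both ends to be there, which admissibility forbids. -/
lemma isSubdivided_of_crossCount {U : SphPolygon} {ξ : V3} (hadm : U.IsAdmissible ξ)
    (h : U.crossCount ξ = 0) : U.IsSubdivided ξ := by
  classical
  have hnn : ∀ i : ℤ, 0 ≤ (ξ ⬝ᵥ U.w i) * (ξ ⬝ᵥ U.w (i + 1)) := by
    intro i
    by_contra hc
    unfold crossCount at h
    rw [← U.sum_periodic_pairs (fun x y => if (ξ ⬝ᵥ x) * (ξ ⬝ᵥ y) < 0 then (1 : ℤ) else 0) i,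
      Finset.sum_eq_zero_iff_of_nonneg (fun i _ => by split_ifs <;> simp)] at h
    have := h 0 (Finset.mem_range.2 U.n_pos)
    simp only [Nat.cast_zero, add_zero] at this
    rw [if_pos (not_le.1 hc)] at this
    exact one_ne_zero this
  intro i p hp hz
  obtain ⟨hu, s, t, hs, ht, hp⟩ := hp
  have hi := hnn i
  have hone : ∀ {x : ℝ} {q : V3}, 0 ≤ x → q ⬝ᵥ q = 1 → p = x • q → p = q := by
    intro x q hx hq h
    rw [h] at hu
    simp only [smul_dotProduct, dotProduct_smul, hq, smul_eq_mul, mul_one] at hu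
    rw [h, show x = 1 by nlinarith, one_smul]
  rw [hp, dotProduct_add, dotProduct_smul, dotProduct_smul, smul_eq_mul, smul_eq_mul] at hz
  rcases hs.eq_or_lt with rfl | hs'
  · right
    exact hone ht (U.unit _) (by rw [hp, zero_smul, zero_add])
  rcases ht.eq_or_lt with rfl | ht'
  · left
    exact hone hs (U.unit _) (by rw [hp, zero_smul, add_zero])
  exfalso
  have e1 : s * (ξ ⬝ᵥ U.w i) ^ 2 + t * ((ξ ⬝ᵥ U.w i) * (ξ ⬝ᵥ U.w (i + 1))) = 0 := by
    linear_combination (ξ ⬝ᵥ U.w i) * hz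
  have e2 : ξ ⬝ᵥ U.w i = 0 := by
    have h1 := mul_nonneg ht hi
    have h2 : s * (ξ ⬝ᵥ U.w i) ^ 2 = 0 := le_antisymm (by linarith) (by positivity)
    exact pow_eq_zero_iff two_ne_zero |>.1 ((mul_eq_zero.1 h2).resolve_left hs'.ne')
  have e3 : ξ ⬝ᵥ U.w (i + 1) = 0 := by
    rw [e2, mul_zero, zero_add] at hz
    exact (mul_eq_zero.1 hz).resolve_left ht'.ne'
  have := hadm i e2
  rw [e3, mul_zero] at this
  exact lt_irrefl _ this

lemma exists_subdivided (W : SphPolygon) {ξ : V3} (hξ : ξ ⬝ᵥ ξ = 1) (hs : W.IsSimple)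
    (hadm : W.IsAdmissible ξ) : ∃ Y : SphPolygon, SameClass ξ W Y ∧ Y.IsSimple ∧
      Y.IsAdmissible ξ ∧ Y.IsSubdivided ξ ∧ Y.upCount ξ = W.upCount ξ := by
  have hnn : ∀ U : SphPolygon, 0 ≤ U.crossCount ξ := fun U =>
    Finset.sum_nonneg fun i _ => by split_ifs <;> simp
  have key : ∀ (m : ℕ) (U : SphPolygon), U.crossCount ξ = m →
      ∃ Y : SphPolygon, SameClass ξ U Y ∧ Y.crossCount ξ = 0 ∧ Y.upCount ξ = U.upCount ξ := by
    intro m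
    induction m with
    | zero => exact fun U h => ⟨U, Relation.EqvGen.refl _, by simpa using h, rfl⟩
    | succ m ih =>
      intro U h
      obtain ⟨V, h1, h2, h3⟩ := U.exists_subdivision_step ξ (by omega)
      obtain ⟨Y, g1, g2, g3⟩ := ih V (by push_cast at h; omega)
      exact ⟨Y, h1.trans _ _ _ g1, g2, g3.trans h3⟩
  obtain ⟨Y, h1, h2, h3⟩ := key (W.crossCount ξ).toNat W (Int.toNat_of_nonneg (hnn W)).symm
  obtain ⟨e, he⟩ := exists_isFrame hξ
  obtain ⟨g1, g2⟩ := (h1.invariant he).1.1 ⟨hs, hadm⟩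
  exact ⟨Y, h1, g1, g2, isSubdivided_of_crossCount g2 h2, h3⟩

end SphPolygon

/-! ### Enumeration of the crossings -/

/-- The set of zeros of a periodic function on `ℤ` has an increasing enumeration. -/
lemma exists_enumeration {Z : Set ℤ} {n : ℕ} (hn : 0 < n) (hne : Z.Nonempty)
    (hper : ∀ j : ℤ, j + (n : ℤ) ∈ Z ↔ j ∈ Z) :
    ∃ (c : ℤ → ℤ) (N : ℤ), StrictMono c ∧ (∀ j : ℤ, j ∈ Z ↔ ∃ k, c k = j) ∧ 0 < N ∧
      ∀ k, c (k + N) = c k + n := by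
  classical
  have : Nonempty Z := hne.to_subtype
  have hper' : ∀ j : ℤ, j - (n : ℤ) ∈ Z ↔ j ∈ Z := fun j => by
    rw [← hper (j - n), sub_add_cancel]
  -- A nonempty periodic set of integers is unbounded in both directions and locally finite, so its
  -- order type is ℤ.
  have : NoMaxOrder Z := ⟨fun a => ⟨⟨a + n, (hper _).2 a.2⟩, by
    rw [← Subtype.coe_lt_coe]; dsimp only; omega⟩⟩
  have : NoMinOrder Z := ⟨fun a => ⟨⟨a - n, (hper' _).2 a.2⟩, by
    rw [← Subtype.coe_lt_coe]; dsimp only; omega⟩⟩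
  let : LocallyFiniteOrder Z := Subtype.instLocallyFiniteOrder (fun j => j ∈ Z)
  let : SuccOrder Z := LinearLocallyFiniteOrder.succOrder Z
  let : PredOrder Z := LinearLocallyFiniteOrder.predOrder Z
  let φ : Z ≃o ℤ := orderIsoIntOfLinearSuccPredArch
  -- Translation by the period, in terms of the enumeration. It is an increasing bijection of ℤ,
  -- hence itself a translation, by `T 0`.
  let T : ℤ → ℤ := fun k => φ ⟨(φ.symm k : ℤ) + n, (hper _).2 (φ.symm k).2⟩
  have hφT : ∀ k, ((φ.symm (T k) : Z) : ℤ) = (φ.symm k : ℤ) + n := fun k => by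
    simp [T]
  have hTmono : StrictMono T := by
    intro a b hab
    apply φ.strictMono
    rw [Subtype.mk_lt_mk]
    have := φ.symm.strictMono hab
    rw [← Subtype.coe_lt_coe] at this
    omega
  have hTsurj : Function.Surjective T := by
    intro m
    refine ⟨φ ⟨(φ.symm m : ℤ) - n, (hper' _).2 (φ.symm m).2⟩, ?_⟩
    simp [T]
  have hTstep : ∀ k, T (k + 1) = T k + 1 := by
    intro k
    have h1 := hTmono (lt_add_one k)
    obtain ⟨m, hm⟩ := hTsurj (T k + 1)
    have h2 : k < m := hTmono.lt_iff_lt.1 (by omega)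
    have h3 : T (k + 1) ≤ T m := hTmono.monotone (by omega)
    omega
  have hT : ∀ k, T k = k + T 0 := by
    intro k
    induction k using Int.induction_on with
    | zero => simp
    | succ i ih => rw [hTstep, ih]; ring
    | pred i ih =>
      have := hTstep (-(i : ℤ) - 1)
      rw [sub_add_cancel, ih] at this
      omega
  refine ⟨fun k => (φ.symm k : ℤ), T 0, fun a b hab => φ.symm.strictMono hab, ?_, ?_, ?_⟩
  · intro j
    constructor
    · intro hj
      exact ⟨φ ⟨j, hj⟩, by simp⟩
    · rintro ⟨k, rfl⟩
      exact (φ.symm k).2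
  · have h1 := hφT 0
    have h2 : (φ.symm 0 : Z) < φ.symm (T 0) := by
      rw [← Subtype.coe_lt_coe, h1]; omega
    exact φ.symm.lt_iff_lt.1 h2
  · intro k
    rw [← hT]
    exact hφT k

namespace SphPolygon

lemma upCount_pair_iff {Y : SphPolygon} {ξ : V3} (hsub : Y.IsSubdivided ξ) (j : ℤ) :
    (ξ ⬝ᵥ Y.w j ≤ 0 ∧ 0 < ξ ⬝ᵥ Y.w (j + 1)) ↔ (ξ ⬝ᵥ Y.w j = 0 ∧ 0 < ξ ⬝ᵥ Y.w (j + 1)) := by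
  refine ⟨fun ⟨h1, h2⟩ => ⟨?_, h2⟩, fun ⟨h1, h2⟩ => ⟨h1.le, h2⟩⟩
  by_contra h0
  have h3 := hsub.mul_pos h0 h2.ne'
  have h4 : ξ ⬝ᵥ Y.w j < 0 := lt_of_le_of_ne h1 h0
  nlinarith

/-- In a subdivided polygon an edge can go up only from a crossing, so each upper chord contributes
its first edge and nothing else contributes. -/
lemma IsEnumeration.upCount_eq {Y : SphPolygon} {ξ : V3} {r : ℕ} {c : ℤ → ℤ}
    (E : Y.IsEnumeration ξ r c) : Y.upCount ξ = r := by
  classical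
  unfold upCount
  set g : ℤ → ℤ := fun j => if ξ ⬝ᵥ Y.w j ≤ 0 ∧ 0 < ξ ⬝ᵥ Y.w (j + 1) then 1 else 0 with hg
  have h1 : ∑ i ∈ Finset.range Y.n, g i = ∑ i ∈ Finset.range (c (2 * r : ℕ) - c 0).toNat,
      g (c 0 + i) := by
    have h2 := E.shift 0
    rw [zero_add] at h2
    push_cast
    rw [h2, add_sub_cancel_left, Int.toNat_natCast]
    exact (Y.sum_periodic_pairs
      (fun x y => if ξ ⬝ᵥ x ≤ 0 ∧ 0 < ξ ⬝ᵥ y then (1 : ℤ) else 0) (c 0)).symm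
  have h3 : ∀ k : ℤ, ∑ i ∈ Finset.range (chordLen c k), g (c k + i) =
      if Even k then 1 else 0 := by
    intro k
    have hlen := E.two_le_chordLen k
    have hcast := E.chordLen_cast k
    obtain ⟨m, hm⟩ : ∃ m, chordLen c k = m + 1 := ⟨chordLen c k - 1, by omega⟩
    rw [hm, Finset.sum_range_succ', Finset.sum_eq_zero, zero_add]
    · simp only [hg, upCount_pair_iff E.subdivided, Nat.cast_zero, add_zero, E.zero, true_and]
      have := E.sign_first k
      unfold altSign at this
      split_ifs at this with h
      · rw [one_mul] at this
        simp [h, this]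
      · rw [neg_one_mul, neg_pos] at this
        simp [h, this.not_gt]
    · intro i hi
      rw [Finset.mem_range] at hi
      simp only [hg, upCount_pair_iff E.subdivided]
      rw [if_neg]
      rintro ⟨h4, -⟩
      exact E.ne_zero (k := k) (by push_cast; omega) (by push_cast; omega) h4
  change ∑ i ∈ Finset.range Y.n, g i = r
  rw [h1, E.sum_chords, Finset.sum_congr rfl fun (k : ℕ) _ => h3 k]
  clear h1 h3 E
  induction r with
  | zero => simp
  | succ r ih =>
    rw [show 2 * (r + 1) = 2 * r + 1 + 1 by ring, Finset.sum_range_succ, Finset.sum_range_succ, ih]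
    simp

/-- The enumeration of the zeros of the height is started at a crossing that goes up. Since the
chords alternate between the hemispheres, their number is even, and half of it is the number of
edges that go up. -/
lemma exists_isEnumeration {Y : SphPolygon} {ξ : V3} (hs : Y.IsSimple) (ha : Y.IsAdmissible ξ)
    (hsub : Y.IsSubdivided ξ) {r : ℕ} (hr : 0 < r) (hup : Y.upCount ξ = r) :
    ∃ c, Y.IsEnumeration ξ r c := by
  classical
  obtain ⟨j, hj0, hj⟩ : ∃ j : ℤ, ξ ⬝ᵥ Y.w j = 0 ∧ 0 < ξ ⬝ᵥ Y.w (j + 1) := by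
    by_contra hc
    push Not at hc
    unfold upCount at hup
    rw [Finset.sum_eq_zero] at hup
    · omega
    · intro i _
      rw [if_neg]
      rw [upCount_pair_iff hsub]
      rintro ⟨h1, h2⟩
      exact absurd h2 (not_lt.2 (hc i h1))
  obtain ⟨c₀, N, hmono, hZ, hN, hshift⟩ := exists_enumeration (Z := {j | ξ ⬝ᵥ Y.w j = 0}) Y.n_pos
    ⟨j, hj0⟩ (fun j => by
      change ξ ⬝ᵥ Y.w (j + Y.n) = 0 ↔ _
      rw [Y.periodic]; rfl)
  obtain ⟨k₀, hk₀⟩ := (hZ j).1 hj0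
  have C : Y.IsCrossingSeq ξ fun k => c₀ (k + k₀) :=
    ⟨ha, hsub, fun a b hab => hmono (by omega), fun j => by
      rw [show ξ ⬝ᵥ Y.w j = 0 ↔ _ from hZ j]
      exact ⟨fun ⟨k, hk⟩ => ⟨k - k₀, by simpa using hk⟩, fun ⟨k, hk⟩ => ⟨_, hk⟩⟩⟩
  have hsign : ∀ m : ℤ, 0 < altSign m * (ξ ⬝ᵥ Y.w (c₀ (m + k₀) + 1)) := by
    have step : ∀ m : ℤ, 0 < altSign m * (ξ ⬝ᵥ Y.w (c₀ (m + k₀) + 1)) ↔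
        0 < altSign (m + 1) * (ξ ⬝ᵥ Y.w (c₀ (m + 1 + k₀) + 1)) := by
      intro m
      have := C.alternating m
      rw [altSign_succ]
      rcases altSign_eq m with h | h <;> rw [h]
      · rw [one_mul, neg_one_mul, neg_pos]; exact pos_iff_neg_of_mul_neg this
      · rw [neg_one_mul, neg_neg, one_mul, neg_pos]; exact neg_iff_pos_of_mul_neg this
    intro m
    induction m using Int.induction_on with
    | zero => rw [zero_add, hk₀]; simpa [altSign] using hj
    | succ i ih => exact (step _).1 ih
    | pred i ih => exact (step _).2 (by simpa using ih)
  -- After N chords the polygon has closed up, so chord N lies in the same hemisphere as chord 0.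
  have hNeven : Even N := by
    by_contra hodd
    have h1 := hsign N
    rw [add_comm N k₀, hshift, hk₀, add_right_comm, Y.periodic] at h1
    unfold altSign at h1
    rw [if_neg hodd] at h1
    linarith
  obtain ⟨M, hM⟩ := hNeven
  have hM' : N = 2 * (M.toNat : ℤ) := by omega
  have E : Y.IsEnumeration ξ M.toNat fun k => c₀ (k + k₀) := by
    refine ⟨C, hs, by omega, fun k => ?_, fun i => ?_⟩
    · rw [← hM', add_right_comm, hshift]
    · have := hsign (2 * i)
      simpa [altSign] using this
  have hMr : M.toNat = r := by
    have := E.upCount_eq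
    rw [hup] at this
    exact_mod_cast this.symm
  exact ⟨_, hMr ▸ E⟩

/-! ### Free chords -/

/-- The sign relation says that {p, q} and {a, b} are not interlaced. So if one of p, q lies between
a and b, both do, and their distance is smaller. -/
lemma abs_sub_lt_of_sign_relation {a b p q : ℝ} (hpa : p ≠ a) (hpb : p ≠ b) (hqa : q ≠ a)
    (hqb : q ≠ b) (h : (SignType.sign (q - a) : ℝ) - SignType.sign (p - a) -
      SignType.sign (q - b) + SignType.sign (p - b) = 0)
    (hin : (min a b < p ∧ p < max a b) ∨ (min a b < q ∧ q < max a b)) : |q - p| < |b - a| := by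
  have sg : ∀ {x y : ℝ}, x < y → (SignType.sign (x - y) : ℝ) = -1 ∧
      (SignType.sign (y - x) : ℝ) = 1 := fun h => by
    rw [sign_neg (sub_neg.2 h), sign_pos (sub_pos.2 h)]; simp
  rcases lt_or_gt_of_ne hpa with h1 | h1 <;> rcases lt_or_gt_of_ne hpb with h2 | h2 <;>
    rcases lt_or_gt_of_ne hqa with h3 | h3 <;> rcases lt_or_gt_of_ne hqb with h4 | h4 <;>
    simp only [sg h1, sg h2, sg h3, sg h4] at h <;> norm_num at h <;>
    rw [min_lt_iff, min_lt_iff, lt_max_iff, lt_max_iff] at hin <;>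
    rw [abs_lt] <;> constructor <;>
    rcases abs_cases (b - a) with ⟨h5, h6⟩ | ⟨h5, h6⟩ <;> rw [h5] <;>
    first
      | linarith
      | (exfalso; rcases hin with ⟨h7 | h7, h8 | h8⟩ | ⟨h7 | h7, h8 | h8⟩ <;> linarith)

namespace IsEnumeration
variable {Y : SphPolygon} {ξ e : V3} {r : ℕ} {c : ℤ → ℤ} (E : Y.IsEnumeration ξ r c)
include E

/-- There is a chord whose ends are adjacent in the order that begins at the `0`-th crossing. -/
lemma exists_free_chord (he : IsFrame ξ e) {φ : ℤ → ℝ} (A : IsAngle Y ξ e c φ) :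
    ∃ i : ℤ, ∀ x : ℤ, ¬(min (φ (2 * i)) (φ (2 * i + 1)) < φ x ∧
      φ x < max (φ (2 * i)) (φ (2 * i + 1))) := by
  -- The upper chord with the smallest difference of angles: a crossing between its ends would
  -- belong to another upper chord, which by `abs_sub_lt_of_sign_relation` would have a smaller
  -- difference.
  obtain ⟨i, hi, hmin⟩ := Finset.exists_min_image (Finset.range r)
    (fun i : ℕ => |φ (2 * i + 1) - φ (2 * i)|) ⟨0, Finset.mem_range.2 E.r_pos⟩
  rw [Finset.mem_range] at hi
  refine ⟨i, fun x hx => ?_⟩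
  have hr : (0 : ℤ) < 2 * r := by have := E.r_pos; omega
  have h1 := Int.emod_nonneg x hr.ne'
  have h2 := Int.emod_lt_of_pos x hr
  have h3 := Int.emod_add_mul_ediv x (2 * r)
  rw [← h3, E.angle_shift_mul A he] at hx
  set y := x % (2 * r) with hy
  obtain ⟨j, hj⟩ : ∃ j : ℕ, y = 2 * j ∨ y = 2 * j + 1 := ⟨(y / 2).toNat, by omega⟩
  have hjr : j < r := by omega
  have hji : j ≠ i := by
    rintro rfl
    rcases hj with h | h <;> rw [h] at hx
    · rcases le_total (φ (2 * j)) (φ (2 * j + 1)) with h' | h'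
      · exact hx.1.ne' (min_eq_left h').symm
      · exact hx.2.ne (max_eq_left h').symm
    · rcases le_total (φ (2 * j)) (φ (2 * j + 1)) with h' | h'
      · exact hx.2.ne (max_eq_right h').symm
      · exact hx.1.ne' (min_eq_right h').symm
  have hne : ∀ k l : ℤ, 0 ≤ k → k < 2 * r → 0 ≤ l → l < 2 * r → k ≠ l → φ k ≠ φ l := by
    intro k l a1 a2 a3 a4 a5
    rcases lt_or_gt_of_ne a5 with h | h
    · exact E.angle_ne A he h (by omega)
    · exact (E.angle_ne A he h (by omega)).symm
  have hsame : ∀ a b : ℕ, altSign (2 * a) = altSign (2 * b) := fun a b => by simp [altSign]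
  have hrel : (SignType.sign (φ (2 * j + 1) - φ (2 * i)) : ℝ) -
      SignType.sign (φ (2 * j) - φ (2 * i)) - SignType.sign (φ (2 * j + 1) - φ (2 * i + 1)) +
      SignType.sign (φ (2 * j) - φ (2 * i + 1)) = 0 := by
    rcases lt_or_gt_of_ne hji with h | h
    · have := E.sign_relation A he (hsame j i) (by omega) (by omega)
      have anti : ∀ x y : ℝ, (SignType.sign (x - y) : ℝ) = -(SignType.sign (y - x) : ℝ) :=
        fun x y => by rw [← neg_sub y x, Left.sign_neg]; simp
      rw [anti (φ (2 * i + 1)) (φ (2 * j)), anti (φ (2 * i)) (φ (2 * j)),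
        anti (φ (2 * i + 1)) (φ (2 * j + 1)), anti (φ (2 * i)) (φ (2 * j + 1))] at this
      linarith
    · exact E.sign_relation A he (hsame i j) (by omega) (by omega)
  have hlt := abs_sub_lt_of_sign_relation (hne (2 * j) (2 * i) (by omega) (by omega) (by omega)
    (by omega) (by omega)) (hne (2 * j) (2 * i + 1) (by omega) (by omega) (by omega)
    (by omega) (by omega)) (hne (2 * j + 1) (2 * i) (by omega) (by omega) (by omega)
    (by omega) (by omega)) (hne (2 * j + 1) (2 * i + 1) (by omega) (by omega) (by omega)
    (by omega) (by omega)) hrel (by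
      rcases hj with h | h <;> rw [h] at hx
      · exact .inl hx
      · exact .inr hx)
  exact absurd (hmin j (Finset.mem_range.2 hjr)) (not_le.2 hlt)

lemma rebase (i : ℤ) : Y.IsEnumeration ξ r fun k => c (k + 2 * i) := by
  refine ⟨⟨E.admissible, E.subdivided, fun a b h => E.mono (by omega), fun j => ?_⟩, E.simple,
    E.r_pos, fun k => ?_, fun k => ?_⟩
  · rw [E.zero_iff]
    exact ⟨fun ⟨k, hk⟩ => ⟨k - 2 * i, by simpa using hk⟩, fun ⟨k, hk⟩ => ⟨_, hk⟩⟩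
  · rw [add_right_comm, E.shift]
  · rw [← mul_add]; exact E.up _

/-- After renumbering, the `0`-th and the first crossing are adjacent. -/
lemma exists_rebase (he : IsFrame ξ e) : ∃ (c' : ℤ → ℤ) (φ : ℤ → ℝ), Y.IsEnumeration ξ r c' ∧
    IsAngle Y ξ e c' φ ∧ ((∀ k, φ k = 0 ∨ φ 1 ≤ φ k) ∨ ∀ k, φ k ≤ φ 1) := by
  obtain ⟨φ, A⟩ := E.exists_isAngle he
  obtain ⟨i, hi⟩ := E.exists_free_chord he A
  have E' := E.rebase i
  obtain ⟨ψ, B⟩ := E'.exists_isAngle he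
  refine ⟨_, ψ, E', B, ?_⟩
  -- Angles measured from the new base point are the old differences, brought into [0, 2π).
  have hψ : ∀ k, ψ k = if φ (2 * i) ≤ φ (k + 2 * i) then φ (k + 2 * i) - φ (2 * i)
      else φ (k + 2 * i) - φ (2 * i) + 2 * Real.pi := by
    intro k
    have l1 := A.lt (k + 2 * i)
    have l2 := A.lt (2 * i)
    have n1 := A.nonneg (k + 2 * i)
    have n2 := A.nonneg (2 * i)
    have hexp : Complex.exp (ψ k * Complex.I) =
        Complex.exp ((φ (k + 2 * i) - φ (2 * i) : ℝ) * Complex.I) := by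
      have h1 := B.exp k
      simp only [zero_add] at h1
      rw [A.exp (k + 2 * i), A.exp (2 * i), ← mul_assoc] at h1
      have h2 := mul_right_cancel₀ (E.hor_ne_zero he 0) h1
      push_cast
      rw [sub_mul, Complex.exp_sub, h2, mul_div_cancel_right₀ _ (Complex.exp_ne_zero _)]
    split_ifs with h
    · exact angle_unique (B.nonneg k) (B.lt k) (by linarith) (by linarith) hexp
    · refine angle_unique (B.nonneg k) (B.lt k) (by linarith) (by linarith) ?_
      rw [hexp]
      push_cast
      rw [add_mul, Complex.exp_add, Complex.exp_two_pi_mul_I, mul_one]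
  have h1 : ψ 1 = if φ (2 * i) ≤ φ (2 * i + 1) then φ (2 * i + 1) - φ (2 * i)
      else φ (2 * i + 1) - φ (2 * i) + 2 * Real.pi := by
    rw [hψ, add_comm 1 (2 * i)]
  -- If the free chord runs counterclockwise, its end is the next crossing after the base point;
  -- otherwise it is the last one before returning to it.
  by_cases hc : φ (2 * i) ≤ φ (2 * i + 1)
  · left
    intro k
    have l1 := A.lt (2 * i + 1)
    have n1 := A.nonneg (k + 2 * i)
    have := hi (k + 2 * i)
    rw [min_eq_left hc, max_eq_right hc] at this
    rw [h1, if_pos hc, hψ]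
    split_ifs with h
    · rcases h.eq_or_lt with h2 | h2
      · left; linarith
      · right
        by_contra h3
        exact this ⟨h2, by linarith⟩
    · right; linarith
  · right
    intro k
    have l1 := A.lt (k + 2 * i)
    have n1 := A.nonneg (2 * i + 1)
    have := hi (k + 2 * i)
    rw [min_eq_right (not_le.1 hc).le, max_eq_left (not_le.1 hc).le] at this
    rw [h1, if_neg hc, hψ]
    split_ifs with h
    · linarith
    · have : φ (k + 2 * i) ≤ φ (2 * i + 1) := by
        by_contra h3
        exact this ⟨not_le.1 h3, not_le.1 h⟩
      linarith

/-- The permutation is obtained by sorting the crossings by their angles, after renumbering so that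
the chord with number 0 is free. -/
lemma exists_readsOff (he : IsFrame ξ e) : ∃ σ : Equiv.Perm (Fin (2 * r)), Y.ReadsOff ξ r σ := by
  obtain ⟨c', φ, E', A, hfree⟩ := E.exists_rebase he
  have hr := E.r_pos
  set f : Fin (2 * r) → ℝ := fun l => φ ((l : ℕ) : ℤ) with hf
  have hinj : Function.Injective f := by
    intro a b hab
    by_contra hne
    rcases lt_or_gt_of_ne (fun h => hne (Fin.ext h) : (a : ℕ) ≠ b) with h | h
    · exact E'.angle_ne A he (k := (a : ℕ)) (l := (b : ℕ)) (by omega) (by omega) hab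
    · exact E'.angle_ne A he (k := (b : ℕ)) (l := (a : ℕ)) (by omega) (by omega) hab.symm
  set σ := Tuple.sort f
  have hθ : StrictMono (f ∘ σ) :=
    (Tuple.monotone_sort f).strictMono_of_injective (hinj.comp σ.injective)
  have h0 := E'.angle_zero A he
  refine ⟨σ, E.subdivided, c', f ∘ σ, E'.mono, E'.shift, E'.zero_iff, E'.up, hθ,
    fun k => ⟨A.nonneg _, A.lt _⟩, fun k => ?_, σ.symm ⟨1, by omega⟩, by simp, ?_⟩
  · apply he.ext
    · rw [hor_add, hor_smul, hor_smul, he.hor_cross_axis, A.exp ((σ k : ℕ) : ℤ),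
        Complex.exp_mul_I]
      simp only [Function.comp_apply, hf]
      push_cast
      ring
    · rw [E'.zero, dotProduct_add, dotProduct_smul, dotProduct_smul, E'.zero]
      simp
  · set k := σ.symm ⟨1, by omega⟩ with hk
    have hk1 : (f ∘ σ) k = φ 1 := by simp [hk, hf]
    have hz : (f ∘ σ) (σ.symm ⟨0, by omega⟩) = 0 := by simp [hf, h0]
    have hz0 : σ.symm ⟨0, by omega⟩ = (⟨0, by omega⟩ : Fin (2 * r)) := by
      have : σ.symm ⟨0, by omega⟩ ≤ (⟨0, by omega⟩ : Fin (2 * r)) := by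
        rw [← hθ.le_iff_le, hz]
        exact A.nonneg _
      exact le_antisymm this (Fin.mk_le_of_le_val (Nat.zero_le _))
    have hk0 : (k : ℕ) ≠ 0 := by
      intro h
      have : k = σ.symm ⟨0, by omega⟩ := by rw [hz0]; exact Fin.ext h
      have := σ.symm.injective this
      simp at this
    rcases hfree with hfree | hfree
    · left
      by_contra hk2
      have h2 : (⟨1, by omega⟩ : Fin (2 * r)) < k := Fin.mk_lt_of_lt_val (by omega)
      have h3 := hθ h2
      rw [hk1] at h3
      have h4 : (f ∘ σ) ⟨0, by omega⟩ < (f ∘ σ) (⟨1, by omega⟩ : Fin (2 * r)) :=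
        hθ (Fin.mk_lt_of_lt_val (by simp))
      rw [← hz0, hz] at h4
      rcases hfree ((σ ⟨1, by omega⟩ : Fin (2 * r)) : ℕ) with h5 | h5
      · exact h4.ne' h5
      · exact absurd h3 (not_lt.2 h5)
    · right
      by_contra hk2
      have h2 : k < (⟨k + 1, by omega⟩ : Fin (2 * r)) := Fin.lt_def.2 (by simp)
      have h3 := hθ h2
      rw [hk1] at h3
      exact absurd h3 (not_lt.2 (hfree ((σ ⟨k + 1, by omega⟩ : Fin (2 * r)) : ℕ)))

end IsEnumeration

/-- The class of a polygon with an admissible direction is represented by a permutation. -/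
theorem exists_isRepresentedBy {W : SphPolygon} {ξ : V3} (hξ : ξ ⬝ᵥ ξ = 1) (hW : W.IsSimple)
    (hadm : W.IsAdmissible ξ) {r : ℕ} (hr : 0 < r) (hindex : W.index ξ = 1 - (r : ℤ)) :
    ∃ σ : Equiv.Perm (Fin (2 * r)), W.IsRepresentedBy ξ r σ := by
  obtain ⟨e, he⟩ := exists_isFrame hξ
  obtain ⟨Y, h1, h2, h3, h4, h5⟩ := W.exists_subdivided hξ hW hadm
  rw [index_eq_one_sub_upCount] at hindex
  obtain ⟨c, E⟩ := exists_isEnumeration h2 h3 h4 hr (by omega)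
  obtain ⟨σ, hσ⟩ := E.exists_readsOff he
  exact ⟨σ, Y, h1, hσ⟩

end SphPolygon

theorem theorem3 (W : SphPolygon) (hW : W.IsSimple) (ξ : V3) (hξ : ξ ⬝ᵥ ξ = 1)
    (hadm : W.IsAdmissible ξ) (r : ℕ) (hindex : W.index ξ = 1 - (r : ℤ))
    (hneg : W.index ξ < 0) :
    (∃ σ : Equiv.Perm (Fin (2 * r)), W.IsRepresentedBy ξ r σ) ∧
    (∀ σ : Equiv.Perm (Fin (2 * r)), W.IsRepresentedBy ξ r σ →
      W.HasNormalDegree ξ (-(numPos σ : ℤ) + (numNeg σ : ℤ))) ∧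
    (∀ σ τ : Equiv.Perm (Fin (2 * r)), W.IsRepresentedBy ξ r σ → W.IsRepresentedBy ξ r τ →
      -(numPos σ : ℤ) + (numNeg σ : ℤ) = -(numPos τ : ℤ) + (numNeg τ : ℤ)) := by
  have hr : 0 < r := by omega
  have hdeg : ∀ σ : Equiv.Perm (Fin (2 * r)), W.IsRepresentedBy ξ r σ →
      W.HasNormalDegree ξ (-(numPos σ : ℤ) + (numNeg σ : ℤ)) :=
    fun σ h => h.hasNormalDegree hW hadm hξ hr
  refine ⟨SphPolygon.exists_isRepresentedBy hξ hW hadm hr hindex, hdeg, fun σ τ hσ hτ => ?_⟩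
  -- Both expressions equal the number of crossings with one and the same transversal arc.
  obtain ⟨⟨u, hu⟩, h⟩ := hdeg σ hσ
  rw [← h u hu, (hdeg τ hτ).2 u hu]
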